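/- **Conventions.** Let $F_n$ be the free group on $x_1,\dots,x_n$, let $F_2$ be the free group on $a,b$ (elements of $F_2$ are identified with reduced words in $a^{\pm1},b^{\pm1}$), and let $B_n$ be the $n$-strand braid group with standard generators $\sigma_1,\dots,\sigma_{n-1}$. Actions are right actions. An automorphism of $F_n$ is *$i$-local* if it fixes $x_j$ for $j\neq i,i+1$ and maps $\langle x_i,x_{i+1}\rangle$ onto itself; equivalently it is $\mathrm{id}*\tau*\mathrm{id}$ for some $\tau\in\mathrm{Aut}(F_2)$, its *core* (with $a,b$ corresponding to $x_i,x_{i+1}$). A representation $\Theta:B_n\to\mathrm{Aut}(F_n)$ is *local* if each $\Theta(\sigma_i)$ is $i$-local; if $\tau_i$ is the core of $\Theta(\sigma_i)$, then $(\tau_1,\dots,\tau_{n-1})$, and the sequence of pairs of reduced words $(\tau_i(a),\tau_i(b))$, are said to *define* $\Theta$. For $n=3$ we say that the quadruple $(A,B,C,D)=(\tau_1(a),\tau_1(b),\tau_2(a),\tau_2(b))$ defines $\Theta$. The *natural symmetries* are: *inverse*, replacing each $\tau_i$ by $\tau_i^{-1}$ (the core of $\Theta(\sigma_i^{-1})$);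 *swap*, replacing the pairs $(A_i,B_i)_{1\le i\le n-1}$ by $(B_{n-i}^{\sigma},A_{n-i}^{\sigma})_{1\le i\le n-1}$, where $W^\sigma$ is $W$ with the letters $a,b$ interchanged (so $(A,B,C,D)\mapsto(D^\sigma,C^\sigma,B^\sigma,A^\sigma)$ for $n=3$); and *backward*, reading every word from right to left. "Up to natural symmetries" refers to the equivalence relation they generate. **Theorem (Classification of local $\mathrm{Aut}(F_3)$ and $\mathrm{Aut}(F_n)$ braid representations).** (1) Up to natural symmetries, a quadruple $(A,B,C,D)$ of reduced words in $a^{\pm1},b^{\pm1}$ defines a local $\mathrm{Aut}(F_3)$ representation of $B_3$ if and only if it is one of the following, with $r\in\mathbb Z_{\ge0}$: - $(T)$: $(a,b,a,b)$ - $(T')$: $(a,b^{-1},a^{-1},b)$ - $(A_r\text{-}1)$: $(a^rba^{-r},a,a^rba^{-r},a)$ - $(A_r\text{-}2)$: $(a^rba^{-r},a,a^rb^{-1}a^{-r},a^{-1})$ - $(A_r\text{-}3)$: $(a^rb^{-1}a^{-r},a^{-1},a^{-r}b^{-1}a^{r},a^{-1})$ - $(B\text{-}1)$: $(b^{-1},a,b^{-1},a)$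 - $(B\text{-}2)$: $(b^{-1},a,b,a^{-1})$ - $(C\text{-}1)$: $(ab^{-1}a,a,ab^{-1}a,a)$ - $(C\text{-}2)$: $(ab^{-1}a,a,aba,a^{-1})$ - $(C\text{-}3)$: $(aba,a^{-1},aba,a^{-1})$ - $(D\text{-}1)$: $(a^{-1}b^{-1}a,b^2a,a^{-1}b^{-1}a,b^2a)$ - $(D\text{-}2)$: $(aba^{-1},b^2a^{-1},a^{-1}b^{-1}a,b^2a)$ - $(D\text{-}3)$: $(a^{-1}b^{-1}a,b^2a,a^{-1}ba,a^{-1}b^2)$ - $(D\text{-}4)$: $(aba^{-1},b^2a^{-1},a^{-1}ba,a^{-1}b^2)$ (2) A local $\mathrm{Aut}(F_n)$ representation is defined by exactly one sequence of cores, and $(\tau_1,\dots,\tau_{n-1})\in\mathrm{Aut}(F_2)^{n-1}$ defines a local $\mathrm{Aut}(F_n)$ representation if and only if $(\tau_i,\tau_{i+1})$ defines a local $\mathrm{Aut}(F_3)$ representation for each $1\le i\le n-2$. (3) Let $\Gamma$ be the oriented graph whose vertices $v$ are the following pairs of reduced words $(\tau_v(a),\tau_v(b))$ and whose oriented edges are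 the following: - $[T]$: vertex $(a,b)$, with a loop. - $[T']$: an edge $(a,b^{-1})\to(a^{-1},b)$. - $[A_r]$, $r\ge0$: vertices $v_1=(a^rba^{-r},a)$, $v_2=(a^rb^{-1}a^{-r},a^{-1})$, $v_3=(a^{-r}ba^{r},a)$, $v_4=(a^{-r}b^{-1}a^{r},a^{-1})$ (for $r=0$, $v_1=v_3$ and $v_2=v_4$), with edges $v_1\to v_1,v_2$; $v_2\to v_3,v_4$; $v_3\to v_3,v_4$; $v_4\to v_1,v_2$. - $[B]$: vertices $(b^{-1},a)$, $(b,a^{-1})$, with all four possible edges (loops included). - $[C]$: vertices $(ab^{-1}a,a)$, $(aba,a^{-1})$, with all four possible edges (loops included). - $[D]$: vertices $v_1=(a^{-1}b^{-1}a,b^2a)$, $v_2=(aba^{-1},b^2a^{-1})$, $v_3=(a^{-1}ba,a^{-1}b^2)$, $v_4=(ab^{-1}a^{-1},ab^2)$, with edges $v_1\to v_1,v_3$; $v_2\to v_1,v_3$; $v_3\to v_2,v_4$; $v_4\to v_2,v_4$. For vertices $v,w$ of $\Gamma$ there is an edge from $v$ to $w$ if and only if $(\tau_v,\tau_w)$ defines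 a local $\mathrm{Aut}(F_3)$ representation. For $n\ge3$, every oriented edge-path of $\Gamma$ of length $n-2$, passing through $v_1,\dots,v_{n-1}$ in this order, gives exactly one local $\mathrm{Aut}(F_n)$ representation with cores $\tau_{v_1},\dots,\tau_{v_{n-1}}$; and a sequence of $n-1$ pairs of reduced words defines a local $\mathrm{Aut}(F_n)$ representation if and only if it is, up to natural symmetries, the sequence of vertices passed by such an edge-path. -/

import Mathlib

namespace LocalBraid

/-! ### Braid groups and local representations -/

/-- The defining relators of the braid group on `m + 1` strands, with Artin generators indexed by
`Fin m`: far commutation and the braid relation. -/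
def braidRels (m : ℕ) : Set (FreeGroup (Fin m)) :=
  {w | ∃ i j : Fin m, i.val + 1 < j.val ∧
      w = FreeGroup.of i * FreeGroup.of j * (FreeGroup.of j * FreeGroup.of i)⁻¹} ∪
  {w | ∃ i j : Fin m, i.val + 1 = j.val ∧
      w = FreeGroup.of i * FreeGroup.of j * FreeGroup.of i *
        (FreeGroup.of j * FreeGroup.of i * FreeGroup.of j)⁻¹}

/-- The braid group `B_{m+1}` on `m + 1` strands. -/
abbrev BraidGroup (m : ℕ) : Type := PresentedGroup (braidRels m)

/-- The standard generators of `B_{m+1}`. -/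
def sigma {m : ℕ} (i : Fin m) : BraidGroup m := PresentedGroup.of i

/-- A right action of `B_{m+1}` on the free group `F_{m+1}` by automorphisms: `(x)Θ(β)` is
`(Θ β).unop x`, and `(x)Θ(βγ) = ((x)Θ(β))Θ(γ)`. -/
abbrev BraidRep (m : ℕ) : Type := BraidGroup m →* (MulAut (FreeGroup (Fin (m + 1))))ᵐᵒᵖ

/-- The free group `F₂` on the letters `a`, `b`. Each element is identified with the unique
reduced word representing it (`FreeGroup.toWord`). -/
abbrev F2 : Type := FreeGroup (Fin 2)

/-- The letter `a`. -/
abbrev a : F2 := FreeGroup.of 0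

/-- The letter `b`. -/
abbrev b : F2 := FreeGroup.of 1

/-- The homomorphism `F₂ → F_{m+1}` sending `a, b` to the `i`-th and `(i+1)`-st free generators. -/
def incl {m : ℕ} (i : Fin m) : F2 →* FreeGroup (Fin (m + 1)) :=
  FreeGroup.map ![i.castSucc, i.succ]

/-- `φ` is `i`-local: it fixes every generator other than the `i`-th and `(i+1)`-st, and maps the
subgroup generated by these two onto itself. -/
def IsLocalAut {m : ℕ} (i : Fin m) (φ : MulAut (FreeGroup (Fin (m + 1)))) : Prop :=
  (∀ j, j ≠ i.castSucc → j ≠ i.succ → φ (FreeGroup.of j) = FreeGroup.of j) ∧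
  (Subgroup.closure {FreeGroup.of i.castSucc, FreeGroup.of i.succ}).map φ.toMonoidHom =
    Subgroup.closure {FreeGroup.of i.castSucc, FreeGroup.of i.succ}

/-- `τ ∈ Aut(F₂)` is the core of `φ` at position `i`, i.e. `φ = id * τ * id`. -/
def IsCore {m : ℕ} (i : Fin m) (τ : MulAut F2) (φ : MulAut (FreeGroup (Fin (m + 1)))) : Prop :=
  (∀ j, j ≠ i.castSucc → j ≠ i.succ → φ (FreeGroup.of j) = FreeGroup.of j) ∧
  ∀ w : F2, φ (incl i w) = incl i (τ w)

/-- A representation is local if the image of each `σ_i` is `i`-local. -/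
def BraidRep.IsLocal {m : ℕ} (Θ : BraidRep m) : Prop :=
  ∀ i : Fin m, IsLocalAut i (Θ (sigma i)).unop

/-- `Θ` is the (local) representation with cores `τ_1, …, τ_m`. -/
def BraidRep.HasCores {m : ℕ} (Θ : BraidRep m) (τ : Fin m → MulAut F2) : Prop :=
  ∀ i : Fin m, IsCore i (τ i) (Θ (sigma i)).unop

/-- The automorphisms `τ_1, …, τ_m` define a local `Aut(F_{m+1})` representation. -/
def Defines {m : ℕ} (τ : Fin m → MulAut F2) : Prop :=
  ∃ Θ : BraidRep m, Θ.HasCores τ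

/-! ### Words -/

/-- A pair of reduced words, recording the images of `a` and `b` under an automorphism. -/
abbrev WordPair : Type := F2 × F2

/-- The pairs of reduced words `(τ_i(a), τ_i(b))`. -/
def coreWords {m : ℕ} (τ : Fin m → MulAut F2) : Fin m → WordPair :=
  fun i => (τ i a, τ i b)

/-- `Θ` is a local representation whose cores are given by the pairs of words `w`. -/
def BraidRep.HasCoreWords {m : ℕ} (Θ : BraidRep m) (w : Fin m → WordPair) : Prop :=
  ∃ τ : Fin m → MulAut F2, coreWords τ = w ∧ Θ.HasCores τ

/-- The pairs of words `w` define a local `Aut(F_{m+1})` representation. -/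
def WordsDefine {m : ℕ} (w : Fin m → WordPair) : Prop :=
  ∃ Θ : BraidRep m, Θ.HasCoreWords w

/-- A quadruple of words `(A, B, C, D)`, as the data of two cores. -/
abbrev quad (A B C D : F2) : Fin 2 → WordPair := ![(A, B), (C, D)]

/-! ### Natural symmetries -/

/-- Interchange the letters `a` and `b` in a word. -/
def swapLetters (W : F2) : F2 := FreeGroup.map (Equiv.swap (0 : Fin 2) 1) W

/-- Read a reduced word backward (the signs of the letters are kept). -/
def readBackward (W : F2) : F2 := FreeGroup.mk W.toWord.reverse

/-- The three elementary natural symmetries. For `quad A B C D`, swap gives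
`quad D^σ C^σ B^σ A^σ`, and backward reverses each of the four words. The inverse symmetry replaces
the core `τ_i` of `Θ(σ_i)` by the core `τ_i⁻¹` of `Θ(σ_i⁻¹)`. -/
inductive SymmetryStep {m : ℕ} : (Fin m → WordPair) → (Fin m → WordPair) → Prop
  | inverse (τ : Fin m → MulAut F2) :
      SymmetryStep (coreWords τ) (coreWords fun i => (τ i)⁻¹)
  | swap (w : Fin m → WordPair) :
      SymmetryStep w (fun i => (swapLetters (w i.rev).2, swapLetters (w i.rev).1))
  | backward (w : Fin m → WordPair) :
      SymmetryStep w (fun i => (readBackward (w i).1, readBackward (w i).2))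

/-- `w` and `w'` agree up to natural symmetries. -/
def SymmEquiv {m : ℕ} (w w' : Fin m → WordPair) : Prop :=
  Relation.EqvGen SymmetryStep w w'

/-! ### The list of quadruples -/

/-- The explicit list of quadruples `(A, B, C, D)`. -/
inductive Listed : F2 → F2 → F2 → F2 → Prop
  | T : Listed a b a b
  | T' : Listed a b⁻¹ a⁻¹ b
  | A1 (r : ℕ) : Listed (a ^ r * b * (a ^ r)⁻¹) a (a ^ r * b * (a ^ r)⁻¹) a
  | A2 (r : ℕ) : Listed (a ^ r * b * (a ^ r)⁻¹) a (a ^ r * b⁻¹ * (a ^ r)⁻¹) a⁻¹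
  | A3 (r : ℕ) : Listed (a ^ r * b⁻¹ * (a ^ r)⁻¹) a⁻¹ ((a ^ r)⁻¹ * b⁻¹ * a ^ r) a⁻¹
  | B1 : Listed b⁻¹ a b⁻¹ a
  | B2 : Listed b⁻¹ a b a⁻¹
  | C1 : Listed (a * b⁻¹ * a) a (a * b⁻¹ * a) a
  | C2 : Listed (a * b⁻¹ * a) a (a * b * a) a⁻¹
  | C3 : Listed (a * b * a) a⁻¹ (a * b * a) a⁻¹
  | D1 : Listed (a⁻¹ * b⁻¹ * a) (b ^ 2 * a) (a⁻¹ * b⁻¹ * a) (b ^ 2 * a)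
  | D2 : Listed (a * b * a⁻¹) (b ^ 2 * a⁻¹) (a⁻¹ * b⁻¹ * a) (b ^ 2 * a)
  | D3 : Listed (a⁻¹ * b⁻¹ * a) (b ^ 2 * a) (a⁻¹ * b * a) (a⁻¹ * b ^ 2)
  | D4 : Listed (a * b * a⁻¹) (b ^ 2 * a⁻¹) (a⁻¹ * b * a) (a⁻¹ * b ^ 2)

/-! ### The oriented graph `Γ` -/

/-- The four vertices of the component `A_r`; for `r = 0` the first and third coincide, and so do
the second and fourth. -/
def vA (r : ℕ) : Fin 4 → WordPair :=
  ![(a ^ r * b * (a ^ r)⁻¹, a),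
    (a ^ r * b⁻¹ * (a ^ r)⁻¹, a⁻¹),
    ((a ^ r)⁻¹ * b * a ^ r, a),
    ((a ^ r)⁻¹ * b⁻¹ * a ^ r, a⁻¹)]

/-- The two vertices of the component `B`. -/
def vB : Fin 2 → WordPair := ![(b⁻¹, a), (b, a⁻¹)]

/-- The two vertices of the component `C`. -/
def vC : Fin 2 → WordPair := ![(a * b⁻¹ * a, a), (a * b * a, a⁻¹)]

/-- The four vertices of the component `D`. -/
def vD : Fin 4 → WordPair :=
  ![(a⁻¹ * b⁻¹ * a, b ^ 2 * a),
    (a * b * a⁻¹, b ^ 2 * a⁻¹),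
    (a⁻¹ * b * a, a⁻¹ * b ^ 2),
    (a * b⁻¹ * a⁻¹, a * b ^ 2)]

/-- The vertices of `Γ`: pairs of reduced words `(τ_v(a), τ_v(b))`. -/
inductive IsVertex : WordPair → Prop
  | T : IsVertex (a, b)
  | T'1 : IsVertex (a, b⁻¹)
  | T'2 : IsVertex (a⁻¹, b)
  | A (r : ℕ) (k : Fin 4) : IsVertex (vA r k)
  | B (k : Fin 2) : IsVertex (vB k)
  | C (k : Fin 2) : IsVertex (vC k)
  | D (k : Fin 4) : IsVertex (vD k)

/-- The oriented edges of `Γ`. -/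
inductive IsEdge : WordPair → WordPair → Prop
  | T : IsEdge (a, b) (a, b)
  | T' : IsEdge (a, b⁻¹) (a⁻¹, b)
  | A00 (r : ℕ) : IsEdge (vA r 0) (vA r 0)
  | A01 (r : ℕ) : IsEdge (vA r 0) (vA r 1)
  | A12 (r : ℕ) : IsEdge (vA r 1) (vA r 2)
  | A13 (r : ℕ) : IsEdge (vA r 1) (vA r 3)
  | A22 (r : ℕ) : IsEdge (vA r 2) (vA r 2)
  | A23 (r : ℕ) : IsEdge (vA r 2) (vA r 3)
  | A30 (r : ℕ) : IsEdge (vA r 3) (vA r 0)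
  | A31 (r : ℕ) : IsEdge (vA r 3) (vA r 1)
  | B (k l : Fin 2) : IsEdge (vB k) (vB l)
  | C (k l : Fin 2) : IsEdge (vC k) (vC l)
  | D00 : IsEdge (vD 0) (vD 0)
  | D02 : IsEdge (vD 0) (vD 2)
  | D10 : IsEdge (vD 1) (vD 0)
  | D12 : IsEdge (vD 1) (vD 2)
  | D21 : IsEdge (vD 2) (vD 1)
  | D23 : IsEdge (vD 2) (vD 3)
  | D31 : IsEdge (vD 3) (vD 1)
  | D33 : IsEdge (vD 3) (vD 3)

/-- The oriented graph `Γ`. -/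
def Gamma : Digraph {v : WordPair // IsVertex v} where
  Adj v w := IsEdge v.1 w.1

/-- The vertices `γ_1, …, γ_m` are passed in this order by an oriented edge-path of `Γ` (of length
`m - 1`; such a path is determined by its vertices, as `Γ` has no parallel edges). -/
def IsEdgePath {m : ℕ} (γ : Fin m → {v : WordPair // IsVertex v}) : Prop :=
  ∀ i j : Fin m, i.val + 1 = j.val → Gamma.Adj (γ i) (γ j)

/-- The pairs of words attached to the vertices passed by a path. -/
def pathWords {m : ℕ} (γ : Fin m → {v : WordPair // IsVertex v}) : Fin m → WordPair :=
  fun i => (γ i).1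

end LocalBraid

open LocalBraid (BraidRep F2 WordPair quad WordsDefine Defines SymmEquiv Listed IsVertex Gamma
  IsEdgePath pathWords)

/-! Far commutation of local automorphisms is automatic, and the braid relation at consecutive
positions lives in a copy of the free group on `x₁, x₂, x₃`. So everything reduces to pairs of cores
with `Braid s t` (`defines_iff_braid`).

Abelianizing the relation gives integer equations in the exponent sums, with five families of
solutions (`integer_equations`). In the diagonal family the two automorphisms induce the same
involution on homology. Comparing them along the augmentation filtration of the rational group ring
shows that they are equal (`eq_of_braid_of_expSum`), and this leaves only T and T'.

In the other families, put `A = s a` and `C = t a`. Evaluating the relation at `x₁` shows that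
`A(x₁, C(x₂, x₃))` is fixed by the local automorphism with core `s` (`Braid.fixed`). This
automorphism fixes `x₃` and preserves `⟨x₁, x₂⟩`, so the blocks between powers of `x₃` are fixed by
`s`. As both off-diagonal exponent sums of `s` are nonzero, no element fixed by `s` has exactly one
vanishing exponent sum. This forces `C`, and `A` up to one exceptional alternative, to have at most
three syllables (`structure_of_fixed`); the swap symmetry treats `s b` and `t b`. Substituting these
shapes into the fixed blocks leaves equations in `F₂`, settled by syllables, by traces in `SL₂(ℤ)`
and by the quotient `S₃`.

The outcome is `Braid.classify`: a braid pair is an edge of `Γ`, or an edge of the swapped graph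
with neither end a vertex of `Γ`. Hence a sequence of cores stays entirely in one of the two graphs,
and a single swap brings it to a path of `Γ`. Conversely the edges satisfy the relation by
computation on generators (`IsEdge.wordBraid`), and the backward, inverse and swap symmetries carry
every edge into the list (`IsEdge.equivListed`). -/

namespace LocalBraid

/-! ### First and last letters of reduced words -/

section Words

variable {α : Type*} [DecidableEq α]

/-- The generator underlying the first letter of the reduced word of `w`. -/
def firstGen (w : FreeGroup α) : Option α := w.toWord.head?.map Prod.fst

/-- The generator underlying the last letter of the reduced word of `w`. -/
def lastGen (w : FreeGroup α) : Option α := w.toWord.getLast?.map Prod.fst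

@[simp] lemma firstGen_one : firstGen (1 : FreeGroup α) = none := by simp [firstGen]

lemma firstGen_eq_none {w : FreeGroup α} : firstGen w = none ↔ w = 1 := by
  simp [firstGen]

lemma lastGen_inv (w : FreeGroup α) : lastGen w⁻¹ = firstGen w := by
  simp [lastGen, firstGen, FreeGroup.toWord_inv, FreeGroup.invRev, Function.comp_def]

lemma firstGen_inv (w : FreeGroup α) : firstGen w⁻¹ = lastGen w := by
  rw [← lastGen_inv, inv_inv]

/-- Different generators at the junction exclude not only cancellation but also the merging of
syllables, which is the form needed below. -/
lemma toWord_mul_of_ne {u v : FreeGroup α} (h : ∀ s, lastGen u = some s → firstGen v ≠ some s) :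
    (u * v).toWord = u.toWord ++ v.toWord := by
  rw [FreeGroup.toWord_mul, FreeGroup.IsReduced.reduce_eq]
  refine List.IsChain.append FreeGroup.isReduced_toWord FreeGroup.isReduced_toWord ?_
  intro x hx y hy hxy
  refine absurd ?_ (h x.1 ?_)
  · simp only [firstGen, Option.mem_def] at *
    simp [hy, hxy]
  · simp only [lastGen, Option.mem_def] at *
    simp [hx]

lemma firstGen_mul {u v : FreeGroup α} (h : ∀ s, lastGen u = some s → firstGen v ≠ some s)
    (hu : u ≠ 1) : firstGen (u * v) = firstGen u := by
  rw [firstGen, toWord_mul_of_ne h, firstGen, List.head?_append_of_ne_nil]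
  simpa using hu

lemma toWord_zpow (s : α) (k : ℤ) :
    (FreeGroup.of s ^ k).toWord = List.replicate k.natAbs (s, decide (0 ≤ k)) := by
  obtain ⟨n, rfl | rfl⟩ := k.eq_nat_or_neg
  · simp
  · rcases n.eq_zero_or_pos with rfl | hn
    · simp
    · have : ¬ (n : ℤ) ≤ 0 := by omega
      simp [FreeGroup.toWord_inv, FreeGroup.invRev, hn.ne']

lemma firstGen_zpow (s : α) {k : ℤ} (hk : k ≠ 0) : firstGen (FreeGroup.of s ^ k) = some s := by
  simp [firstGen, toWord_zpow, hk, List.head?_replicate]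

lemma lastGen_zpow (s : α) {k : ℤ} (hk : k ≠ 0) : lastGen (FreeGroup.of s ^ k) = some s := by
  simp [lastGen, toWord_zpow, hk, List.getLast?_replicate]

lemma firstGen_zpow_mul (s : α) {k : ℤ} (hk : k ≠ 0) {v : FreeGroup α}
    (hv : firstGen v ≠ some s) : firstGen (FreeGroup.of s ^ k * v) = some s := by
  rw [firstGen_mul, firstGen_zpow s hk]
  · rw [lastGen_zpow s hk]; rintro _ ⟨⟩; exact hv
  · intro h; have := firstGen_zpow s hk; rw [h] at this; simp at this

/-- The elements of a free group whose reduced words only involve generators in `S`. -/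
def lettersIn (S : Set α) : Subgroup (FreeGroup α) where
  carrier := {w | ∀ p ∈ w.toWord, p.1 ∈ S}
  one_mem' := by simp
  mul_mem' := by
    intro u v hu hv p hp
    have := (FreeGroup.toWord_mul_sublist u v).subset hp
    rcases List.mem_append.1 this with h | h
    exacts [hu p h, hv p h]
  inv_mem' := by
    intro u hu p hp
    simp only [FreeGroup.toWord_inv, FreeGroup.invRev, List.mem_reverse, List.mem_map] at hp
    obtain ⟨q, hq, rfl⟩ := hp
    exact hu q hq

lemma mem_lettersIn {S : Set α} {w : FreeGroup α} :
    w ∈ lettersIn S ↔ ∀ p ∈ w.toWord, p.1 ∈ S := Iff.rfl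

lemma lettersIn_mono {S T : Set α} (h : S ⊆ T) : lettersIn S ≤ lettersIn T :=
  fun _ hw p hp => h (hw p hp)

lemma firstGen_mem {S : Set α} {w : FreeGroup α} (hw : w ∈ lettersIn S) {s : α}
    (hs : firstGen w = some s) : s ∈ S := by
  simp only [firstGen, Option.map_eq_some_iff] at hs
  obtain ⟨p, hp, rfl⟩ := hs
  exact hw p (List.mem_of_mem_head? hp)

lemma lastGen_mem {S : Set α} {w : FreeGroup α} (hw : w ∈ lettersIn S) {s : α}
    (hs : lastGen w = some s) : s ∈ S := by
  rw [← firstGen_inv] at hs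
  exact firstGen_mem (inv_mem hw) hs

lemma mk_eq_zpow {s : α} {l : List (α × Bool)} (h : ∀ p ∈ l, p.1 = s) :
    ∃ k : ℤ, FreeGroup.mk l = FreeGroup.of s ^ k := by
  induction l with
  | nil => exact ⟨0, by simp [FreeGroup.one_eq_mk]⟩
  | cons p l ih =>
    obtain ⟨k, hk⟩ := ih fun q hq => h q (List.mem_cons_of_mem _ hq)
    obtain ⟨t, e⟩ := p
    obtain rfl : t = s := h (t, e) List.mem_cons_self
    have : FreeGroup.mk ((t, e) :: l) = FreeGroup.mk [(t, e)] * FreeGroup.mk l := by simp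
    rw [this, hk]
    cases e
    · refine ⟨-1 + k, ?_⟩
      rw [zpow_add, zpow_neg_one]; rfl
    · refine ⟨1 + k, ?_⟩
      rw [zpow_add, zpow_one]; rfl

lemma eq_zpow_of_mem_lettersIn {s : α} {w : FreeGroup α} (h : w ∈ lettersIn {s}) :
    ∃ k : ℤ, w = FreeGroup.of s ^ k := by
  obtain ⟨k, hk⟩ := mk_eq_zpow (s := s) (l := w.toWord) h
  exact ⟨k, by rw [← hk, FreeGroup.mk_toWord]⟩

lemma toWord_mk_of_append {w : FreeGroup α} {l₁ l₂ : List (α × Bool)} (h : w.toWord = l₁ ++ l₂) :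
    (FreeGroup.mk l₁).toWord = l₁ ∧ (FreeGroup.mk l₂).toWord = l₂ ∧
      w = FreeGroup.mk l₁ * FreeGroup.mk l₂ := by
  have hw : FreeGroup.IsReduced (l₁ ++ l₂) := h ▸ FreeGroup.isReduced_toWord
  refine ⟨?_, ?_, ?_⟩
  · rw [FreeGroup.toWord_mk]
    exact (hw.infix ⟨[], l₂, by simp⟩).reduce_eq
  · rw [FreeGroup.toWord_mk]
    exact (hw.infix ⟨l₁, [], by simp⟩).reduce_eq
  · rw [FreeGroup.mul_mk, ← h, FreeGroup.mk_toWord]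

/-- Split off the maximal initial block of letters whose generator satisfies `P`. -/
lemma exists_split (P : α → Prop) [DecidablePred P] (w : FreeGroup α) :
    ∃ u v : FreeGroup α, w = u * v ∧ w.toWord = u.toWord ++ v.toWord ∧ u ∈ lettersIn {s | P s} ∧
      ∀ s, firstGen v = some s → ¬ P s := by
  obtain ⟨h1, h2, h3⟩ := toWord_mk_of_append
    (List.takeWhile_append_dropWhile (p := fun q : α × Bool => decide (P q.1))
      (l := w.toWord)).symm
  refine ⟨_, _, h3, by rw [h1, h2, List.takeWhile_append_dropWhile], ?_, ?_⟩
  · rw [mem_lettersIn, h1]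
    intro p hp
    simpa using List.mem_takeWhile_imp hp
  · intro s hs
    rw [firstGen, h2] at hs
    simp only [Option.map_eq_some_iff] at hs
    obtain ⟨p, hp, rfl⟩ := hs
    have := List.head?_dropWhile_not (fun q : α × Bool => decide (P q.1)) w.toWord
    rw [hp] at this
    simpa using this

/-- Split off the first syllable if it is a power of `s`. -/
lemma exists_zpow_mul (s : α) (w : FreeGroup α) :
    ∃ (k : ℤ) (v : FreeGroup α), w = FreeGroup.of s ^ k * v ∧ firstGen v ≠ some s ∧
      v.norm ≤ w.norm ∧ (firstGen w = some s → k ≠ 0 ∧ v.norm < w.norm) ∧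
      ∀ S, w ∈ lettersIn S → v ∈ lettersIn S := by
  obtain ⟨u, v, hw, hl, hu, hv⟩ := exists_split (· = s) w
  obtain ⟨k, rfl⟩ := eq_zpow_of_mem_lettersIn hu
  refine ⟨k, v, hw, fun h => hv s h rfl, ?_, ?_, ?_⟩
  · simp [FreeGroup.norm, hl]
  · intro h
    have hk : k ≠ 0 := by
      rintro rfl
      simp only [zpow_zero, one_mul] at hw
      exact hv s (hw ▸ h) rfl
    refine ⟨hk, ?_⟩
    simp [FreeGroup.norm, hl, toWord_zpow, hk]
  · intro S hS p hp
    exact hS p (by rw [hl]; exact List.mem_append_right _ hp)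

/-- An element of a subgroup generated by some of the generators followed by an element whose word
begins with another generator. -/
lemma firstGen_mul_of_mem {S : Set α} {u v : FreeGroup α} (hu : u ∈ lettersIn S) (hu1 : u ≠ 1)
    (hv : ∀ s ∈ S, firstGen v ≠ some s) : firstGen (u * v) = firstGen u :=
  firstGen_mul (fun s hs => hv s (lastGen_mem hu hs)) hu1

/-! ### Fixed elements of an endomorphism acting on a free factor -/

variable {z : α} {φ : FreeGroup α →* FreeGroup α}

/-- A nontrivial initial block without `z` goes to a nontrivial block without `z`, and by induction
what follows it still begins with `z`; nothing cancels at the junction, so the image begins inside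
the image of the initial block. -/
lemma firstGen_map_ne (hz : φ (FreeGroup.of z) = FreeGroup.of z) (hφ : Function.Injective φ)
    (hm : ∀ u ∈ lettersIn {s | s ≠ z}, φ u ∈ lettersIn {s | s ≠ z}) (v : FreeGroup α)
    (hv : firstGen v ≠ some z) : firstGen (φ v) ≠ some z := by
  induction hn : v.norm using Nat.strong_induction_on generalizing v with
  | _ n ih =>
  obtain ⟨u, v', hw, hl, hu, hv'⟩ := exists_split (· ≠ z) v
  obtain ⟨k, v'', hw', hv'', -, hk, -⟩ := exists_zpow_mul z v'
  by_cases hv1 : v' = 1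
  · rw [hw, hv1, mul_one]
    intro h
    exact firstGen_mem (hm u hu) h rfl
  have hfv : firstGen v' = some z := by
    cases h : firstGen v' with
    | none => exact absurd (firstGen_eq_none.1 h) hv1
    | some t => by_contra hne; exact hv' t h (fun e => hne (by rw [e]))
  obtain ⟨hk0, hlt⟩ := hk hfv
  have hu1 : u ≠ 1 := by
    rintro rfl
    rw [one_mul] at hw
    exact hv (hw ▸ hfv)
  have hvn : v'.norm ≤ v.norm := by simp [FreeGroup.norm, hl]
  have h1 := ih v''.norm (by omega) v'' hv'' rfl
  have h2 : firstGen (φ v') = some z := by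
    rw [hw', map_mul, map_zpow, hz]
    exact firstGen_zpow_mul z hk0 h1
  rw [hw, map_mul, firstGen_mul_of_mem (hm u hu) (by simpa using (map_ne_one_iff φ hφ).2 hu1)]
  · intro h; exact firstGen_mem (hm u hu) h rfl
  · intro s hs h
    rw [h2] at h
    exact hs (Option.some_injective _ h).symm

/-- If the first `z`-syllable of an element is preceded by `u`, and the element is fixed by an
injective endomorphism that fixes `z` and preserves the complementary free factor, then `u` and the
rest are fixed. -/
lemma fixed_of_fixed_mul (hz : φ (FreeGroup.of z) = FreeGroup.of z) (hφ : Function.Injective φ)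
    (hm : ∀ u ∈ lettersIn {s | s ≠ z}, φ u ∈ lettersIn {s | s ≠ z}) {u v : FreeGroup α} {k : ℤ}
    (hu : u ∈ lettersIn {s | s ≠ z}) (hk : k ≠ 0) (hv : firstGen v ≠ some z)
    (h : φ (u * FreeGroup.of z ^ k * v) = u * FreeGroup.of z ^ k * v) : φ u = u ∧ φ v = v := by
  -- The initial `z`-free block can be read off the reduced word, so it is determined by the
  -- element; applied to both sides of `h` this gives `φ u = u`.
  have key : ∀ u' v' : FreeGroup α, u' ∈ lettersIn {s | s ≠ z} → firstGen v' ≠ some z →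
      (u' * FreeGroup.of z ^ k * v').toWord.takeWhile (fun p => decide (p.1 ≠ z)) = u'.toWord := by
    intro u' v' hu' hv'
    have h1 := firstGen_zpow_mul z hk hv'
    rw [mul_assoc, toWord_mul_of_ne, List.takeWhile_append_of_pos]
    · have : (FreeGroup.of z ^ k * v').toWord.takeWhile (fun p => decide (p.1 ≠ z)) = [] := by
        rw [firstGen, Option.map_eq_some_iff] at h1
        obtain ⟨p, hp, hpz⟩ := h1
        rw [List.head?_eq_some_iff] at hp
        obtain ⟨l, hl⟩ := hp
        rw [hl, List.takeWhile_cons_of_neg (by simp [hpz])]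
      rw [this, List.append_nil]
    · intro p hp
      simpa using hu' p hp
    · intro s hs h2
      rw [h1] at h2
      exact lastGen_mem hu' hs (Option.some_injective _ h2).symm
  have h3 : φ u = u := by
    apply FreeGroup.toWord_injective
    rw [← key _ _ (hm u hu) (firstGen_map_ne hz hφ hm v hv), ← key u v hu hv]
    rw [map_mul, map_mul, map_zpow, hz] at h
    rw [h]
  refine ⟨h3, ?_⟩
  rw [map_mul, map_mul, map_zpow, hz, h3] at h
  exact mul_left_cancel h

end Words

/-! ### Exponent sums -/

section Exponents

variable {α : Type*} [DecidableEq α]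

/-- The exponent sum of the generator `s`, as a homomorphism. -/
def expHom (s : α) : FreeGroup α →* Multiplicative ℤ :=
  FreeGroup.lift fun t => Multiplicative.ofAdd (if t = s then 1 else 0)

/-- The exponent sum of the generator `s`. -/
def expSum (s : α) (w : FreeGroup α) : ℤ := (expHom s w).toAdd

@[simp] lemma expSum_one (s : α) : expSum s 1 = 0 := by simp [expSum]

@[simp] lemma expSum_mul (s : α) (u v : FreeGroup α) :
    expSum s (u * v) = expSum s u + expSum s v := by simp [expSum]

@[simp] lemma expSum_inv (s : α) (u : FreeGroup α) : expSum s u⁻¹ = -expSum s u := by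
  simp [expSum]

@[simp] lemma expSum_zpow (s : α) (u : FreeGroup α) (k : ℤ) :
    expSum s (u ^ k) = k * expSum s u := by simp [expSum]

@[simp] lemma expSum_pow (s : α) (u : FreeGroup α) (k : ℕ) :
    expSum s (u ^ k) = k * expSum s u := by simp [expSum]

lemma expSum_of (s t : α) : expSum s (FreeGroup.of t) = if t = s then 1 else 0 := by
  simp [expSum, expHom]

lemma expSum_map {β : Type*} [DecidableEq β] [Fintype α] (f : FreeGroup α →* FreeGroup β) (s : β)
    (w : FreeGroup α) :
    expSum s (f w) = ∑ t, expSum t w * expSum s (f (FreeGroup.of t)) := by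
  induction w using FreeGroup.induction_on with
  | C1 => simp
  | of x => simp [expSum_of]
  | inv_of x h => simp only [map_inv, expSum_inv, h, neg_mul, Finset.sum_neg_distrib]
  | mul x y hx hy => simp only [map_mul, expSum_mul, hx, hy, add_mul, Finset.sum_add_distrib]

end Exponents

/-! ### The augmentation filtration of the rational group ring of a free group -/

section Augmentation

variable {α : Type*} [DecidableEq α]

/-- A filtered form of: conjugate operators satisfying the braid relation and inducing the same
involution on the graded pieces agree to all orders. -/
lemma sub_mem_of_braid {V : Type*} [AddCommGroup V] [Module ℚ V] {F : ℕ → Submodule ℚ V}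
    (hF : Antitone F) {X Y : V →ₗ[ℚ] V} (hY : ∀ d, ∀ v ∈ F d, Y v ∈ F d)
    (hXY : ∀ d, ∀ v ∈ F d, X v - Y v ∈ F (d + 1))
    (hYY : ∀ d, ∀ v ∈ F d, Y (Y v) - v ∈ F (d + 1))
    (hb : ∀ v, X (Y (X v)) = Y (X (Y v))) (s : ℕ) :
    ∀ d, ∀ v ∈ F d, X v - Y v ∈ F (d + s + 1) := by
  induction s with
  | zero => exact hXY
  | succ s ih =>
    set E : V →ₗ[ℚ] V := X - Y with hE
    have hX : ∀ v, X v = Y v + E v := fun v => by simp [hE]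
    have hE' : ∀ d, ∀ v ∈ F d, E v ∈ F (d + s + 1) := ih
    -- Expanding `X = Y + E` in the braid relation, with `Y² = 1` on graded pieces, leaves `2E =
    -- YEY` one step deeper; the term `EYE` is negligible because it raises the degree twice.
    have two : ∀ d, ∀ v ∈ F d, (2 : ℚ) • E v - Y (E (Y v)) ∈ F (d + s + 2) := by
      intro d v hv
      have h1 : Y (Y (E v)) + E (Y (Y v)) - Y (E (Y v)) + E (Y (E v)) = 0 := by
        have := hb v
        simp only [hX, map_add] at this
        rw [← sub_eq_zero] at this
        rw [← this]; abel
      have h2 : Y (Y (E v)) - E v ∈ F (d + s + 2) := hYY _ _ (hE' d v hv)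
      have h3 : E (Y (Y v)) - E v ∈ F (d + s + 2) := by
        rw [← map_sub]
        have := hE' _ _ (hYY d v hv)
        rwa [show d + 1 + s + 1 = d + s + 2 by ring] at this
      have h4 : E (Y (E v)) ∈ F (d + s + 2) :=
        hF (by omega) (hE' _ _ (hY _ _ (hE' d v hv)))
      have : (2 : ℚ) • E v - Y (E (Y v)) =
          -((Y (Y (E v)) - E v) + (E (Y (Y v)) - E v) + E (Y (E v))) := by
        rw [two_smul, eq_neg_iff_add_eq_zero, ← h1]; abel
      rw [this]
      exact neg_mem (add_mem (add_mem h2 h3) h4)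
    intro d v hv
    have h1 := two d v hv
    have h2 := hY _ _ (two d (Y v) (hY d v hv))
    have h3 : Y (E (Y (Y v))) - Y (E v) ∈ F (d + s + 2) := by
      rw [← map_sub, ← map_sub]
      have := hY _ _ (hE' _ _ (hYY d v hv))
      rwa [show d + 1 + s + 1 = d + s + 2 by ring] at this
    have h4 : Y (Y (E v)) - E v ∈ F (d + s + 2) := hYY _ _ (hE' d v hv)
    have h5 : Y (Y (E (Y (Y v)))) - Y (Y (E v)) ∈ F (d + s + 2) := by
      rw [← map_sub]; exact hY _ _ h3
    -- Using `2E = YEY` twice gives `4E = Y²EY² = E`, so `3E` vanishes on the graded piece; rational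
    -- coefficients then allow division by 3.
    have h6 : (3 : ℚ) • E v ∈ F (d + s + 2) := by
      have : (3 : ℚ) • E v = (2 : ℚ) • ((2 : ℚ) • E v - Y (E (Y v)))
          + Y ((2 : ℚ) • E (Y v) - Y (E (Y (Y v))))
          + (Y (Y (E (Y (Y v)))) - Y (Y (E v))) + (Y (Y (E v)) - E v) := by
        simp only [map_sub, map_smul]
        module
      rw [this]
      exact add_mem (add_mem (add_mem (Submodule.smul_mem _ _ h1) h2) h5) h4
    have : E v = (1 / 3 : ℚ) • (3 : ℚ) • E v := by rw [smul_smul]; norm_num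
    change E v ∈ _
    rw [this, show d + (s + 1) + 1 = d + s + 2 by ring]
    exact Submodule.smul_mem _ _ h6

/-- The rational group ring of a free group. -/
abbrev GroupRing (α : Type*) : Type _ := MonoidAlgebra ℚ (FreeGroup α)

/-- A group element as an element of the group ring. -/
noncomputable abbrev grp (g : FreeGroup α) : GroupRing α := MonoidAlgebra.of ℚ (FreeGroup α) g

/-- The augmentation ideal, as a subspace. -/
noncomputable def augIdeal (α : Type*) : Submodule ℚ (GroupRing α) :=
  Submodule.span ℚ (Set.range fun g : FreeGroup α => grp g - 1)

lemma grp_one : grp (1 : FreeGroup α) = 1 := map_one _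

lemma grp_sub_one_mem (g : FreeGroup α) : grp g - 1 ∈ augIdeal α :=
  Submodule.subset_span ⟨g, rfl⟩

lemma augIdeal_mul_le : augIdeal α * augIdeal α ≤ augIdeal α := by
  conv_lhs => rw [augIdeal, Submodule.span_mul_span]
  rw [Submodule.span_le]
  rintro _ ⟨_, ⟨g, rfl⟩, _, ⟨h, rfl⟩, rfl⟩
  have : (grp g - 1) * (grp h - 1) = (grp (g * h) - 1) - (grp g - 1) - (grp h - 1) := by
    rw [grp, grp, grp, map_mul]; noncomm_ring
  change (grp g - 1) * (grp h - 1) ∈ augIdeal α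
  rw [this]
  exact sub_mem (sub_mem (grp_sub_one_mem _) (grp_sub_one_mem _)) (grp_sub_one_mem _)

/-- The exponent starts at 1 because the zeroth power, in the monoid of subspaces, is only the line
of scalars and does not in general contain the augmentation ideal. -/
lemma augIdeal_pow_antitone : Antitone fun d : ℕ => augIdeal α ^ (d + 1) := by
  refine antitone_nat_of_succ_le fun d => ?_
  rw [pow_succ (augIdeal α) (d + 1), pow_succ (augIdeal α) d, mul_assoc]
  exact mul_le_mul' le_rfl augIdeal_mul_le

/-- The endomorphism of the group ring induced by an endomorphism of the group. -/
noncomputable def ringMap (f : FreeGroup α →* FreeGroup α) : GroupRing α →ₐ[ℚ] GroupRing α :=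
  MonoidAlgebra.mapDomainAlgHom ℚ ℚ f

lemma ringMap_grp (f : FreeGroup α →* FreeGroup α) (g : FreeGroup α) :
    ringMap f (grp g) = grp (f g) := by
  simp [ringMap, grp]

lemma ringMap_mem_augIdeal (f : FreeGroup α →* FreeGroup α) {x : GroupRing α}
    (hx : x ∈ augIdeal α) : ringMap f x ∈ augIdeal α := by
  induction hx using Submodule.span_induction with
  | mem x h =>
    obtain ⟨g, rfl⟩ := h
    simp only [map_sub, map_one, ringMap_grp]
    exact grp_sub_one_mem _
  | zero => simp
  | add x y _ _ hx hy => rw [map_add]; exact add_mem hx hy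
  | smul c x _ hx => rw [map_smul]; exact Submodule.smul_mem _ _ hx

lemma ringMap_mem_augIdeal_pow (f : FreeGroup α →* FreeGroup α) (d : ℕ) {x : GroupRing α}
    (hx : x ∈ augIdeal α ^ (d + 1)) : ringMap f x ∈ augIdeal α ^ (d + 1) := by
  induction d generalizing x with
  | zero => simpa using ringMap_mem_augIdeal f (by simpa using hx)
  | succ d ih =>
    rw [pow_succ] at hx
    induction hx using Submodule.mul_induction_on' with
    | mem_mul_mem m hm n hn =>
      rw [map_mul, pow_succ]
      exact Submodule.mul_mem_mul (ih hm) (ringMap_mem_augIdeal f hn)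
    | add x _ y _ hx hy => rw [map_add]; exact add_mem hx hy

/-- Since `(g - 1)(h - 1)` lies in the square of the ideal, `g ↦ g - 1` is additive modulo that
square, so it is determined by the abelianization. -/
lemma grp_sub_linear_mem [Fintype α] (g : FreeGroup α) :
    (grp g - 1) - ∑ s, (expSum s g : ℚ) • (grp (FreeGroup.of s) - 1) ∈ augIdeal α ^ 2 := by
  induction g using FreeGroup.induction_on with
  | C1 => rw [grp_one]; simp
  | of x => simp [expSum_of]
  | inv_of x h =>
    have : (grp (FreeGroup.of x)⁻¹ - 1)
        - ∑ s, (expSum s (FreeGroup.of x)⁻¹ : ℚ) • (grp (FreeGroup.of s) - 1)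
        = -((grp (FreeGroup.of x) - 1)
          - ∑ s, (expSum s (FreeGroup.of x) : ℚ) • (grp (FreeGroup.of s) - 1))
          - (grp (FreeGroup.of x)⁻¹ - 1) * (grp (FreeGroup.of x) - 1) := by
      have hx : grp (FreeGroup.of x)⁻¹ * grp (FreeGroup.of x) = 1 := by
        rw [grp, grp, ← map_mul, inv_mul_cancel, map_one]
      simp only [expSum_inv, Int.cast_neg, neg_smul, Finset.sum_neg_distrib, sub_mul, mul_sub, hx,
        one_mul, mul_one]
      abel
    rw [this, pow_two]
    rw [pow_two] at h
    exact sub_mem (neg_mem h) (Submodule.mul_mem_mul (grp_sub_one_mem _) (grp_sub_one_mem _))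
  | mul x y hx hy =>
    have : (grp (x * y) - 1)
        - ∑ s, (expSum s (x * y) : ℚ) • (grp (FreeGroup.of s) - 1)
        = ((grp x - 1) - ∑ s, (expSum s x : ℚ) • (grp (FreeGroup.of s) - 1))
        + ((grp y - 1) - ∑ s, (expSum s y : ℚ) • (grp (FreeGroup.of s) - 1))
          + (grp x - 1) * (grp y - 1) := by
      simp only [expSum_mul, Int.cast_add, add_smul, Finset.sum_add_distrib, grp, map_mul, sub_mul,
        mul_sub, one_mul, mul_one]
      abel
    rw [this]
    refine add_mem (add_mem hx hy) ?_
    rw [pow_two]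
    exact Submodule.mul_mem_mul (grp_sub_one_mem _) (grp_sub_one_mem _)

lemma grp_sub_grp_mem [Fintype α] {g h : FreeGroup α} (H : ∀ s, expSum s g = expSum s h) :
    grp g - grp h ∈ augIdeal α ^ 2 := by
  have := sub_mem (grp_sub_linear_mem g) (grp_sub_linear_mem h)
  simp only [H] at this
  convert this using 1
  abel

/-- The graded pieces are spanned by products of degree-one classes, on which only the
abelianization acts; the induction replaces one factor at a time. -/
lemma ringMap_sub_mem [Fintype α] {f g : FreeGroup α →* FreeGroup α}
    (H : ∀ s t, expSum s (f (FreeGroup.of t)) = expSum s (g (FreeGroup.of t))) (d : ℕ)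
    {x : GroupRing α} (hx : x ∈ augIdeal α ^ (d + 1)) :
    ringMap f x - ringMap g x ∈ augIdeal α ^ (d + 1 + 1) := by
  have base : ∀ x ∈ augIdeal α, ringMap f x - ringMap g x ∈ augIdeal α ^ 2 := by
    intro x hx
    induction hx using Submodule.span_induction with
    | mem x h =>
      obtain ⟨w, rfl⟩ := h
      simp only [map_sub, map_one, ringMap_grp, sub_sub_sub_cancel_right]
      exact grp_sub_grp_mem fun s => by rw [expSum_map f, expSum_map g]; simp only [H]
    | zero => simp
    | add x y _ _ hx hy => rw [map_add, map_add, add_sub_add_comm]; exact add_mem hx hy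
    | smul c x _ hx => rw [map_smul, map_smul, ← smul_sub]; exact Submodule.smul_mem _ _ hx
  induction d generalizing x with
  | zero => exact base x (by simpa using hx)
  | succ d ih =>
    rw [pow_succ] at hx
    induction hx using Submodule.mul_induction_on' with
    | mem_mul_mem m hm n hn =>
      have : ringMap f (m * n) - ringMap g (m * n) =
          (ringMap f m - ringMap g m) * ringMap f n + ringMap g m * (ringMap f n - ringMap g n) := by
        simp only [map_mul, sub_mul, mul_sub]; abel
      rw [this]
      refine add_mem ?_ ?_
      · rw [pow_succ]
        exact Submodule.mul_mem_mul (ih hm) (ringMap_mem_augIdeal f hn)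
      · rw [show d + 1 + 1 + 1 = (d + 1) + 2 by ring, pow_add]
        exact Submodule.mul_mem_mul (ringMap_mem_augIdeal_pow g d hm) (base n hn)
    | add x _ y _ hx hy => rw [map_add, map_add, add_sub_add_comm]; exact add_mem hx hy

/-! ### A faithful unipotent representation -/

/-- The nilpotent operator attached to a generator; it adds a letter to square-free words. -/
def raising (s : α) : Module.End ℚ (List α → ℚ) where
  toFun f l := match l with
    | [] => 0
    | t :: l' => if t = s ∧ l'.head? ≠ some s then f l' else 0
  map_add' f g := by
    ext l; cases l with
    | nil => simp
    | cons t l => simp only [Pi.add_apply]; split_ifs <;> simp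
  map_smul' c f := by
    ext l; cases l with
    | nil => simp
    | cons t l => simp

lemma raising_nil (s : α) (f : List α → ℚ) : raising s f [] = 0 := rfl

lemma raising_cons (s t : α) (l : List α) (f : List α → ℚ) :
    raising s f (t :: l) = if t = s ∧ l.head? ≠ some s then f l else 0 := rfl

/-- The condition on the head in `raising` forbids adding the same letter twice in a row. Hence `1 +
raising s` is unipotent with `k`-th power `1 + k • raising s`, so a whole syllable acts in one step.
-/
lemma raising_mul_self (s : α) : raising s * raising s = 0 := by
  ext f l
  rcases l with _ | ⟨t, _ | ⟨u, l⟩⟩ <;>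
    simp [raising_nil, raising_cons]
  grind

/-- The unipotent operator by which a generator acts. -/
def unipotent (s : α) : (Module.End ℚ (List α → ℚ))ˣ where
  val := 1 + raising s
  inv := 1 - raising s
  val_inv := by
    have := raising_mul_self s
    simp [add_mul, mul_sub, this]
  inv_val := by
    have := raising_mul_self s
    simp [mul_add, sub_mul, this]

lemma unipotent_zpow (s : α) (k : ℤ) :
    ((unipotent s ^ k : (Module.End ℚ (List α → ℚ))ˣ) : Module.End ℚ (List α → ℚ)) =
      1 + (k : ℚ) • raising s := by
  have h := raising_mul_self s
  induction k using Int.induction_on with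
  | zero => simp
  | succ n ih =>
    rw [zpow_add_one, Units.val_mul, ih]
    simp only [unipotent, add_mul, mul_add, one_mul, mul_one, smul_mul_assoc, h, smul_zero]
    push_cast
    module
  | pred n ih =>
    rw [zpow_sub_one, Units.val_mul, ih]
    change (1 + _) * (1 - raising s) = _
    simp only [add_mul, mul_sub, one_mul, mul_one, smul_mul_assoc, h, smul_zero]
    push_cast
    module

/-- The unipotent representation of the free group. -/
def unipotentRep : FreeGroup α →* Module.End ℚ (List α → ℚ) :=
  (Units.coeHom _).comp (FreeGroup.lift unipotent)

lemma unipotentRep_zpow_mul (s : α) (k : ℤ) (v : FreeGroup α) (f : List α → ℚ) :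
    unipotentRep (FreeGroup.of s ^ k * v) f =
      unipotentRep v f + (k : ℚ) • raising s (unipotentRep v f) := by
  have : unipotentRep (FreeGroup.of s ^ k) = 1 + (k : ℚ) • raising s := by
    rw [← unipotent_zpow]; simp [unipotentRep]
  rw [map_mul, this]; rfl

/-- If `w = s₁^k₁ ⋯ sₙ^kₙ` is the decomposition into syllables, the coefficient at the word `s₁ ⋯
sₙ` is `k₁ ⋯ kₙ ≠ 0`, and no longer word occurs. -/
lemma exists_unipotentRep_ne_zero (w : FreeGroup α) :
    ∃ l : List α, l.head? = firstGen w ∧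
      unipotentRep w (Pi.single [] 1) l ≠ 0 ∧
      ∀ l' : List α, l.length < l'.length → unipotentRep w (Pi.single [] 1) l' = 0 := by
  induction hn : w.norm using Nat.strong_induction_on generalizing w with
  | _ n ih =>
  cases hf : firstGen w with
  | none =>
    obtain rfl := firstGen_eq_none.1 hf
    refine ⟨[], rfl, by simp, fun l' hl' => ?_⟩
    have : l' ≠ [] := by rintro rfl; simp at hl'
    simp [this]
  | some s =>
    obtain ⟨k, v, hw, hv, -, hk, -⟩ := exists_zpow_mul s w
    obtain ⟨hk, hlt⟩ := hk hf
    obtain ⟨l, hl1, hl2, hl3⟩ := ih _ (hn ▸ hlt) v rfl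
    refine ⟨s :: l, rfl, ?_, ?_⟩
    · rw [hw, unipotentRep_zpow_mul, Pi.add_apply, hl3 (s :: l) (by simp), Pi.smul_apply,
        raising_cons, if_pos ⟨rfl, by rw [hl1]; exact hv⟩]
      simpa using ⟨hk, hl2⟩
    · intro l' hl'
      rw [hw, unipotentRep_zpow_mul, Pi.add_apply, Pi.smul_apply]
      cases l' with
      | nil => simp at hl'
      | cons t l' =>
        simp only [List.length_cons] at hl'
        rw [raising_cons, hl3 (t :: l') (by simp; omega), hl3 l' (by omega)]
        simp

lemma unipotentRep_injective : Function.Injective (unipotentRep (α := α)) := by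
  rw [injective_iff_map_eq_one]
  intro w hw
  obtain ⟨l, h1, h2, -⟩ := exists_unipotentRep_ne_zero w
  rw [hw] at h2
  have : l = [] := by
    by_contra h
    simp [h] at h2
  rw [this] at h1
  exact firstGen_eq_none.1 h1.symm

/-- Functions vanishing on words of length less than `d`. -/
def vanishing (α : Type*) (d : ℕ) : Submodule ℚ (List α → ℚ) where
  carrier := {f | ∀ l : List α, l.length < d → f l = 0}
  add_mem' hf hg l hl := by simp [hf l hl, hg l hl]
  zero_mem' l _ := rfl
  smul_mem' c f hf l hl := by simp [hf l hl]

lemma vanishing_succ_le (d : ℕ) : vanishing α (d + 1) ≤ vanishing α d :=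
  fun _ hf l hl => hf l (by omega)

lemma raising_mem (s : α) {d : ℕ} {f : List α → ℚ} (hf : f ∈ vanishing α d) :
    raising s f ∈ vanishing α (d + 1) := by
  intro l hl
  cases l with
  | nil => rfl
  | cons t l =>
    rw [raising_cons, hf l (by simpa using hl)]
    simp

lemma unipotentRep_sub_mem (w : FreeGroup α) {d : ℕ} {f : List α → ℚ} (hf : f ∈ vanishing α d) :
    unipotentRep w f - f ∈ vanishing α (d + 1) := by
  induction w using FreeGroup.induction_on generalizing f with
  | C1 => simp
  | of x =>
    have := unipotentRep_zpow_mul x 1 1 f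
    simp only [zpow_one, mul_one, map_one, Module.End.one_apply, Int.cast_one, one_smul] at this
    rw [this, add_sub_cancel_left]
    exact raising_mem x hf
  | inv_of x _ =>
    have := unipotentRep_zpow_mul x (-1) 1 f
    simp only [zpow_neg_one, mul_one, map_one, Module.End.one_apply] at this
    rw [this, add_sub_cancel_left]
    exact Submodule.smul_mem _ _ (raising_mem x hf)
  | mul x y hx hy =>
    have h1 := hy hf
    have h2 : unipotentRep y f ∈ vanishing α d := by
      have := add_mem (vanishing_succ_le d h1) hf
      rwa [sub_add_cancel] at this
    have := add_mem (hx h2) h1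
    rw [map_mul, Module.End.mul_apply]
    rwa [sub_add_sub_cancel] at this

/-- The extension of the unipotent representation to the group ring. -/
noncomputable def unipotentAlgRep : GroupRing α →ₐ[ℚ] Module.End ℚ (List α → ℚ) :=
  MonoidAlgebra.lift ℚ (Module.End ℚ (List α → ℚ)) (FreeGroup α) unipotentRep

lemma unipotentAlgRep_grp (g : FreeGroup α) : unipotentAlgRep (grp g) = unipotentRep g := by
  simp [unipotentAlgRep, grp]

lemma unipotentAlgRep_mem {x : GroupRing α} (hx : x ∈ augIdeal α) {d : ℕ} {f : List α → ℚ}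
    (hf : f ∈ vanishing α d) : unipotentAlgRep x f ∈ vanishing α (d + 1) := by
  induction hx using Submodule.span_induction with
  | mem x h =>
    obtain ⟨g, rfl⟩ := h
    simp only [map_sub, map_one, unipotentAlgRep_grp]
    exact unipotentRep_sub_mem g hf
  | zero => simp
  | add x y _ _ hx hy => rw [map_add]; exact add_mem hx hy
  | smul c x _ hx => rw [map_smul]; exact Submodule.smul_mem _ _ hx

lemma unipotentAlgRep_pow_mem (n : ℕ) {x : GroupRing α} (hx : x ∈ augIdeal α ^ (n + 1)) {d : ℕ}
    {f : List α → ℚ} (hf : f ∈ vanishing α d) :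
    unipotentAlgRep x f ∈ vanishing α (d + n + 1) := by
  induction n generalizing x d f with
  | zero => exact unipotentAlgRep_mem (by simpa using hx) hf
  | succ n ih =>
    rw [pow_succ] at hx
    induction hx using Submodule.mul_induction_on' with
    | mem_mul_mem p hp q hq =>
      rw [map_mul, Module.End.mul_apply, show d + (n + 1) + 1 = (d + 1) + n + 1 by ring]
      exact ih hp (unipotentAlgRep_mem hq hf)
    | add x _ y _ hx hy => rw [map_add]; exact add_mem hx hy

/-- The augmentation powers push the length filtration of a faithful representation, so elements
congruent modulo every power act alike and are equal. -/
lemma eq_of_grp_sub_mem {g h : FreeGroup α} (H : ∀ n, grp g - grp h ∈ augIdeal α ^ (n + 1)) :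
    g = h := by
  apply unipotentRep_injective
  refine LinearMap.ext fun f => funext fun l => ?_
  -- For the coordinate at `l`, the power `l.length + 1` suffices: it sends every function to one
  -- vanishing on words of length at most `l.length`.
  have := unipotentAlgRep_pow_mem l.length (H l.length) (d := 0) (f := f) (fun _ h => by simp at h)
    l (by omega)
  rw [map_sub, unipotentAlgRep_grp, unipotentAlgRep_grp, LinearMap.sub_apply, Pi.sub_apply,
    sub_eq_zero] at this
  exact this

/-- Two endomorphisms of a free group that satisfy the braid relation and induce the same
involution of the abelianization are equal. -/
theorem eq_of_braid_of_expSum [Fintype α] {X Y : FreeGroup α →* FreeGroup α}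
    (hb : ∀ w, X (Y (X w)) = Y (X (Y w)))
    (hXY : ∀ s t, expSum s (X (FreeGroup.of t)) = expSum s (Y (FreeGroup.of t)))
    (hYY : ∀ s t, expSum s (Y (Y (FreeGroup.of t))) = expSum s (FreeGroup.of t)) : X = Y := by
  have hcomp : ∀ (f g : FreeGroup α →* FreeGroup α) (x : GroupRing α),
      ringMap f (ringMap g x) = ringMap (f.comp g) x := by
    intro f g x
    have : (ringMap f).comp (ringMap g) = ringMap (f.comp g) := by
      refine MonoidAlgebra.algHom_ext (fun w => ?_) (Subsingleton.elim _ _)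
      have h := ringMap_grp (α := α)
      simp only [grp, MonoidAlgebra.of_apply] at h
      simp [h]
    rw [← this]; rfl
  have hid : ∀ x : GroupRing α, ringMap (MonoidHom.id _) x = x := by
    intro x
    have : ringMap (MonoidHom.id (FreeGroup α)) = AlgHom.id ℚ _ := by
      refine MonoidAlgebra.algHom_ext (fun w => ?_) (Subsingleton.elim _ _)
      have h := ringMap_grp (α := α)
      simp only [grp, MonoidAlgebra.of_apply] at h
      simp [h]
    rw [this]; rfl
  refine MonoidHom.ext fun w => eq_of_grp_sub_mem fun n => ?_
  have := sub_mem_of_braid (F := fun d => augIdeal α ^ (d + 1)) augIdeal_pow_antitone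
    (X := (ringMap X).toLinearMap) (Y := (ringMap Y).toLinearMap)
    (fun d v hv => ringMap_mem_augIdeal_pow Y d hv)
    (fun d v hv => ringMap_sub_mem hXY d hv)
    (fun d v hv => by
      have := ringMap_sub_mem (f := Y.comp Y) (g := MonoidHom.id _) (by simpa using hYY) d hv
      rwa [← hcomp, hid] at this)
    (fun v => by
      simp only [AlgHom.toLinearMap_apply, hcomp]
      congr 1
      exact congrArg _ (MonoidHom.ext hb))
    n 0 (grp w - 1) (by simpa using grp_sub_one_mem w)
  simp only [AlgHom.toLinearMap_apply, map_sub, map_one, ringMap_grp,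
    sub_sub_sub_cancel_right] at this
  exact augIdeal_pow_antitone (by omega : n ≤ 0 + n + 1) this

end Augmentation

/-! ### Local automorphisms with a given core -/

section Cores

variable {m : ℕ}

lemma incl_a (i : Fin m) : incl i a = FreeGroup.of i.castSucc := by simp [incl]

lemma incl_b (i : Fin m) : incl i b = FreeGroup.of i.succ := by simp [incl]

lemma incl_injective (i : Fin m) : Function.Injective (incl i) := by
  refine FreeGroup.map_injective ?_
  intro s t h
  have : i.castSucc ≠ i.succ := (Fin.castSucc_lt_succ).ne
  fin_cases s <;> fin_cases t <;> simp_all [eq_comm]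

lemma hom_F2_ext {G : Type*} [Group G] {f g : F2 →* G} (ha : f a = g a) (hb : f b = g b) :
    f = g := by
  refine FreeGroup.ext_hom _ _ fun s => ?_
  fin_cases s
  exacts [ha, hb]

lemma aut_F2_ext {s t : MulAut F2} (ha : s a = t a) (hb : s b = t b) : s = t :=
  MulEquiv.toMonoidHom_injective (hom_F2_ext ha hb)

/-- The `i`-local endomorphism `id * f * id`. -/
def coreHom (i : Fin m) (f : F2 →* F2) : FreeGroup (Fin (m + 1)) →* FreeGroup (Fin (m + 1)) :=
  FreeGroup.lift fun j =>
    if j = i.castSucc then incl i (f a) else if j = i.succ then incl i (f b) else FreeGroup.of j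

lemma coreHom_of_ne {i : Fin m} (f : F2 →* F2) {j : Fin (m + 1)} (h1 : j ≠ i.castSucc)
    (h2 : j ≠ i.succ) : coreHom i f (FreeGroup.of j) = FreeGroup.of j := by
  simp [coreHom, h1, h2]

lemma coreHom_castSucc (i : Fin m) (f : F2 →* F2) :
    coreHom i f (FreeGroup.of i.castSucc) = incl i (f a) := by
  simp [coreHom]

lemma coreHom_succ (i : Fin m) (f : F2 →* F2) :
    coreHom i f (FreeGroup.of i.succ) = incl i (f b) := by
  have : i.castSucc ≠ i.succ := (Fin.castSucc_lt_succ).ne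
  simp [coreHom, this.symm]

lemma coreHom_incl (i : Fin m) (f : F2 →* F2) (w : F2) :
    coreHom i f (incl i w) = incl i (f w) := by
  have : (coreHom i f).comp (incl i) = (incl i).comp f :=
    hom_F2_ext (by simp only [MonoidHom.comp_apply, incl_a, coreHom_castSucc])
      (by simp only [MonoidHom.comp_apply, incl_b, coreHom_succ])
  exact DFunLike.congr_fun this w

lemma hom_ext_core (i : Fin m) {G : Type*} [Group G] {f g : FreeGroup (Fin (m + 1)) →* G}
    (h : ∀ j, j ≠ i.castSucc → j ≠ i.succ → f (FreeGroup.of j) = g (FreeGroup.of j))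
    (h' : ∀ w, f (incl i w) = g (incl i w)) : f = g := by
  refine FreeGroup.ext_hom _ _ fun j => ?_
  by_cases h1 : j = i.castSucc
  · rw [h1, ← incl_a]; exact h' a
  by_cases h2 : j = i.succ
  · rw [h2, ← incl_b]; exact h' b
  exact h j h1 h2

lemma coreHom_comp (i : Fin m) (f g : F2 →* F2) :
    (coreHom i f).comp (coreHom i g) = coreHom i (f.comp g) := by
  refine hom_ext_core i (fun j h1 h2 => ?_) fun w => ?_
  · simp only [MonoidHom.comp_apply, coreHom_of_ne _ h1 h2]
  · simp only [MonoidHom.comp_apply, coreHom_incl]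

lemma coreHom_id (i : Fin m) : coreHom i (MonoidHom.id F2) = MonoidHom.id _ := by
  refine hom_ext_core i (fun j h1 h2 => ?_) fun w => ?_
  · simp only [MonoidHom.id_apply, coreHom_of_ne _ h1 h2]
  · simp only [MonoidHom.id_apply, coreHom_incl]

/-- The `i`-local automorphism with core `τ`. -/
def coreAut (i : Fin m) (τ : MulAut F2) : MulAut (FreeGroup (Fin (m + 1))) :=
  MonoidHom.toMulEquiv (coreHom i τ.toMonoidHom) (coreHom i (τ⁻¹ : MulAut F2).toMonoidHom)
    (by
      rw [coreHom_comp, ← coreHom_id i]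
      congr 1
      ext s
      simp)
    (by
      rw [coreHom_comp, ← coreHom_id i]
      congr 1
      ext s
      simp)

lemma coreAut_of_ne {i : Fin m} (τ : MulAut F2) {j : Fin (m + 1)} (h1 : j ≠ i.castSucc)
    (h2 : j ≠ i.succ) : coreAut i τ (FreeGroup.of j) = FreeGroup.of j :=
  coreHom_of_ne _ h1 h2

lemma coreAut_incl (i : Fin m) (τ : MulAut F2) (w : F2) :
    coreAut i τ (incl i w) = incl i (τ w) := coreHom_incl i _ w

lemma coreAut_castSucc (i : Fin m) (τ : MulAut F2) :
    coreAut i τ (FreeGroup.of i.castSucc) = incl i (τ a) := coreHom_castSucc i _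

lemma coreAut_succ (i : Fin m) (τ : MulAut F2) :
    coreAut i τ (FreeGroup.of i.succ) = incl i (τ b) := coreHom_succ i _

lemma aut_ext_core (i : Fin m) {f g : MulAut (FreeGroup (Fin (m + 1)))}
    (h : ∀ j, j ≠ i.castSucc → j ≠ i.succ → f (FreeGroup.of j) = g (FreeGroup.of j))
    (h' : ∀ w, f (incl i w) = g (incl i w)) : f = g :=
  MulEquiv.toMonoidHom_injective (hom_ext_core i h h')

lemma coreAut_inv (i : Fin m) (τ : MulAut F2) : coreAut i τ⁻¹ = (coreAut i τ)⁻¹ := by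
  rw [eq_inv_iff_mul_eq_one]
  refine aut_ext_core i (fun j h1 h2 => ?_) fun w => ?_
  · simp [coreAut_of_ne _ h1 h2]
  · simp [coreAut_incl]

lemma isCore_iff {i : Fin m} {τ : MulAut F2} {φ : MulAut (FreeGroup (Fin (m + 1)))} :
    IsCore i τ φ ↔ φ = coreAut i τ := by
  constructor
  · rintro ⟨h1, h2⟩
    refine aut_ext_core i (fun j h h' => ?_) fun w => ?_
    · rw [h1 j h h', coreAut_of_ne τ h h']
    · rw [h2, coreAut_incl]
  · rintro rfl
    exact ⟨fun j h h' => coreAut_of_ne τ h h', coreAut_incl i τ⟩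

lemma coreAut_injective (i : Fin m) : Function.Injective (coreAut i) := by
  intro s t h
  refine MulEquiv.ext fun w => incl_injective i ?_
  rw [← coreAut_incl, h, coreAut_incl]

/-! ### Local automorphisms as automorphisms with a core -/

lemma range_incl (i : Fin m) :
    (incl i).range = Subgroup.closure {FreeGroup.of i.castSucc, FreeGroup.of i.succ} := by
  rw [incl, FreeGroup.range_map]
  congr 1
  ext w
  simp [eq_comm, or_comm]

lemma IsCore.isLocalAut {i : Fin m} {τ : MulAut F2} {φ : MulAut (FreeGroup (Fin (m + 1)))}
    (h : IsCore i τ φ) : IsLocalAut i φ := by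
  refine ⟨h.1, ?_⟩
  rw [← range_incl, MonoidHom.map_range]
  have : φ.toMonoidHom.comp (incl i) = (incl i).comp τ.toMonoidHom := MonoidHom.ext h.2
  rw [this, MonoidHom.range_comp]
  rw [MonoidHom.range_eq_top.2 τ.surjective, ← MonoidHom.range_eq_map]

lemma exists_hom_of_map_range_le {i : Fin m} {φ : MulAut (FreeGroup (Fin (m + 1)))}
    (h : (incl i).range.map φ.toMonoidHom ≤ (incl i).range) :
    ∃ f : F2 →* F2, ∀ w, φ (incl i w) = incl i (f w) := by
  have h' : ∀ w, ∃ v, incl i v = φ (incl i w) := fun w =>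
    h ⟨_, ⟨w, rfl⟩, rfl⟩
  choose f hf using h'
  refine ⟨MonoidHom.mk' f fun v w => incl_injective i ?_, fun w => (hf w).symm⟩
  simp only [map_mul, hf]

lemma IsLocalAut.exists_isCore {i : Fin m} {φ : MulAut (FreeGroup (Fin (m + 1)))}
    (h : IsLocalAut i φ) : ∃ τ, IsCore i τ φ := by
  obtain ⟨h1, h2⟩ := h
  rw [← range_incl] at h2
  obtain ⟨f, hf⟩ := exists_hom_of_map_range_le h2.le
  -- Here it matters that the subgroup is mapped onto itself, not merely into itself: the inverse
  -- then preserves it too, and its restriction inverts `f`.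
  have h3 : (incl i).range.map (φ⁻¹ : MulAut _).toMonoidHom ≤ (incl i).range := by
    conv_lhs => rw [← h2]
    rw [Subgroup.map_map]
    rintro _ ⟨w, hw, rfl⟩
    simpa using hw
  obtain ⟨g, hg⟩ := exists_hom_of_map_range_le h3
  have hgf : g.comp f = MonoidHom.id _ := by
    refine MonoidHom.ext fun w => incl_injective i ?_
    rw [MonoidHom.comp_apply, ← hg, ← hf]; simp
  have hfg : f.comp g = MonoidHom.id _ := by
    refine MonoidHom.ext fun w => incl_injective i ?_
    rw [MonoidHom.comp_apply, ← hf, ← hg]; simp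
  exact ⟨MonoidHom.toMulEquiv f g hgf hfg, h1, hf⟩

lemma IsCore.unique {i : Fin m} {s t : MulAut F2} {φ : MulAut (FreeGroup (Fin (m + 1)))}
    (hs : IsCore i s φ) (ht : IsCore i t φ) : s = t :=
  coreAut_injective i ((isCore_iff.1 hs).symm.trans (isCore_iff.1 ht))

lemma BraidRep.HasCores.isLocal {Θ : BraidRep m} {τ : Fin m → MulAut F2} (h : Θ.HasCores τ) :
    Θ.IsLocal := fun i => (h i).isLocalAut

theorem BraidRep.IsLocal.existsUnique_hasCores {Θ : BraidRep m} (h : Θ.IsLocal) :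
    ∃! τ : Fin m → MulAut F2, Θ.HasCores τ := by
  choose τ hτ using fun i => (h i).exists_isCore
  exact ⟨τ, hτ, fun s hs => funext fun i => (hs i).unique (hτ i)⟩

/-! ### The braid relation between local automorphisms -/

/-- The two automorphisms move disjoint pairs of generators, so far commutation puts no condition on
the cores. -/
lemma coreAut_commute {i j : Fin m} (h : i.val + 1 < j.val) (s t : MulAut F2) :
    coreAut i s * coreAut j t = coreAut j t * coreAut i s := by
  have key : ∀ {i j : Fin m} (_ : i.val + 1 < j.val ∨ j.val + 1 < i.val) (t : MulAut F2) (w : F2),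
      coreAut j t (incl i w) = incl i w := by
    intro i j h t w
    have : (coreHom j t.toMonoidHom).comp (incl i) = incl i := by
      refine hom_F2_ext ?_ ?_
      · rw [MonoidHom.comp_apply, incl_a]
        refine coreHom_of_ne _ ?_ ?_ <;> simp only [ne_eq, Fin.ext_iff, Fin.val_castSucc,
          Fin.val_succ] <;> omega
      · rw [MonoidHom.comp_apply, incl_b]
        refine coreHom_of_ne _ ?_ ?_ <;> simp only [ne_eq, Fin.ext_iff, Fin.val_castSucc,
          Fin.val_succ] <;> omega
    exact DFunLike.congr_fun this w
  refine aut_ext_core i (fun k h1 h2 => ?_) fun w => ?_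
  · rw [MulAut.mul_apply, MulAut.mul_apply, coreAut_of_ne s h1 h2]
    by_cases h3 : k = j.castSucc
    · rw [h3, ← incl_a, coreAut_incl, key (Or.inr h)]
    by_cases h4 : k = j.succ
    · rw [h4, ← incl_b, coreAut_incl, key (Or.inr h)]
    rw [coreAut_of_ne t h3 h4, coreAut_of_ne s h1 h2]
  · rw [MulAut.mul_apply, MulAut.mul_apply, coreAut_incl, key (Or.inl h), key (Or.inl h),
      coreAut_incl]

/-- The braid relation between the local automorphisms with cores `s`, `t` at positions `i`, `j`. -/
def BraidAt (i j : Fin m) (s t : MulAut F2) : Prop :=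
  coreAut i s * coreAut j t * coreAut i s = coreAut j t * coreAut i s * coreAut j t

/-- The braid relation in `Aut(F₃)` between the cores `s`, `t`. -/
abbrev Braid (s t : MulAut F2) : Prop := BraidAt (0 : Fin 2) 1 s t

lemma hasCores_iff {Θ : BraidRep m} {τ : Fin m → MulAut F2} :
    Θ.HasCores τ ↔ ∀ i, Θ (sigma i) = MulOpposite.op (coreAut i (τ i)) := by
  simp only [BraidRep.HasCores, isCore_iff]
  exact forall_congr' fun i => ⟨fun h => MulOpposite.unop_injective h, fun h => by rw [h]; rfl⟩

lemma hasCores_unique {Θ Θ' : BraidRep m} {τ : Fin m → MulAut F2} (h : Θ.HasCores τ)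
    (h' : Θ'.HasCores τ) : Θ = Θ' := by
  rw [hasCores_iff] at h h'
  exact PresentedGroup.ext fun i => (h i).trans (h' i).symm

theorem defines_iff_braidAt {τ : Fin m → MulAut F2} :
    Defines τ ↔ ∀ i j : Fin m, i.val + 1 = j.val → BraidAt i j (τ i) (τ j) := by
  constructor
  · rintro ⟨Θ, hΘ⟩ i j hij
    rw [hasCores_iff] at hΘ
    have h1 : (sigma i * sigma j * sigma i : BraidGroup m) * (sigma j * sigma i * sigma j)⁻¹ = 1 := by
      have := PresentedGroup.one_of_mem (rels := braidRels m) (Or.inr ⟨i, j, hij, rfl⟩)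
      simp only [map_mul, map_inv] at this
      exact this
    have h2 := congrArg Θ (mul_inv_eq_one.1 h1)
    simp only [map_mul, hΘ] at h2
    have h3 := congrArg MulOpposite.unop h2
    simp only [MulOpposite.unop_mul, MulOpposite.unop_op] at h3
    -- Passing out of the opposite group reverses products, but both sides of the braid relation are
    -- palindromes, so the right-action convention has no effect.
    rw [BraidAt, mul_assoc, h3, mul_assoc]
  · intro h
    have hr : ∀ r ∈ braidRels m,
        FreeGroup.lift (fun i => MulOpposite.op (coreAut i (τ i))) r = 1 := by
      rintro r (⟨i, j, hij, rfl⟩ | ⟨i, j, hij, rfl⟩)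
      · rw [map_mul, map_inv, mul_inv_eq_one]
        simp only [map_mul, FreeGroup.lift_apply_of, ← MulOpposite.op_mul, coreAut_commute hij]
      · rw [map_mul, map_inv, mul_inv_eq_one]
        simp only [map_mul, FreeGroup.lift_apply_of, ← MulOpposite.op_mul]
        rw [← mul_assoc, ← mul_assoc, (h i j hij : _ * _ * _ = _)]
    refine ⟨PresentedGroup.toGroup hr, ?_⟩
    rw [hasCores_iff]
    intro i
    exact PresentedGroup.toGroup.of hr

/-- The injection `e` onto the free factor of the three generators involved intertwines both local
automorphisms, and every other generator is fixed by both. -/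
lemma braidAt_iff_braid {i j : Fin m} (hij : i.val + 1 = j.val) (s t : MulAut F2) :
    BraidAt i j s t ↔ Braid s t := by
  have hsc : i.succ = j.castSucc := by
    rw [Fin.ext_iff, Fin.val_succ, Fin.val_castSucc]; exact hij
  let e : FreeGroup (Fin 3) →* FreeGroup (Fin (m + 1)) :=
    FreeGroup.map ![i.castSucc, i.succ, j.succ]
  have e0 : e (FreeGroup.of 0) = FreeGroup.of i.castSucc := by simp [e]
  have e1 : e (FreeGroup.of 1) = FreeGroup.of i.succ := by simp [e]
  have e2 : e (FreeGroup.of 2) = FreeGroup.of j.succ := by simp [e]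
  have he : Function.Injective e := by
    refine FreeGroup.map_injective ?_
    intro k l
    fin_cases k <;> fin_cases l <;> simp [Fin.ext_iff] <;> omega
  have hi : ∀ w, e (incl (0 : Fin 2) w) = incl i w := fun w =>
    DFunLike.congr_fun (hom_F2_ext (f := e.comp (incl (0 : Fin 2))) (g := incl i)
      (by rw [MonoidHom.comp_apply, incl_a, incl_a]; exact e0)
      (by rw [MonoidHom.comp_apply, incl_b, incl_b]; exact e1)) w
  have hj : ∀ w, e (incl (1 : Fin 2) w) = incl j w := fun w =>
    DFunLike.congr_fun (hom_F2_ext (f := e.comp (incl (1 : Fin 2))) (g := incl j)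
      (by rw [MonoidHom.comp_apply, incl_a, incl_a, ← hsc]; exact e1)
      (by rw [MonoidHom.comp_apply, incl_b, incl_b]; exact e2)) w
  have hs : ∀ w, coreAut i s (e w) = e (coreAut 0 s w) := fun w =>
    DFunLike.congr_fun (hom_ext_core (0 : Fin 2) (f := (coreAut i s).toMonoidHom.comp e)
      (g := e.comp (coreAut 0 s).toMonoidHom)
      (fun k h1 h2 => by
        have : k = 2 := by fin_cases k <;> simp_all [Fin.ext_iff]
        subst this
        change coreAut i s (e (FreeGroup.of 2)) = e (coreAut 0 s (FreeGroup.of 2))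
        rw [e2, coreAut_of_ne s h1 h2, e2]
        refine coreAut_of_ne s ?_ ?_ <;> simp [Fin.ext_iff] <;> omega)
      (fun w => by
        change coreAut i s (e (incl 0 w)) = e (coreAut 0 s (incl 0 w))
        rw [hi, coreAut_incl, coreAut_incl, hi])) w
  have ht : ∀ w, coreAut j t (e w) = e (coreAut 1 t w) := fun w =>
    DFunLike.congr_fun (hom_ext_core (1 : Fin 2) (f := (coreAut j t).toMonoidHom.comp e)
      (g := e.comp (coreAut 1 t).toMonoidHom)
      (fun k h1 h2 => by
        have : k = 0 := by fin_cases k <;> simp_all [Fin.ext_iff]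
        subst this
        change coreAut j t (e (FreeGroup.of 0)) = e (coreAut 1 t (FreeGroup.of 0))
        rw [e0, coreAut_of_ne t h1 h2, e0]
        refine coreAut_of_ne t ?_ ?_ <;> simp [Fin.ext_iff] <;> omega)
      (fun w => by
        change coreAut j t (e (incl 1 w)) = e (coreAut 1 t (incl 1 w))
        rw [hj, coreAut_incl, coreAut_incl, hj])) w
  constructor
  · intro h
    refine MulEquiv.ext fun w => he ?_
    have := DFunLike.congr_fun h (e w)
    simpa only [MulAut.mul_apply, hs, ht] using this
  · intro h
    refine MulEquiv.toMonoidHom_injective (FreeGroup.ext_hom _ _ fun k => ?_)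
    change (coreAut i s * coreAut j t * coreAut i s) (FreeGroup.of k) =
      (coreAut j t * coreAut i s * coreAut j t) (FreeGroup.of k)
    by_cases hk : ∃ l : Fin 3, e (FreeGroup.of l) = FreeGroup.of k
    · obtain ⟨l, hl⟩ := hk
      have := congrArg e (DFunLike.congr_fun h (FreeGroup.of l))
      rw [← hl]
      simpa only [MulAut.mul_apply, hs, ht] using this
    · push Not at hk
      have h0 : k ≠ i.castSucc := fun h => hk 0 (by rw [h, e0])
      have h1 : k ≠ i.succ := fun h => hk 1 (by rw [h, e1])
      have h2 : k ≠ j.succ := fun h => hk 2 (by rw [h, e2])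
      have h1' : k ≠ j.castSucc := hsc ▸ h1
      simp only [MulAut.mul_apply, coreAut_of_ne s h0 h1, coreAut_of_ne t h1' h2]

theorem defines_iff_braid {τ : Fin m → MulAut F2} :
    Defines τ ↔ ∀ i j : Fin m, i.val + 1 = j.val → Braid (τ i) (τ j) := by
  rw [defines_iff_braidAt]
  exact forall₃_congr fun i j h => braidAt_iff_braid h _ _

lemma defines_pair_iff {s t : MulAut F2} : Defines ![s, t] ↔ Braid s t := by
  rw [defines_iff_braid]
  constructor
  · intro h; exact h 0 1 rfl
  · intro h i j hij
    obtain ⟨rfl, rfl⟩ : i = 0 ∧ j = 1 := by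
      simp only [Fin.ext_iff]; simp; omega
    exact h

/-! ### From cores to pairs of words -/

lemma coreWords_injective : Function.Injective (coreWords (m := m)) := by
  intro s t h
  funext i
  have := congrFun h i
  simp only [coreWords, Prod.mk.injEq] at this
  exact aut_F2_ext this.1 this.2

lemma wordsDefine_iff {w : Fin m → WordPair} :
    WordsDefine w ↔ ∃ τ : Fin m → MulAut F2, coreWords τ = w ∧ Defines τ := by
  constructor
  · rintro ⟨Θ, τ, h, h'⟩; exact ⟨τ, h, Θ, h'⟩
  · rintro ⟨τ, h, Θ, h'⟩; exact ⟨Θ, τ, h, h'⟩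

/-- The braid relation between the automorphisms given by two pairs of words. -/
def WordBraid (v w : WordPair) : Prop :=
  ∃ s t : MulAut F2, (s a, s b) = v ∧ (t a, t b) = w ∧ Braid s t

lemma wordsDefine_pair_iff {v w : WordPair} : WordsDefine ![v, w] ↔ WordBraid v w := by
  rw [wordsDefine_iff]
  constructor
  · rintro ⟨τ, h, h'⟩
    have h0 := congrFun h 0
    have h1 := congrFun h 1
    refine ⟨τ 0, τ 1, h0, h1, ?_⟩
    exact defines_iff_braid.1 h' 0 1 rfl
  · rintro ⟨s, t, h0, h1, h⟩
    refine ⟨![s, t], ?_, defines_pair_iff.2 h⟩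
    funext i
    fin_cases i
    exacts [h0, h1]

/-- The bound on `m` gives every index a neighbour, which certifies that its pair of words comes
from an automorphism; for `m = 1` the right-hand side would be vacuous. -/
theorem wordsDefine_iff_wordBraid (hm : 2 ≤ m) {w : Fin m → WordPair} :
    WordsDefine w ↔ ∀ i j : Fin m, i.val + 1 = j.val → WordBraid (w i) (w j) := by
  rw [wordsDefine_iff]
  constructor
  · rintro ⟨τ, rfl, h⟩ i j hij
    exact ⟨τ i, τ j, rfl, rfl, defines_iff_braid.1 h i j hij⟩
  · intro h
    have hex : ∀ i, ∃ s : MulAut F2, (s a, s b) = w i := by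
      intro i
      by_cases hi : i.val + 1 < m
      · obtain ⟨s, -, hs, -⟩ := h i ⟨i.val + 1, hi⟩ rfl
        exact ⟨s, hs⟩
      · obtain ⟨-, s, -, hs, -⟩ := h ⟨i.val - 1, by omega⟩ i (by simp; omega)
        exact ⟨s, hs⟩
    choose τ hτ using hex
    refine ⟨τ, funext hτ, defines_iff_braid.2 fun i j hij => ?_⟩
    obtain ⟨s, t, hs, ht, hb⟩ := h i j hij
    have h1 : s = τ i := by
      have := hs.trans (hτ i).symm
      simp only [Prod.mk.injEq] at this
      exact aut_F2_ext this.1 this.2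
    have h2 : t = τ j := by
      have := ht.trans (hτ j).symm
      simp only [Prod.mk.injEq] at this
      exact aut_F2_ext this.1 this.2
    rwa [← h1, ← h2]

theorem WordsDefine.existsUnique {w : Fin m → WordPair} (h : WordsDefine w) :
    ∃! Θ : BraidRep m, Θ.IsLocal ∧ Θ.HasCoreWords w := by
  obtain ⟨Θ, τ, h, h'⟩ := h
  refine ⟨Θ, ⟨h'.isLocal, τ, h, h'⟩, ?_⟩
  rintro Θ' ⟨-, s, hs, hs'⟩
  obtain rfl := coreWords_injective (hs.trans h.symm)
  exact hasCores_unique hs' h'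

end Cores

/-! ### Abelianized braid relation -/

section Abelian

/-- The matrix of exponent sums of an endomorphism of a free group. -/
def expMatrix {α : Type*} [DecidableEq α] (f : FreeGroup α →* FreeGroup α) : Matrix α α ℤ :=
  Matrix.of fun t s => expSum s (f (FreeGroup.of t))

/-- Rows are the images of generators, hence the reversed order. -/
lemma expMatrix_comp {α : Type*} [DecidableEq α] [Fintype α] (f g : FreeGroup α →* FreeGroup α) :
    expMatrix (f.comp g) = expMatrix g * expMatrix f := by
  ext t s
  simp only [expMatrix, Matrix.of_apply, MonoidHom.comp_apply, Matrix.mul_apply]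
  exact expSum_map f s _

lemma expSum_incl {m : ℕ} (i : Fin m) (j : Fin (m + 1)) (w : F2) :
    expSum j (incl i w) =
      (if i.castSucc = j then expSum 0 w else 0) + (if i.succ = j then expSum 1 w else 0) := by
  rw [expSum_map, Fin.sum_univ_two]
  change expSum 0 w * expSum j (incl i a) + expSum 1 w * expSum j (incl i b) = _
  rw [incl_a, incl_b, expSum_of, expSum_of]
  simp

lemma expMatrix_coreAut_zero (s : MulAut F2) :
    expMatrix (coreAut (0 : Fin 2) s).toMonoidHom =
      !![expSum 0 (s a), expSum 1 (s a), 0; expSum 0 (s b), expSum 1 (s b), 0; 0, 0, 1] := by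
  have h0 : coreAut (0 : Fin 2) s (FreeGroup.of 0) = incl 0 (s a) := coreAut_castSucc 0 s
  have h1 : coreAut (0 : Fin 2) s (FreeGroup.of 1) = incl 0 (s b) := coreAut_succ 0 s
  have h2 : coreAut (0 : Fin 2) s (FreeGroup.of 2) = FreeGroup.of 2 :=
    coreAut_of_ne s (by decide) (by decide)
  ext k l
  fin_cases k <;> fin_cases l <;> simp [expMatrix, h0, h1, h2, expSum_incl, expSum_of, Fin.ext_iff]

lemma expMatrix_coreAut_one (t : MulAut F2) :
    expMatrix (coreAut (1 : Fin 2) t).toMonoidHom =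
      !![1, 0, 0; 0, expSum 0 (t a), expSum 1 (t a); 0, expSum 0 (t b), expSum 1 (t b)] := by
  have h0 : coreAut (1 : Fin 2) t (FreeGroup.of 0) = FreeGroup.of 0 :=
    coreAut_of_ne t (by decide) (by decide)
  have h1 : coreAut (1 : Fin 2) t (FreeGroup.of 1) = incl 1 (t a) := coreAut_castSucc 1 t
  have h2 : coreAut (1 : Fin 2) t (FreeGroup.of 2) = incl 1 (t b) := coreAut_succ 1 t
  ext k l
  fin_cases k <;> fin_cases l <;> simp [expMatrix, h0, h1, h2, expSum_incl, expSum_of, Fin.ext_iff]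

lemma det_core (s : MulAut F2) :
    expSum 0 (s a) * expSum 1 (s b) - expSum 1 (s a) * expSum 0 (s b) = 1 ∨
    expSum 0 (s a) * expSum 1 (s b) - expSum 1 (s a) * expSum 0 (s b) = -1 := by
  have h : expMatrix s.toMonoidHom * expMatrix (s⁻¹ : MulAut F2).toMonoidHom = 1 := by
    rw [← expMatrix_comp]
    ext k l
    simp [expMatrix, expSum_of, Matrix.one_apply]
  have h' : IsUnit (expMatrix s.toMonoidHom).det := by
    refine IsUnit.of_mul_eq_one (expMatrix (s⁻¹ : MulAut F2).toMonoidHom).det ?_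
    rw [← Matrix.det_mul, h, Matrix.det_one]
  rw [Matrix.det_fin_two] at h'
  exact Int.isUnit_iff.1 h'

lemma fixed_core {s : MulAut F2} {w : F2} (h : s w = w) :
    expSum 0 w * expSum 0 (s a) + expSum 1 w * expSum 0 (s b) = expSum 0 w ∧
    expSum 0 w * expSum 1 (s a) + expSum 1 w * expSum 1 (s b) = expSum 1 w := by
  have h0 := expSum_map s.toMonoidHom 0 w
  have h1 := expSum_map s.toMonoidHom 1 w
  rw [Fin.sum_univ_two] at h0 h1
  change expSum 0 (s w) = _ at h0
  change expSum 1 (s w) = _ at h1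
  rw [h] at h0 h1
  exact ⟨h0.symm, h1.symm⟩

/-- The relation `STS = TST` for the block matrices with nontrivial blocks `(α β; q m)` and `(l k; γ
δ)`, whose determinants are units. The corner entries `(0,2)` and `(2,0)` agree automatically and
give no equation. -/
lemma integer_equations {α β q m l k γ δ : ℤ} (e1 : α * α + β * l * q = α)
    (e2 : α * β + β * l * m = β * l) (e3 : q * α + m * l * q = l * q)
    (e4 : q * β + m * m * l = m * l * l + k * γ) (e5 : m * k = l * m * k + k * δ)
    (e6 : γ * m = γ * m * l + δ * γ) (e7 : δ = γ * m * k + δ * δ)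
    (d1 : α * m - β * q = 1 ∨ α * m - β * q = -1) (d2 : l * δ - k * γ = 1 ∨ l * δ - k * γ = -1) :
    (β = 0 ∧ q = 0 ∧ k = 0 ∧ γ = 0 ∧ α = 1 ∧ δ = 1 ∧ l = m ∧ (m = 1 ∨ m = -1)) ∨
    (l = 0 ∧ m = 0 ∧ α = 0 ∧ δ = 0 ∧ β * q = k * γ ∧ (β * q = 1 ∨ β * q = -1)) ∨
    (l = 0 ∧ m = 2 ∧ α = 0 ∧ δ = 2 ∧ β * q = -1 ∧ k * γ = -1) ∨
    (l = 2 ∧ m = 0 ∧ α = 2 ∧ δ = 0 ∧ β * q = -1 ∧ k * γ = -1) ∨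
    (l = 2 ∧ m = 2 ∧ α = -2 ∧ δ = -2 ∧ β * q = -3 ∧ k * γ = -3) := by
  have unit : ∀ {u v : ℤ}, u * v = 1 ∨ u * v = -1 → (u = 1 ∨ u = -1) ∧ (v = 1 ∨ v = -1) := by
    intro u v h
    have hu : IsUnit (u * v) := Int.isUnit_iff.2 h
    exact ⟨Int.isUnit_iff.1 (isUnit_of_mul_isUnit_left hu),
      Int.isUnit_iff.1 (isUnit_of_mul_isUnit_right hu)⟩
  by_cases h1 : β = 0 ∧ q = 0
  · obtain ⟨rfl, rfl⟩ := h1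
    obtain ⟨hα, hm⟩ := unit (u := α) (v := m) (by simpa using d1)
    have hα : α = 1 := by rcases hα with rfl | rfl <;> omega
    subst hα
    by_cases h2 : k = 0 ∧ γ = 0
    · obtain ⟨rfl, rfl⟩ := h2
      obtain ⟨hl, hδ⟩ := unit (u := l) (v := δ) (by simpa using d2)
      left
      rcases hl with rfl | rfl <;> rcases hδ with rfl | rfl <;> rcases hm with rfl | rfl <;> omega
    · exfalso
      have hδ : δ = m * (1 - l) := by
        by_cases hk : k = 0
        · have hγ : γ ≠ 0 := fun h => h2 ⟨hk, h⟩
          exact mul_left_cancel₀ hγ (by linear_combination -e6)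
        · exact mul_left_cancel₀ hk (by linear_combination -e5)
      subst hδ
      rcases hm with rfl | rfl
      · have : l * (1 * (1 - l)) - k * γ = 0 := by linear_combination e4
        omega
      · have : l * (-1 * (1 - l)) - k * γ = -2 * l := by linear_combination e4
        omega
  · have hα : α = l * (1 - m) := by
      by_cases hβ : β = 0
      · have hq : q ≠ 0 := fun h => h1 ⟨hβ, h⟩
        exact mul_left_cancel₀ hq (by linear_combination e3)
      · exact mul_left_cancel₀ hβ (by linear_combination e2)
    by_cases h2 : k = 0 ∧ γ = 0
    · exfalso
      obtain ⟨rfl, rfl⟩ := h2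
      obtain ⟨hl, hδ⟩ := unit (u := l) (v := δ) (by simpa using d2)
      have : α * m - β * q = l * m * (1 - l) := by rw [hα]; linear_combination -e4
      rcases hl with rfl | rfl
      · simp at this; omega
      · have h : α * m - β * q = -2 * m := by rw [this]; ring
        omega
    · have hδ : δ = m * (1 - l) := by
        by_cases hk : k = 0
        · have hγ : γ ≠ 0 := fun h => h2 ⟨hk, h⟩
          exact mul_left_cancel₀ hγ (by linear_combination -e6)
        · exact mul_left_cancel₀ hk (by linear_combination -e5)
      right
      -- With `α` and `δ` eliminated, the central equation `e4` says exactly that the two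
      -- determinants agree.
      have he : α * m - β * q = l * δ - k * γ := by rw [hα, hδ]; linear_combination -e4
      obtain ⟨e, hee, he1⟩ : ∃ e : ℤ, (e = 1 ∨ e = -1) ∧ α * m - β * q = e := ⟨_, d1, rfl⟩
      have he2 : l * δ - k * γ = e := he ▸ he1
      -- Eliminating the off-diagonal products through the common determinant `e` shows that each of
      -- `l`, `m` is zero or satisfies `(1 - m)(1 - l) = -e`, a unit; this forces both into `{0,
      -- 2}`.
      have hl : l * ((1 - m) * (1 - l) + e) = 0 := by
        subst hα; linear_combination -e1 - l * he1
      have hm : m * ((1 - l) * (1 - m) + e) = 0 := by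
        subst hδ; linear_combination e7 - m * he2
      rcases mul_eq_zero.1 hl with hl0 | hl <;> rcases mul_eq_zero.1 hm with hm0 | hm <;>
        clear unit
      · left
        subst hl0
        subst hm0
        simp only [zero_mul] at hα hδ
        subst hα hδ
        simp only [zero_mul, zero_sub] at he1 he2
        refine ⟨rfl, rfl, rfl, rfl, by linarith, ?_⟩
        rcases hee with rfl | rfl <;> omega
      · subst hl0
        by_cases hm0 : m = 0
        · left
          subst hm0
          simp only [zero_mul] at hα hδ
          subst hα hδ
          simp only [zero_mul, zero_sub] at he1 he2
          refine ⟨rfl, rfl, rfl, rfl, by linarith, ?_⟩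
          rcases hee with rfl | rfl <;> omega
        · right; left
          have hm2 : m = 1 + e := by linarith
          obtain rfl : e = 1 := by rcases hee with rfl | rfl <;> omega
          obtain rfl : m = 2 := by omega
          simp only [zero_mul] at hα hδ
          subst hα hδ
          refine ⟨rfl, rfl, rfl, rfl, by linarith, by linarith⟩
      · subst hm0
        by_cases hl0 : l = 0
        · left
          subst hl0
          simp only [zero_mul] at hα hδ
          subst hα hδ
          simp only [zero_mul, zero_sub] at he1 he2
          refine ⟨rfl, rfl, rfl, rfl, by linarith, ?_⟩
          rcases hee with rfl | rfl <;> omega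
        · right; right; left
          have hm2 : l = 1 + e := by linarith
          obtain rfl : e = 1 := by rcases hee with rfl | rfl <;> omega
          obtain rfl : l = 2 := by omega
          simp only [zero_mul] at hα hδ
          subst hα hδ
          refine ⟨rfl, rfl, rfl, rfl, by linarith, by linarith⟩
      · have hlm : (1 - m) * (1 - l) = 1 ∨ (1 - m) * (1 - l) = -1 := by
          rcases hee with rfl | rfl <;> [right; left] <;> linarith
        have hu : IsUnit ((1 - m) * (1 - l)) := Int.isUnit_iff.2 hlm
        have h3 := Int.isUnit_iff.1 (isUnit_of_mul_isUnit_left hu)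
        have h4 := Int.isUnit_iff.1 (isUnit_of_mul_isUnit_right hu)
        have hm' : m = 0 ∨ m = 2 := by omega
        have hl' : l = 0 ∨ l = 2 := by omega
        rcases hm' with rfl | rfl <;> rcases hl' with rfl | rfl <;> omega

lemma Braid.expSum_cases {s t : MulAut F2} (h : Braid s t) :
    (expSum 1 (s a) = 0 ∧ expSum 0 (s b) = 0 ∧ expSum 1 (t a) = 0 ∧ expSum 0 (t b) = 0 ∧
      expSum 0 (s a) = 1 ∧ expSum 1 (t b) = 1 ∧ expSum 0 (t a) = expSum 1 (s b) ∧
      (expSum 1 (s b) = 1 ∨ expSum 1 (s b) = -1)) ∨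
    (expSum 0 (t a) = 0 ∧ expSum 1 (s b) = 0 ∧ expSum 0 (s a) = 0 ∧ expSum 1 (t b) = 0 ∧
      expSum 1 (s a) * expSum 0 (s b) = expSum 1 (t a) * expSum 0 (t b) ∧
      (expSum 1 (s a) * expSum 0 (s b) = 1 ∨ expSum 1 (s a) * expSum 0 (s b) = -1)) ∨
    (expSum 0 (t a) = 0 ∧ expSum 1 (s b) = 2 ∧ expSum 0 (s a) = 0 ∧ expSum 1 (t b) = 2 ∧
      expSum 1 (s a) * expSum 0 (s b) = -1 ∧ expSum 1 (t a) * expSum 0 (t b) = -1) ∨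
    (expSum 0 (t a) = 2 ∧ expSum 1 (s b) = 0 ∧ expSum 0 (s a) = 2 ∧ expSum 1 (t b) = 0 ∧
      expSum 1 (s a) * expSum 0 (s b) = -1 ∧ expSum 1 (t a) * expSum 0 (t b) = -1) ∨
    (expSum 0 (t a) = 2 ∧ expSum 1 (s b) = 2 ∧ expSum 0 (s a) = -2 ∧ expSum 1 (t b) = -2 ∧
      expSum 1 (s a) * expSum 0 (s b) = -3 ∧ expSum 1 (t a) * expSum 0 (t b) = -3) := by
  have hc : ((coreAut (0 : Fin 2) s).toMonoidHom.comp ((coreAut (1 : Fin 2) t).toMonoidHom.comp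
      (coreAut (0 : Fin 2) s).toMonoidHom)) = ((coreAut (1 : Fin 2) t).toMonoidHom.comp
      ((coreAut (0 : Fin 2) s).toMonoidHom.comp (coreAut (1 : Fin 2) t).toMonoidHom)) :=
    MonoidHom.ext fun w => DFunLike.congr_fun h w
  have hM := congrArg expMatrix hc
  simp only [expMatrix_comp, expMatrix_coreAut_zero, expMatrix_coreAut_one] at hM
  have e := fun i j => congrFun (congrFun hM i) j
  have e00 := e 0 0
  have e01 := e 0 1
  have e10 := e 1 0
  have e11 := e 1 1
  have e12 := e 1 2
  have e21 := e 2 1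
  have e22 := e 2 2
  simp [Matrix.mul_apply, Fin.sum_univ_three, -mul_eq_mul_left_iff, -mul_eq_mul_right_iff,
    -left_eq_add, -add_eq_left, -mul_eq_left₀, -mul_eq_right₀, -add_left_inj, -add_right_inj] at e00 e01 e10 e11 e12 e21 e22
  refine integer_equations ?_ ?_ ?_ ?_ ?_ ?_ ?_ (det_core s) (det_core t)
  all_goals linarith

end Abelian

/-! ### Roots of two-syllable words -/

section Roots

lemma toWord_map_of_injective {α β : Type*} [DecidableEq α] [DecidableEq β] {f : α → β}
    (hf : Function.Injective f) (w : FreeGroup α) :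
    (FreeGroup.map f w).toWord = w.toWord.map fun p => (f p.1, p.2) := by
  conv_lhs => rw [← FreeGroup.mk_toWord (x := w), FreeGroup.map.mk, FreeGroup.toWord_mk]
  refine FreeGroup.IsReduced.reduce_eq ?_
  refine (List.isChain_map _).2 (List.IsChain.imp ?_ (FreeGroup.isReduced_toWord (x := w)))
  intro p q h h'
  exact h (hf h')

lemma firstGen_map {α β : Type*} [DecidableEq α] [DecidableEq β] {f : α → β}
    (hf : Function.Injective f) (w : FreeGroup α) :
    firstGen (FreeGroup.map f w) = (firstGen w).map f := by
  simp [firstGen, toWord_map_of_injective hf, Function.comp_def]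

lemma map_mem_lettersIn {α β : Type*} [DecidableEq α] [DecidableEq β] {f : α → β}
    (hf : Function.Injective f) (w : FreeGroup α) :
    FreeGroup.map f w ∈ lettersIn (Set.range f) := by
  intro p hp
  rw [toWord_map_of_injective hf] at hp
  obtain ⟨q, -, rfl⟩ := List.mem_map.1 hp
  exact ⟨_, rfl⟩

/-- A word with exactly two syllables is not a proper power. -/
lemma pow_ne_zpow_mul_zpow {α : Type*} [DecidableEq α] {s t : α} (hst : s ≠ t) {K L : ℤ}
    (hK : K ≠ 0) (hL : L ≠ 0) (u : FreeGroup α) {n : ℕ} (hn : 2 ≤ n) :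
    u ^ n ≠ FreeGroup.of s ^ K * FreeGroup.of t ^ L := by
  intro h
  have hw : (u ^ n).toWord = List.replicate K.natAbs (s, decide (0 ≤ K)) ++
      List.replicate L.natAbs (t, decide (0 ≤ L)) := by
    rw [h, toWord_mul_of_ne, toWord_zpow, toWord_zpow]
    rw [lastGen_zpow s hK, firstGen_zpow t hL]
    rintro _ ⟨⟩ h'
    exact hst (Option.some_injective _ h').symm
  -- In `s^K t^L` every letter after an occurrence of `t` is again a `t`.
  have hpair : (u ^ n).toWord.Pairwise fun p q => p.1 = t → q.1 = t := by
    rw [hw, List.pairwise_append]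
    refine ⟨?_, ?_, ?_⟩
    · exact List.pairwise_replicate.2 (Or.inr id)
    · exact List.pairwise_replicate.2 (Or.inr id)
    · intro p hp q hq hpt
      rw [List.eq_of_mem_replicate hp] at hpt
      exact absurd hpt hst
  have hfirst : firstGen (u ^ n) = some s := by
    rw [h]
    refine firstGen_zpow_mul s hK ?_
    rw [firstGen_zpow t hL]
    exact fun h' => hst (Option.some_injective _ h').symm
  have hlast : lastGen (u ^ n) = some t := by
    rw [h, ← firstGen_inv, mul_inv_rev, ← zpow_neg, ← zpow_neg]
    refine firstGen_zpow_mul t (neg_ne_zero.2 hL) ?_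
    rw [firstGen_zpow s (neg_ne_zero.2 hK)]
    exact fun h' => hst (Option.some_injective _ h')
  obtain ⟨n, rfl⟩ : ∃ k, n = k + 1 := ⟨n - 1, by omega⟩
  have hpow := FreeGroup.toWord_pow u (n + 1)
  rw [FreeGroup.reduceCyclically.reduce_flatten_replicate_succ FreeGroup.isReduced_toWord] at hpow
  have hcc := FreeGroup.reduceCyclically.conj_conjugator_reduceCyclically u.toWord
  set g := FreeGroup.reduceCyclically.conjugator u.toWord
  set c := FreeGroup.reduceCyclically u.toWord
  -- If `u` is cyclically reduced, the second copy of its word puts an initial `s` after a final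
  -- `t`. Otherwise the conjugator makes the first and last letters of the power share a generator.
  rcases hg : g with _ | ⟨p, g'⟩
  · rw [hg] at hpow
    simp only [List.nil_append, FreeGroup.invRev_empty, List.append_nil] at hpow
    rw [firstGen, hpow, List.head?_flatten_replicate (by omega)] at hfirst
    rw [lastGen, hpow, List.getLast?_flatten_replicate (by omega)] at hlast
    simp only [Option.map_eq_some_iff] at hfirst hlast
    obtain ⟨p, hp, hps⟩ := hfirst
    obtain ⟨q, hq, hqt⟩ := hlast
    obtain ⟨k, rfl⟩ : ∃ k, n = k + 1 := ⟨n - 1, by omega⟩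
    rw [hpow, List.replicate_succ, List.replicate_succ, List.flatten_cons, List.flatten_cons,
      List.pairwise_append] at hpair
    have := hpair.2.2 q (List.mem_of_getLast? hq) p
      (List.mem_append_left _ (List.mem_of_mem_head? hp)) hqt
    exact hst (hps.symm.trans this)
  · rw [hg] at hpow
    rw [firstGen, hpow] at hfirst
    have hpow' : (u ^ (n + 1)).toWord = (p :: g' ++ (List.replicate (n + 1) c).flatten ++
        FreeGroup.invRev g') ++ [(p.1, !p.2)] := by
      rw [hpow, FreeGroup.invRev_cons]; simp [FreeGroup.invRev]
    rw [lastGen, hpow', List.getLast?_concat] at hlast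
    simp at hfirst hlast
    exact hst (hfirst.symm.trans hlast)

/-- If `n ≠ 0`, the left side begins with the generator `a`, while the right side begins with `b`.
-/
lemma conj_zpow_inj {n K i j : ℤ} (hK : K ≠ 0) {K' : ℤ}
    (h : a ^ n * b ^ K * a ^ i = b ^ K' * a ^ j) : n = 0 := by
  by_contra hn
  have hK' : K' = K := by simpa [expSum_of] using (congrArg (expSum (1 : Fin 2)) h).symm
  have h1 : firstGen (a ^ n * b ^ K * a ^ i) = some 0 := by
    rw [mul_assoc]
    refine firstGen_zpow_mul _ hn ?_
    by_cases hi : i = 0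
    · rw [hi, zpow_zero, mul_one, firstGen_zpow _ hK]; decide
    · rw [firstGen_zpow_mul _ hK (by rw [firstGen_zpow _ hi]; decide)]; decide
  have h2 : firstGen (b ^ K' * a ^ j) = some 1 := by
    by_cases hi : j = 0
    · rw [hi, zpow_zero, mul_one, firstGen_zpow _ (hK' ▸ hK)]
    · rw [firstGen_zpow_mul _ (hK' ▸ hK) (by rw [firstGen_zpow _ hi]; decide)]
  rw [h, h2] at h1
  exact absurd h1 (by decide)

lemma three_syllable_inj {i j i' j' K K' : ℤ} (hK : K ≠ 0)
    (h : a ^ i * b ^ K * a ^ j = a ^ i' * b ^ K' * a ^ j') : i = i' ∧ K = K' ∧ j = j' := by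
  have h1 : K = K' := by simpa [expSum_of] using congrArg (expSum (1 : Fin 2)) h
  have h2 : i + j = i' + j' := by simpa [expSum_of] using congrArg (expSum (0 : Fin 2)) h
  have h3 : i - i' = 0 := by
    refine conj_zpow_inj (K := K) (i := j) (K' := K') (j := j') hK ?_
    rw [zpow_sub, ← mul_left_cancel_iff (a := a ^ i')]
    simp only [mul_assoc] at h ⊢
    rw [← h]
    have : Commute (a ^ i) (a ^ i')⁻¹ := (Commute.refl a).zpow_zpow _ _ |>.inv_right
    rw [← mul_assoc (a ^ i), this.eq]
    group
  omega

@[simp] lemma expSum_zero_a : expSum 0 a = 1 := by simp [expSum_of]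

@[simp] lemma expSum_one_a : expSum 1 a = 0 := by simp [expSum_of]

@[simp] lemma expSum_zero_b : expSum 0 b = 0 := by simp [expSum_of]

@[simp] lemma expSum_one_b : expSum 1 b = 1 := by simp [expSum_of]

lemma expSum_zero_bab (i d j : ℤ) : expSum 0 (b ^ i * a ^ d * b ^ j) = d := by simp

lemma expSum_one_bab (i d j : ℤ) : expSum 1 (b ^ i * a ^ d * b ^ j) = i + j := by simp

/-- Roots of words with three syllables `a ^ i * b ^ K * a ^ j`. -/
lemma root_three_syllable {C : F2} {f i j K : ℤ} (hf : f ≠ 0) (hK : K ≠ 0)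
    (h : C ^ f = a ^ i * b ^ K * a ^ j) :
    (expSum 0 C = 0 ∧ j = -i ∧ C = a ^ i * b ^ expSum 1 C * a ^ j) ∨
    (expSum 0 C ≠ 0 ∧ f = 1 ∧ C = a ^ i * b ^ expSum 1 C * a ^ j) ∨
    (expSum 0 C ≠ 0 ∧ f = -1 ∧ C = a ^ (-j) * b ^ expSum 1 C * a ^ (-i)) := by
  have h0 : f * expSum 0 C = i + j := by simpa [expSum_of] using congrArg (expSum (0 : Fin 2)) h
  have h1 : f * expSum 1 C = K := by simpa [expSum_of] using congrArg (expSum (1 : Fin 2)) h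
  by_cases hl : expSum 0 C = 0
  · left
    have hij : j = -i := by rw [hl] at h0; linarith
    refine ⟨hl, hij, ?_⟩
    -- Here `C ^ f` is a conjugate of a power of `b`, and roots in a free group are unique.
    refine zpow_left_injective hf ?_
    change C ^ f = (a ^ i * b ^ expSum 1 C * a ^ j) ^ f
    rw [h, hij, zpow_neg, conj_zpow, ← zpow_mul, mul_comm _ f, h1]
  · right
    have hL : i + j ≠ 0 := by rw [← h0]; exact mul_ne_zero hf hl
    -- Conjugating moves the left `a`-syllable to the right, leaving exactly two syllables; such a
    -- word is not a proper power, so `f = ±1`.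
    have h2 : (a ^ (-i) * C * (a ^ (-i))⁻¹) ^ f = b ^ K * a ^ (i + j) := by
      rw [conj_zpow, h, zpow_add]; group
    have hf1 : f = 1 ∨ f = -1 := by
      by_contra hne
      obtain ⟨n, rfl | rfl⟩ := f.eq_nat_or_neg
      · rw [zpow_natCast] at h2
        exact pow_ne_zpow_mul_zpow (by decide) hK hL _ (by omega) h2
      · rw [zpow_neg, zpow_natCast, ← inv_pow] at h2
        exact pow_ne_zpow_mul_zpow (by decide) hK hL _ (by omega) h2
    rcases hf1 with rfl | rfl
    · left
      rw [one_mul] at h1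
      exact ⟨hl, rfl, by rw [h1, ← h, zpow_one]⟩
    · right
      have h3 : expSum 1 C = -K := by linarith
      refine ⟨hl, rfl, ?_⟩
      rw [h3, ← inv_inj, ← zpow_neg_one, h]
      group

end Roots

/-! ### Blocks of a fixed word -/

section Blocks

lemma lettersIn_le_closure {α : Type*} [DecidableEq α] (S : Set α) :
    lettersIn S ≤ Subgroup.closure (FreeGroup.of '' S) := by
  intro w hw
  rw [← FreeGroup.mk_toWord (x := w)]
  rw [mem_lettersIn] at hw
  generalize w.toWord = l at hw ⊢
  induction l with
  | nil => exact one_mem _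
  | cons p l ih =>
    have : FreeGroup.mk (p :: l) = FreeGroup.mk [p] * FreeGroup.mk l := by simp
    rw [this]
    refine mul_mem ?_ (ih fun q hq => hw q (List.mem_cons_of_mem _ hq))
    have hp : FreeGroup.of p.1 ∈ Subgroup.closure (FreeGroup.of '' S) :=
      Subgroup.subset_closure ⟨_, hw p List.mem_cons_self, rfl⟩
    obtain ⟨t, e⟩ := p
    cases e
    · exact inv_mem hp
    · exact hp

variable {s : MulAut F2}

lemma coreAut_map_lettersIn {u : FreeGroup (Fin 3)} (hu : u ∈ lettersIn {k : Fin 3 | k ≠ 2}) :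
    (coreAut (0 : Fin 2) s).toMonoidHom u ∈ lettersIn {k : Fin 3 | k ≠ 2} := by
  have h1 : ∀ w, incl (0 : Fin 2) w ∈ lettersIn {k : Fin 3 | k ≠ 2} := by
    intro w
    refine lettersIn_mono ?_ (map_mem_lettersIn ?_ w)
    · rintro _ ⟨k, rfl⟩; fin_cases k <;> simp
    · intro k l; fin_cases k <;> fin_cases l <;> simp
  have h2 : u ∈ (incl (0 : Fin 2)).range := by
    rw [range_incl]
    refine Subgroup.closure_mono ?_ (lettersIn_le_closure _ hu)
    rintro _ ⟨k, hk, rfl⟩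
    fin_cases k
    · exact Or.inl rfl
    · exact Or.inr rfl
    · exact absurd rfl hk
  obtain ⟨w, rfl⟩ := h2
  change coreAut 0 s (incl 0 w) ∈ _
  rw [coreAut_incl]
  exact h1 _

/-- The last generator of `F₃`. -/
abbrev z3 : FreeGroup (Fin 3) := FreeGroup.of 2

/-- Fixed words split at powers of `x₃`. The condition on `v` says that `z3 ^ k` is a full syllable.
-/
lemma fixed_block {u : F2} {v : FreeGroup (Fin 3)} {k : ℤ} (hk : k ≠ 0)
    (hv : firstGen v ≠ some 2)
    (h : coreAut (0 : Fin 2) s (incl 0 u * z3 ^ k * v) = incl 0 u * z3 ^ k * v) :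
    s u = u ∧ coreAut (0 : Fin 2) s v = v := by
  have hu : incl (0 : Fin 2) u ∈ lettersIn {k : Fin 3 | k ≠ 2} := by
    refine lettersIn_mono ?_ (map_mem_lettersIn ?_ u)
    · rintro _ ⟨k, rfl⟩; fin_cases k <;> simp
    · intro k l; fin_cases k <;> fin_cases l <;> simp
  have hz : coreAut (0 : Fin 2) s z3 = z3 := coreAut_of_ne s (by decide) (by decide)
  obtain ⟨h1, h2⟩ := fixed_of_fixed_mul (z := 2) (φ := (coreAut (0 : Fin 2) s).toMonoidHom) hz
    (coreAut (0 : Fin 2) s).injective (fun u hu => coreAut_map_lettersIn hu) hu hk hv h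
  refine ⟨incl_injective (0 : Fin 2) ?_, h2⟩
  rw [← coreAut_incl]
  exact h1

/-- The substitution `a ↦ x₁`, `b ↦ C(x₂, x₃)`. -/
def substSnd (C : F2) : F2 →* FreeGroup (Fin 3) :=
  FreeGroup.lift ![FreeGroup.of 0, incl 1 C]

@[simp] lemma substSnd_a (C : F2) : substSnd C a = FreeGroup.of 0 := by simp [substSnd]

@[simp] lemma substSnd_b (C : F2) : substSnd C b = incl 1 C := by simp [substSnd]

lemma coreAut_one_incl_zero (t : MulAut F2) (w : F2) :
    coreAut (1 : Fin 2) t (incl 0 w) = substSnd (t a) w := by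
  have : (coreAut (1 : Fin 2) t).toMonoidHom.comp (incl 0) = substSnd (t a) := by
    refine hom_F2_ext ?_ ?_
    · change coreAut (1 : Fin 2) t (incl 0 a) = _
      rw [incl_a, substSnd_a]
      exact coreAut_of_ne t (by decide) (by decide)
    · change coreAut (1 : Fin 2) t (incl 0 b) = _
      rw [incl_b, substSnd_b]
      exact coreAut_castSucc 1 t
  exact DFunLike.congr_fun this w

/-- The second automorphism fixes `x₁`, so evaluating the relation at `x₁` makes the image of `x₁`
under `s` and then `t` invariant under a further application of `s`. -/
lemma Braid.fixed {t : MulAut F2} (h : Braid s t) :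
    coreAut (0 : Fin 2) s (substSnd (t a) (s a)) = substSnd (t a) (s a) := by
  have h1 := DFunLike.congr_fun h (FreeGroup.of 0)
  simp only [MulAut.mul_apply] at h1
  have h2 : coreAut (1 : Fin 2) t (FreeGroup.of 0) = FreeGroup.of 0 :=
    coreAut_of_ne t (by decide) (by decide)
  have h3 : coreAut (0 : Fin 2) s (FreeGroup.of 0) = incl 0 (s a) := coreAut_castSucc 0 s
  rw [h2, h3, coreAut_one_incl_zero] at h1
  exact h1

lemma incl_one_mem (w : F2) : incl (1 : Fin 2) w ∈ lettersIn {k : Fin 3 | k ≠ 0} := by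
  refine lettersIn_mono ?_ (map_mem_lettersIn ?_ w)
  · rintro _ ⟨k, rfl⟩; fin_cases k <;> simp
  · intro k l; fin_cases k <;> fin_cases l <;> simp

lemma firstGen_incl_one_ne {w : F2} (hw : firstGen w ≠ some 1) :
    firstGen (incl (1 : Fin 2) w) ≠ some 2 := by
  rw [incl, firstGen_map (by intro k l; fin_cases k <;> fin_cases l <;> simp)]
  cases h : firstGen w with
  | none => simp
  | some k =>
    rw [h] at hw
    fin_cases k
    · simp
    · simp at hw

lemma firstGen_F2 {w : F2} (h0 : firstGen w ≠ some 0) (hw : w ≠ 1) : firstGen w = some 1 := by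
  cases h : firstGen w with
  | none => exact absurd (firstGen_eq_none.1 h) hw
  | some k => fin_cases k <;> simp_all

lemma firstGen_F2' {w : F2} (h0 : firstGen w ≠ some 1) (hw : w ≠ 1) : firstGen w = some 0 := by
  cases h : firstGen w with
  | none => exact absurd (firstGen_eq_none.1 h) hw
  | some k => fin_cases k <;> simp_all

/-- Nontrivial powers of `C(x₂, x₃)` alternate with powers of `x₁` without cancellation, so the
result begins with `x₁` or is trivial. -/
lemma firstGen_substSnd {C : F2} (hC : C ≠ 1) (w : F2) (hw : firstGen w ≠ some 1) (k : Fin 3)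
    (hk : k ≠ 0) : firstGen (substSnd C w) ≠ some k := by
  induction hn : w.norm using Nat.strong_induction_on generalizing w k with
  | _ n ih =>
  by_cases hw1 : w = 1
  · simp [hw1]
  obtain ⟨e, v, hwv, hv, hvn, he, -⟩ := exists_zpow_mul 0 w
  obtain ⟨he, -⟩ := he (firstGen_F2' hw hw1)
  have hsub : substSnd C w = FreeGroup.of 0 ^ e * substSnd C v := by
    rw [hwv, map_mul, map_zpow]; congr 2
  have hfv : firstGen (substSnd C v) ≠ some 0 := by
    by_cases hv1 : v = 1
    · simp [hv1]
    obtain ⟨f, v', hvv', hv', -, hf, -⟩ := exists_zpow_mul 1 v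
    obtain ⟨hf, hlt⟩ := hf (firstGen_F2 hv hv1)
    have hsub' : substSnd C v = incl 1 (C ^ f) * substSnd C v' := by
      rw [hvv', map_mul, map_zpow, map_zpow]; congr 2; exact substSnd_b C
    have hCf : C ^ f ≠ 1 := by
      intro h; exact hC (zpow_left_injective hf (by simpa using h))
    rw [hsub', firstGen_mul_of_mem (incl_one_mem _)
      (by simpa using ((map_ne_one_iff _ (incl_injective (1 : Fin 2))).2 hCf))]
    · intro h; exact firstGen_mem (incl_one_mem _) h rfl
    · intro k hk; exact ih _ (by omega) v' hv' k hk rfl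
  rw [hsub, firstGen_zpow_mul 0 he hfv]
  intro h; exact hk (Option.some_injective _ h).symm

lemma incl_one_zpow_a (i : ℤ) : incl (1 : Fin 2) (a ^ i) = incl (0 : Fin 2) (b ^ i) := by
  rw [map_zpow, map_zpow, incl_a, incl_b]; rfl

lemma incl_one_zpow_b (i : ℤ) : incl (1 : Fin 2) (b ^ i) = z3 ^ i := by
  rw [map_zpow, incl_b]; rfl

lemma firstGen_zpow_b_mul_ne {v : FreeGroup (Fin 3)} (hv : firstGen v ≠ some 2)
    (hv1 : firstGen v ≠ some 1) (j : ℤ) : firstGen (incl (0 : Fin 2) (b ^ j) * v) ≠ some 2 := by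
  rw [map_zpow, incl_b]
  by_cases hj : j = 0
  · simpa [hj] using hv
  · change firstGen (FreeGroup.of (1 : Fin 3) ^ j * v) ≠ _
    rw [firstGen_zpow_mul _ hj hv1]; decide

/-- If no nontrivial power of `b` is fixed, a fixed word containing a block `E(x₂, x₃)` has only one
`x₃`-syllable in this block. -/
lemma fixed_subst_block (hno : ∀ l : ℤ, s (b ^ l) = b ^ l → l = 0) {u E : F2}
    {v : FreeGroup (Fin 3)} (hE : expSum 1 E ≠ 0) (hv1 : firstGen v ≠ some 1)
    (hv2 : firstGen v ≠ some 2)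
    (h : coreAut (0 : Fin 2) s (incl 0 u * incl 1 E * v) = incl 0 u * incl 1 E * v) :
    ∃ i k j : ℤ, k ≠ 0 ∧ E = a ^ i * b ^ k * a ^ j ∧ s (u * b ^ i) = u * b ^ i ∧
      coreAut (0 : Fin 2) s (incl 0 (b ^ j) * v) = incl 0 (b ^ j) * v := by
  obtain ⟨i, E₁, rfl, hE₁, -⟩ := exists_zpow_mul 0 E
  have hE₁1 : E₁ ≠ 1 := by
    rintro rfl; simp [expSum_of] at hE
  obtain ⟨k, E₂, rfl, hE₂, -, hk', -⟩ := exists_zpow_mul 1 E₁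
  have hk := (hk' (firstGen_F2 hE₁ hE₁1)).1
  clear hk'
  obtain ⟨j, E₃, rfl, hE₃, -⟩ := exists_zpow_mul 0 E₂
  change coreAut (0 : Fin 2) s (incl 0 u * incl 1 (a ^ i * (b ^ k * (a ^ j * E₃))) * v) =
    incl 0 u * incl 1 (a ^ i * (b ^ k * (a ^ j * E₃))) * v at h
  have hre : incl 0 u * incl 1 (a ^ i * (b ^ k * (a ^ j * E₃))) * v =
      incl (0 : Fin 2) (u * b ^ i) * z3 ^ k * (incl 0 (b ^ j) * (incl 1 E₃ * v)) := by
    simp only [map_mul, incl_one_zpow_a, incl_one_zpow_b, mul_assoc]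
  rw [hre] at h
  -- A nontrivial `E₃` begins with another power of `x₃`, which isolates a nonzero power of `x₂`
  -- between two powers of `x₃`. That power would be fixed by `s`, against `hno`.
  by_cases hE₃1 : E₃ = 1
  · subst hE₃1
    rw [map_one, one_mul] at h
    obtain ⟨h1, h2⟩ := fixed_block hk (firstGen_zpow_b_mul_ne hv2 hv1 j) h
    exact ⟨i, k, j, hk, by simp [mul_assoc], h1, h2⟩
  · exfalso
    have hfE₃ := firstGen_F2 hE₃ hE₃1
    have hj : j ≠ 0 := by
      rintro rfl
      rw [zpow_zero, one_mul] at hE₂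
      exact hE₂ hfE₃
    obtain ⟨k', E₄, rfl, hE₄, -, hk', -⟩ := exists_zpow_mul 1 E₃
    obtain ⟨hk', -⟩ := hk' hfE₃
    have hE₄v : firstGen (incl (1 : Fin 2) E₄ * v) ≠ some 2 := by
      by_cases hE₄1 : E₄ = 1
      · simpa [hE₄1] using hv2
      · rw [firstGen_mul_of_mem (incl_one_mem _)
          (by simpa using (map_ne_one_iff _ (incl_injective (1 : Fin 2))).2 hE₄1)]
        · exact firstGen_incl_one_ne hE₄
        · intro k hk; fin_cases k
          exacts [absurd rfl hk, hv1, hv2]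
    have hre' : incl (1 : Fin 2) (b ^ k' * E₄) * v = z3 ^ k' * (incl 1 E₄ * v) := by
      rw [map_mul, incl_one_zpow_b, mul_assoc]
    have hz : firstGen (z3 ^ k' * (incl (1 : Fin 2) E₄ * v)) = some 2 :=
      firstGen_zpow_mul _ hk' hE₄v
    change coreAut (0 : Fin 2) s (_ * (_ * (incl 1 (b ^ k' * E₄) * v))) =
      _ * (_ * (incl 1 (b ^ k' * E₄) * v)) at h
    rw [hre'] at h
    obtain ⟨-, h2⟩ := fixed_block hk (by
      rw [map_zpow, incl_b]
      change firstGen (FreeGroup.of (1 : Fin 3) ^ j * _) ≠ _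
      rw [firstGen_zpow_mul _ hj (by rw [hz]; decide)]
      decide) h
    rw [← mul_assoc] at h2
    exact hj (hno j (fixed_block hk' hE₄v h2).1)

/-- The first syllable of `A` in a fixed word `u * A(x₁, C(x₂, x₃))`. -/
lemma fixed_syllable (hno : ∀ l : ℤ, s (b ^ l) = b ^ l → l = 0) {C u A : F2} {e f : ℤ}
    (hC : expSum 1 C ≠ 0) (hf : f ≠ 0) (hA : firstGen A ≠ some 1)
    (h : coreAut (0 : Fin 2) s (incl 0 u * substSnd C (a ^ e * b ^ f * A)) =
      incl 0 u * substSnd C (a ^ e * b ^ f * A)) :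
    ∃ i j : ℤ, C = a ^ i * b ^ expSum 1 C * a ^ j ∧ i + j = expSum 0 C ∧
      (expSum 0 C = 0 ∨ f = 1 ∨ f = -1) ∧
      s (u * a ^ e * b ^ (if 0 < f then i else -j)) = u * a ^ e * b ^ (if 0 < f then i else -j) ∧
      coreAut (0 : Fin 2) s (incl 0 (b ^ (if 0 < f then j else -i)) * substSnd C A) =
        incl 0 (b ^ (if 0 < f then j else -i)) * substSnd C A := by
  have hC1 : C ≠ 1 := by rintro rfl; simp at hC
  have hre : incl 0 u * substSnd C (a ^ e * b ^ f * A) =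
      incl (0 : Fin 2) (u * a ^ e) * incl 1 (C ^ f) * substSnd C A := by
    simp only [map_mul, map_zpow, substSnd_a, substSnd_b, incl_a, mul_assoc]; rfl
  rw [hre] at h
  obtain ⟨i, k, j, hk, hE, h1, h2⟩ := fixed_subst_block hno
    (by rw [expSum_zpow]; exact mul_ne_zero hf hC)
    (firstGen_substSnd hC1 A hA 1 (by decide)) (firstGen_substSnd hC1 A hA 2 (by decide)) h
  have sum : ∀ i j : ℤ, C = a ^ i * b ^ expSum 1 C * a ^ j → i + j = expSum 0 C := by
    intro i j hC
    have := congrArg (expSum (0 : Fin 2)) hC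
    simp [expSum_of] at this
    exact this.symm
  -- For `f = -1` the block is `C⁻¹`, with outer exponents `-j` and `-i`; this is the source of the
  -- case distinction on the sign of `f`. If `C` has `a`-exponent sum zero then `j = -i` and both
  -- branches coincide.
  rcases root_three_syllable hf hk hE with ⟨h3, rfl, h4⟩ | ⟨h3, rfl, h4⟩ | ⟨h3, rfl, h4⟩
  · refine ⟨i, -i, h4, sum _ _ h4, Or.inl h3, ?_, ?_⟩
    · simpa using h1
    · simpa using h2
  · exact ⟨i, j, h4, sum _ _ h4, Or.inr (Or.inl rfl), by simpa using h1, by simpa using h2⟩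
  · exact ⟨-j, -i, h4, sum _ _ h4, Or.inr (Or.inr rfl), by simpa using h1, by simpa using h2⟩

/-- The three-syllable form of `C` is unique, so the same `i` and `j` serve every occurrence of `C`
in the word. -/
lemma fixed_syllable' (hno : ∀ l : ℤ, s (b ^ l) = b ^ l → l = 0) {C u A : F2} {e f i j : ℤ}
    (hC : expSum 1 C ≠ 0) (hCij : C = a ^ i * b ^ expSum 1 C * a ^ j) (hf : f ≠ 0)
    (hA : firstGen A ≠ some 1)
    (h : coreAut (0 : Fin 2) s (incl 0 u * substSnd C (a ^ e * b ^ f * A)) =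
      incl 0 u * substSnd C (a ^ e * b ^ f * A)) :
    (expSum 0 C = 0 ∨ f = 1 ∨ f = -1) ∧
      s (u * a ^ e * b ^ (if 0 < f then i else -j)) = u * a ^ e * b ^ (if 0 < f then i else -j) ∧
      coreAut (0 : Fin 2) s (incl 0 (b ^ (if 0 < f then j else -i)) * substSnd C A) =
        incl 0 (b ^ (if 0 < f then j else -i)) * substSnd C A := by
  obtain ⟨i', j', h1, -, h2⟩ := fixed_syllable hno hC hf hA h
  obtain ⟨rfl, -, rfl⟩ := three_syllable_inj hC (hCij.symm.trans h1)
  exact h2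

lemma exists_syllables (A : F2) (hA : firstGen A ≠ some 1) :
    (∃ d : ℤ, A = a ^ d) ∨ ∃ (d g : ℤ) (A' : F2), d ≠ 0 ∧ g ≠ 0 ∧ firstGen A' ≠ some 1 ∧
      A = a ^ d * b ^ g * A' ∧ A'.norm < A.norm := by
  obtain ⟨d, A₁, hAd, hA₁, hn, hd, -⟩ := exists_zpow_mul 0 A
  by_cases h1 : A₁ = 1
  · exact Or.inl ⟨d, by rw [hAd, h1, mul_one]⟩
  right
  have hA1 : A ≠ 1 := by
    rintro rfl
    have : A₁.norm = 0 := by simpa using hn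
    exact h1 (FreeGroup.norm_eq_zero.1 this)
  obtain ⟨hd, -⟩ := hd (firstGen_F2' hA hA1)
  obtain ⟨g, A', hAg, hA', -, hg, -⟩ := exists_zpow_mul 1 A₁
  obtain ⟨hg, hlt⟩ := hg (firstGen_F2 hA₁ h1)
  exact ⟨d, g, A', hd, hg, hA', by rw [hAd, hAg, mul_assoc], by omega⟩

/-- In the situation `expSum 0 C ≠ 0`, all `b`-syllables of `A` are equal to the same letter. -/
lemma sign_mul_expSum_nonneg (hno : ∀ w : F2, s w = w → (expSum 0 w = 0 ↔ expSum 1 w = 0))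
    {C : F2} {i j : ℤ} (hC : expSum 1 C ≠ 0) (hl : expSum 0 C ≠ 0)
    (hCij : C = a ^ i * b ^ expSum 1 C * a ^ j) {f : ℤ} (hf : f = 1 ∨ f = -1) (A : F2)
    (hA : firstGen A ≠ some 1)
    (h : coreAut (0 : Fin 2) s (incl 0 (b ^ (if 0 < f then j else -i)) * substSnd C A) =
        incl 0 (b ^ (if 0 < f then j else -i)) * substSnd C A) :
    0 ≤ f * expSum 1 A ∧ (f * expSum 1 A = 0 → ∃ d : ℤ, A = a ^ d) := by
  induction hn : A.norm using Nat.strong_induction_on generalizing A with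
  | _ n ih =>
  have hnob : ∀ l : ℤ, s (b ^ l) = b ^ l → l = 0 := by
    intro l hl
    simpa [expSum_of] using (hno _ hl)
  rcases exists_syllables A hA with ⟨d, rfl⟩ | ⟨d, g, A', hd, hg, hA', rfl, hlt⟩
  · simp [expSum_of]
  obtain ⟨h1, h2, h3⟩ := fixed_syllable' hnob hC hCij hg hA' h
  have h1 := h1.resolve_left hl
  have h4 := hno _ h2
  rw [expSum_zero_bab, expSum_one_bab] at h4
  -- If the signs were opposite, the outer `b`-exponents of the fixed block `h2` would cancel while
  -- its `a`-exponent `d` is nonzero.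
  have hgf : g = f := by
    rcases hf with rfl | rfl <;> rcases h1 with rfl | rfl <;> simp [hd] at h4 ⊢
  subst hgf
  have h5 := ih _ (hn ▸ hlt) A' hA' h3 rfl
  have : g * expSum 1 (a ^ d * b ^ g * A') = 1 + g * expSum 1 A' := by
    rcases hf with rfl | rfl <;> simp [expSum_of]
    ring
  rw [this]
  constructor
  · linarith
  · intro h; linarith

/-- The structure of two words `A`, `C` such that `A(x₁, C(x₂, x₃))` is fixed by the local
automorphism with core `s`, provided no element fixed by `s` has exactly one vanishing exponent
sum. -/
theorem structure_of_fixed (hno : ∀ w : F2, s w = w → (expSum 0 w = 0 ↔ expSum 1 w = 0))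
    {A C : F2} (hA : expSum 1 A ≠ 0) (hC : expSum 1 C ≠ 0)
    (h : coreAut (0 : Fin 2) s (substSnd C A) = substSnd C A) :
    ∃ i j : ℤ, C = a ^ i * b ^ expSum 1 C * a ^ j ∧ i + j = expSum 0 C ∧
      ((∃ c d f : ℤ, A = a ^ c * b ^ f * a ^ d ∧ f = expSum 1 A ∧
        (expSum 0 C = 0 ∨ f = 1 ∨ f = -1) ∧
        s (a ^ c * b ^ (if 0 < f then i else -j)) = a ^ c * b ^ (if 0 < f then i else -j) ∧
        s (b ^ (if 0 < f then j else -i) * a ^ d) = b ^ (if 0 < f then j else -i) * a ^ d) ∨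
      (expSum 0 C ≠ 0 ∧ expSum 1 A ≠ 1 ∧ expSum 1 A ≠ -1 ∧ ∃ w : F2, s w = w ∧
        expSum 0 w ≠ 0 ∧ (expSum 1 w = expSum 0 C ∨ expSum 1 w = -expSum 0 C))) := by
  have hnob : ∀ l : ℤ, s (b ^ l) = b ^ l → l = 0 := by
    intro l hl
    simpa [expSum_of] using (hno _ hl)
  obtain ⟨c, A₁, rfl, hA₁, -⟩ := exists_zpow_mul 0 A
  have hA₁1 : A₁ ≠ 1 := by
    rintro rfl; simp [expSum_of] at hA
  obtain ⟨f, A₂, rfl, hA₂, -, hf, -⟩ := exists_zpow_mul 1 A₁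
  obtain ⟨hf, -⟩ := hf (firstGen_F2 hA₁ hA₁1)
  change coreAut (0 : Fin 2) s (substSnd C (a ^ c * (b ^ f * A₂))) =
    substSnd C (a ^ c * (b ^ f * A₂)) at h
  rw [← mul_assoc] at h
  obtain ⟨i, j, hCij, hij, hf1, h1, h2⟩ := fixed_syllable (u := 1) hnob hC hf hA₂ (by simpa using h)
  refine ⟨i, j, hCij, hij, ?_⟩
  rw [one_mul] at h1
  have single : ∀ d : ℤ, A₂ = a ^ d →
      ((∃ c' d f' : ℤ, a ^ c * (b ^ f * A₂) = a ^ c' * b ^ f' * a ^ d ∧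
        f' = expSum 1 (a ^ c * (b ^ f * A₂)) ∧ (expSum 0 C = 0 ∨ f' = 1 ∨ f' = -1) ∧
        s (a ^ c' * b ^ (if 0 < f' then i else -j)) = a ^ c' * b ^ (if 0 < f' then i else -j) ∧
        s (b ^ (if 0 < f' then j else -i) * a ^ d) = b ^ (if 0 < f' then j else -i) * a ^ d)) := by
    rintro d rfl
    refine ⟨c, d, f, (mul_assoc _ _ _).symm, by simp [expSum_of], hf1, h1, ?_⟩
    refine incl_injective (0 : Fin 2) ?_
    rw [← coreAut_incl, map_mul (incl 0), map_zpow (incl 0) a, incl_a]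
    rw [map_zpow (substSnd C), substSnd_a] at h2
    exact h2
  rcases exists_syllables A₂ hA₂ with ⟨d, hd⟩ | ⟨d, g, A', hd, hg, hA', hA₂', -⟩
  · exact Or.inl (single d hd)
  subst hA₂'
  obtain ⟨hg1, h3, -⟩ := fixed_syllable' hnob hC hCij hg hA' h2
  have h4 := hno _ h3
  -- Then `j = -i`, and the block between two occurrences of powers of `C` has `b`-exponent sum zero
  -- but `a`-exponent sum `d ≠ 0`.
  by_cases hl : expSum 0 C = 0
  · exfalso
    rw [expSum_zero_bab, expSum_one_bab] at h4
    split_ifs at h4 <;> omega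
  have hf1 := hf1.resolve_left hl
  have hg1 := hg1.resolve_left hl
  have hsum := sign_mul_expSum_nonneg hno hC hl hCij hf1 _ hA₂ h2
  by_cases h5 : f * expSum 1 (a ^ d * b ^ g * A') = 0
  · obtain ⟨d', hd'⟩ := hsum.2 h5
    exact Or.inl (single d' hd')
  right
  have h6 : 0 < f * expSum 1 (a ^ d * b ^ g * A') := lt_of_le_of_ne hsum.1 (Ne.symm h5)
  -- The first `b`-syllable contributes `f` and the rest a nonzero sum of the same sign, so the
  -- total is not `±1`. The witness is the fixed block between the first two occurrences of
  -- `C^(±1)`.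
  refine ⟨hl, ?_, ?_, _, h3, ?_, ?_⟩
  · rcases hf1 with rfl | rfl <;> simp [expSum_of] at h6 ⊢ <;> omega
  · rcases hf1 with rfl | rfl <;> simp [expSum_of] at h6 ⊢ <;> omega
  · rwa [expSum_zero_bab]
  · rw [expSum_zero_bab, expSum_one_bab] at h4
    rw [expSum_one_bab]
    rcases hf1 with rfl | rfl <;> rcases hg1 with rfl | rfl <;> simp at h4 ⊢ <;> omega

end Blocks

/-! ### Symmetries of the braid relation -/

section Symmetries

/-- The automorphism of `F₂` interchanging the letters. -/
def swapAut : MulAut F2 := FreeGroup.freeGroupCongr (Equiv.swap (0 : Fin 2) 1)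

lemma swapAut_apply (w : F2) : swapAut w = swapLetters w := rfl

@[simp] lemma swapLetters_a : swapLetters a = b := by simp [swapLetters]

@[simp] lemma swapLetters_b : swapLetters b = a := by simp [swapLetters]

@[simp] lemma swapLetters_mul (u v : F2) : swapLetters (u * v) = swapLetters u * swapLetters v :=
  map_mul swapAut u v

@[simp] lemma swapLetters_inv (u : F2) : swapLetters u⁻¹ = (swapLetters u)⁻¹ := map_inv swapAut u

@[simp] lemma swapLetters_zpow (u : F2) (n : ℤ) : swapLetters (u ^ n) = swapLetters u ^ n :=
  map_zpow swapAut u n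

@[simp] lemma swapLetters_pow (u : F2) (n : ℕ) : swapLetters (u ^ n) = swapLetters u ^ n :=
  map_pow swapAut u n

@[simp] lemma swapLetters_swapLetters (w : F2) : swapLetters (swapLetters w) = w := by
  have : swapAut * swapAut = 1 := aut_F2_ext (by simp [swapAut_apply]) (by simp [swapAut_apply])
  exact DFunLike.congr_fun this w

lemma expSum_zero_swapLetters (w : F2) : expSum 0 (swapLetters w) = expSum 1 w := by
  have := expSum_map swapAut.toMonoidHom 0 w
  rw [Fin.sum_univ_two] at this
  change expSum 0 (swapLetters w) =
    _ * expSum 0 (swapLetters a) + _ * expSum 0 (swapLetters b) at this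
  simpa using this

lemma expSum_one_swapLetters (w : F2) : expSum 1 (swapLetters w) = expSum 0 w := by
  rw [← expSum_zero_swapLetters, swapLetters_swapLetters]

/-- Conjugation by the interchange of letters. -/
def swapConj (s : MulAut F2) : MulAut F2 := swapAut * s * swapAut

lemma swapConj_apply (s : MulAut F2) (w : F2) :
    swapConj s w = swapLetters (s (swapLetters w)) := rfl

lemma swapConj_a (s : MulAut F2) : swapConj s a = swapLetters (s b) := by
  rw [swapConj_apply, swapLetters_a]

lemma swapConj_b (s : MulAut F2) : swapConj s b = swapLetters (s a) := by
  rw [swapConj_apply, swapLetters_b]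

/-! ### Reading words backward -/

/-- The automorphism of a free group inverting all generators. -/
def invGens (α : Type*) : MulAut (FreeGroup α) :=
  MonoidHom.toMulEquiv (FreeGroup.lift fun s => (FreeGroup.of s)⁻¹)
    (FreeGroup.lift fun s => (FreeGroup.of s)⁻¹) (by ext; simp) (by ext; simp)

@[simp] lemma invGens_of {α : Type*} (s : α) :
    invGens α (FreeGroup.of s) = (FreeGroup.of s)⁻¹ := by
  change FreeGroup.lift (fun s => (FreeGroup.of s)⁻¹) (FreeGroup.of s) = _
  simp

@[simp] lemma invGens_invGens {α : Type*} (w : FreeGroup α) : invGens α (invGens α w) = w := by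
  have : (invGens α).toMonoidHom.comp (invGens α).toMonoidHom = MonoidHom.id _ := by
    ext s; simp
  exact DFunLike.congr_fun this w

/-- Reading backward is an anti-automorphism; after composition with inversion it becomes an
automorphism, so the backward symmetry acts on cores by conjugation. -/
lemma readBackward_eq (w : F2) : readBackward w = (invGens (Fin 2) w)⁻¹ := by
  rw [readBackward, ← inv_inj, inv_inv]
  conv_rhs => rw [← FreeGroup.mk_toWord (x := w)]
  induction w.toWord with
  | nil => simp [← FreeGroup.one_eq_mk]
  | cons p l ih =>
    have h1 : FreeGroup.mk (p :: l) = FreeGroup.mk [p] * FreeGroup.mk l := by simp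
    have h2 : FreeGroup.mk (p :: l).reverse = FreeGroup.mk l.reverse * FreeGroup.mk [p] := by simp
    rw [h1, h2, map_mul, mul_inv_rev, ih]
    congr 1
    obtain ⟨s, e⟩ := p
    cases e
    · change (FreeGroup.of s)⁻¹⁻¹ = invGens (Fin 2) (FreeGroup.of s)⁻¹
      simp
    · change (FreeGroup.of s)⁻¹ = invGens (Fin 2) (FreeGroup.of s)
      simp

/-- The automorphism acting by reading words backward before and after. -/
def backConj (s : MulAut F2) : MulAut F2 := invGens (Fin 2) * s * invGens (Fin 2)

lemma backConj_apply (s : MulAut F2) (w : F2) :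
    backConj s w = invGens (Fin 2) (s (invGens (Fin 2) w)) := rfl

lemma backConj_a (s : MulAut F2) : backConj s a = readBackward (s a) := by
  rw [backConj_apply, readBackward_eq, invGens_of, map_inv, map_inv]

lemma backConj_b (s : MulAut F2) : backConj s b = readBackward (s b) := by
  rw [backConj_apply, readBackward_eq, invGens_of, map_inv, map_inv]

variable {s t : MulAut F2}

lemma Braid.inverse (h : Braid s t) : Braid s⁻¹ t⁻¹ := by
  have := congrArg (·⁻¹) (h : _ * _ * _ = _ * _ * _)
  simp only [mul_inv_rev, ← coreAut_inv, ← mul_assoc] at this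
  exact this

lemma Braid.conj {P : MulAut (FreeGroup (Fin 3))} {x y x' y' : MulAut (FreeGroup (Fin 3))}
    (hx : ∀ w, P (x w) = x' (P w)) (hy : ∀ w, P (y w) = y' (P w)) (h : x * y * x = y * x * y) :
    x' * y' * x' = y' * x' * y' := by
  refine MulEquiv.ext fun w => ?_
  obtain ⟨v, rfl⟩ := P.surjective w
  have := congrArg P (DFunLike.congr_fun h v)
  simpa only [MulAut.mul_apply, hx, hy] using this

lemma invGens_incl {m : ℕ} (i : Fin m) (w : F2) :
    invGens _ (incl i w) = incl i (invGens (Fin 2) w) := by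
  have : (invGens (Fin (m + 1))).toMonoidHom.comp (incl i) =
      (incl i).comp (invGens (Fin 2)).toMonoidHom := by
    refine hom_F2_ext ?_ ?_
    · change invGens _ (incl i a) = incl i (invGens (Fin 2) a)
      rw [invGens_of, map_inv, incl_a, invGens_of]
    · change invGens _ (incl i b) = incl i (invGens (Fin 2) b)
      rw [invGens_of, map_inv, incl_b, invGens_of]
  exact DFunLike.congr_fun this w

lemma invGens_coreAut {m : ℕ} (i : Fin m) (s : MulAut F2) (w : FreeGroup (Fin (m + 1))) :
    invGens _ (coreAut i s w) = coreAut i (backConj s) (invGens _ w) := by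
  have : (invGens _).toMonoidHom.comp (coreAut i s).toMonoidHom =
      (coreAut i (backConj s)).toMonoidHom.comp (invGens (Fin (m + 1))).toMonoidHom := by
    refine hom_ext_core i (fun j h1 h2 => ?_) fun w => ?_
    · change invGens _ (coreAut i s (FreeGroup.of j)) =
        coreAut i (backConj s) (invGens _ (FreeGroup.of j))
      rw [coreAut_of_ne s h1 h2, invGens_of, map_inv, coreAut_of_ne _ h1 h2]
    · change invGens _ (coreAut i s (incl i w)) = coreAut i (backConj s) (invGens _ (incl i w))
      rw [coreAut_incl, invGens_incl, invGens_incl, coreAut_incl, backConj_apply, invGens_invGens]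
  exact DFunLike.congr_fun this w

lemma Braid.backward (h : Braid s t) : Braid (backConj s) (backConj t) :=
  Braid.conj (P := invGens _) (invGens_coreAut 0 s) (invGens_coreAut 1 t) h

/-! ### Reversing the order of the generators -/

/-- The automorphism of `F₃` reversing the order of the generators. -/
def revGens : MulAut (FreeGroup (Fin 3)) := FreeGroup.freeGroupCongr (Equiv.swap (0 : Fin 3) 2)

lemma revGens_incl_zero (w : F2) : revGens (incl (0 : Fin 2) w) = incl 1 (swapLetters w) := by
  have : revGens.toMonoidHom.comp (incl (0 : Fin 2)) =
      (incl (1 : Fin 2)).comp swapAut.toMonoidHom := by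
    refine hom_F2_ext ?_ ?_
    · change revGens (incl (0 : Fin 2) a) = incl 1 (swapLetters a)
      rw [swapLetters_a, incl_a, incl_b]; rfl
    · change revGens (incl (0 : Fin 2) b) = incl 1 (swapLetters b)
      rw [swapLetters_b, incl_a, incl_b]; rfl
  exact DFunLike.congr_fun this w

lemma revGens_revGens (w : FreeGroup (Fin 3)) : revGens (revGens w) = w := by
  have : revGens.toMonoidHom.comp revGens.toMonoidHom = MonoidHom.id _ := by
    ext s; fin_cases s <;> rfl
  exact DFunLike.congr_fun this w

lemma revGens_coreAut_zero (s : MulAut F2) (w : FreeGroup (Fin 3)) :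
    revGens (coreAut (0 : Fin 2) s w) = coreAut 1 (swapConj s) (revGens w) := by
  have : revGens.toMonoidHom.comp (coreAut (0 : Fin 2) s).toMonoidHom =
      (coreAut (1 : Fin 2) (swapConj s)).toMonoidHom.comp revGens.toMonoidHom := by
    refine hom_ext_core 0 (fun j h1 h2 => ?_) fun w => ?_
    · obtain rfl : j = 2 := by fin_cases j <;> simp_all [Fin.ext_iff]
      change revGens (coreAut (0 : Fin 2) s (FreeGroup.of 2)) =
        coreAut 1 (swapConj s) (FreeGroup.of 0)
      rw [coreAut_of_ne s h1 h2, coreAut_of_ne _ (by decide) (by decide)]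
      rfl
    · change revGens (coreAut (0 : Fin 2) s (incl 0 w)) =
        coreAut 1 (swapConj s) (revGens (incl 0 w))
      rw [coreAut_incl, revGens_incl_zero, revGens_incl_zero, coreAut_incl, swapConj_apply,
        swapLetters_swapLetters]
  exact DFunLike.congr_fun this w

lemma swapConj_swapConj (s : MulAut F2) : swapConj (swapConj s) = s := by
  refine MulEquiv.ext fun w => ?_
  simp [swapConj_apply]

lemma revGens_coreAut_one (s : MulAut F2) (w : FreeGroup (Fin 3)) :
    revGens (coreAut (1 : Fin 2) s w) = coreAut 0 (swapConj s) (revGens w) := by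
  rw [← revGens_revGens (coreAut 0 _ _), revGens_coreAut_zero, swapConj_swapConj, revGens_revGens]

lemma Braid.swap (h : Braid s t) : Braid (swapConj t) (swapConj s) :=
  (Braid.conj (P := revGens) (revGens_coreAut_zero s) (revGens_coreAut_one t) h).symm

/-- The swap symmetry on a single pair of words. -/
def swapPair (v : WordPair) : WordPair := (swapLetters v.2, swapLetters v.1)

@[simp] lemma swapPair_swapPair (v : WordPair) : swapPair (swapPair v) = v := by
  simp [swapPair]

end Symmetries

/-! ### Word equations in `F₂` -/

section WordEquations

lemma conj_zpow_inj' {n K i j : ℤ} (hK : K ≠ 0) {K' : ℤ}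
    (h : b ^ n * a ^ K * b ^ i = a ^ K' * b ^ j) : n = 0 := by
  have := congrArg swapLetters h
  simp only [swapLetters_mul, swapLetters_zpow, swapLetters_a, swapLetters_b] at this
  exact conj_zpow_inj hK this

lemma eq_zero_of_conj {c p : ℤ} (h : a ^ (-c) * b ^ p * a ^ c = b ^ p) : c = 0 ∨ p = 0 := by
  by_cases hp : p = 0
  · exact Or.inr hp
  · left
    have := conj_zpow_inj (n := -c) (i := c) (j := 0) hp (K' := p) (by simpa using h)
    omega

/-- Unipotent upper triangular matrices. -/
def upperHom : Multiplicative ℤ →* Matrix.SpecialLinearGroup (Fin 2) ℤ where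
  toFun n := ⟨!![1, n.toAdd; 0, 1], by simp [Matrix.det_fin_two]⟩
  map_one' := by ext i j; fin_cases i <;> fin_cases j <;> simp
  map_mul' m n := by
    refine Subtype.ext ?_
    change !![1, m.toAdd + n.toAdd; 0, 1] = !![1, m.toAdd; 0, 1] * !![1, n.toAdd; 0, 1]
    simp [add_comm]

/-- Unipotent lower triangular matrices. -/
def lowerHom : Multiplicative ℤ →* Matrix.SpecialLinearGroup (Fin 2) ℤ where
  toFun n := ⟨!![1, 0; n.toAdd, 1], by simp [Matrix.det_fin_two]⟩
  map_one' := by ext i j; fin_cases i <;> fin_cases j <;> simp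
  map_mul' m n := by
    refine Subtype.ext ?_
    change !![1, 0; m.toAdd + n.toAdd, 1] = !![1, 0; m.toAdd, 1] * !![1, 0; n.toAdd, 1]
    simp

lemma coe_upperHom_mul_lowerHom (m n : ℤ) :
    ((upperHom (Multiplicative.ofAdd m) * lowerHom (Multiplicative.ofAdd n) :
      Matrix.SpecialLinearGroup (Fin 2) ℤ) : Matrix (Fin 2) (Fin 2) ℤ) =
      !![1 + m * n, m; n, 1] := by
  rw [Matrix.SpecialLinearGroup.coe_mul]
  change !![1, m; 0, 1] * !![1, 0; n, 1] = _
  simp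

/-- Since `M² = -1`, the powers of `M` run through `±1` and `±M` only. -/
lemma zpow_trace {M : Matrix.SpecialLinearGroup (Fin 2) ℤ} (h2 : M * M = -1)
    (ht : (M : Matrix (Fin 2) (Fin 2) ℤ).trace = 0) (n : ℤ) :
    ((M ^ n : Matrix.SpecialLinearGroup (Fin 2) ℤ) : Matrix (Fin 2) (Fin 2) ℤ).trace = 0 ∨
    ((M ^ n : Matrix.SpecialLinearGroup (Fin 2) ℤ) : Matrix (Fin 2) (Fin 2) ℤ).trace = 2 ∨
    ((M ^ n : Matrix.SpecialLinearGroup (Fin 2) ℤ) : Matrix (Fin 2) (Fin 2) ℤ).trace = -2 := by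
  have hinv : M⁻¹ = -M := by
    rw [inv_eq_iff_mul_eq_one, mul_neg, h2, neg_neg]
  have key : M ^ n = 1 ∨ M ^ n = -1 ∨ M ^ n = M ∨ M ^ n = -M := by
    induction n using Int.induction_on with
    | zero => simp
    | succ n ih =>
      rw [zpow_add_one]
      rcases ih with h | h | h | h <;> simp [h, h2]
    | pred n ih =>
      rw [zpow_sub_one, hinv]
      rcases ih with h | h | h | h <;> simp [h, h2]
  rcases key with h | h | h | h <;> rw [h]
  · right; left; simp
  · right; right; simp
  · left; exact ht
  · left; simp [ht]

/-- A power of `a ^ q * b ^ 2` with `q = ±1` is conjugate to the product of the powers only in the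
obvious cases. -/
lemma abs_le_one_of_conj {q n : ℤ} (hq : q = 1 ∨ q = -1) {g h : F2}
    (H : g * (a ^ q * b ^ (2 : ℤ)) ^ n * g⁻¹ = h * (a ^ (q * n) * b ^ (2 * n)) * h⁻¹) :
    -1 ≤ n ∧ n ≤ 1 := by
  -- The parameters are chosen so that `a ^ q * b ^ 2` has trace 0, hence order 4, whereas `a ^ (q *
  -- n) * b ^ (2 * n)` has trace `2 - 2n²`. Equality of traces then bounds `n`.
  let ρ : F2 →* Matrix.SpecialLinearGroup (Fin 2) ℤ :=
    FreeGroup.lift ![upperHom (Multiplicative.ofAdd 1), lowerHom (Multiplicative.ofAdd (-q))]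
  have ρa : ∀ k : ℤ, ρ (a ^ k) = upperHom (Multiplicative.ofAdd k) := by
    intro k
    rw [map_zpow]
    simp only [ρ, FreeGroup.lift_apply_of, Matrix.cons_val_zero]
    rw [← map_zpow, ← ofAdd_zsmul]; simp
  have ρb : ∀ k : ℤ, ρ (b ^ k) = lowerHom (Multiplicative.ofAdd (-q * k)) := by
    intro k
    rw [map_zpow]
    simp only [ρ, FreeGroup.lift_apply_of, Matrix.cons_val_one, Matrix.cons_val_fin_one]
    rw [← map_zpow, ← ofAdd_zsmul, smul_eq_mul, mul_comm]
  have tr : ∀ u v : F2, ((ρ (u * v * u⁻¹) : Matrix.SpecialLinearGroup (Fin 2) ℤ) :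
      Matrix (Fin 2) (Fin 2) ℤ).trace = (ρ v : Matrix (Fin 2) (Fin 2) ℤ).trace := by
    intro u v
    rw [map_mul, Matrix.SpecialLinearGroup.coe_mul, Matrix.trace_mul_comm,
      ← Matrix.SpecialLinearGroup.coe_mul, ← map_mul]
    congr 3
    group
  have h1 := congrArg (fun w => (ρ w : Matrix (Fin 2) (Fin 2) ℤ).trace) H
  simp only [tr] at h1
  rw [map_zpow] at h1
  have hqq : q * q = 1 := by rcases hq with rfl | rfl <;> rfl
  have h2 : ((ρ (a ^ (q * n) * b ^ (2 * n)) : Matrix.SpecialLinearGroup (Fin 2) ℤ) :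
      Matrix (Fin 2) (Fin 2) ℤ).trace = 2 - 2 * (n * n) := by
    rw [map_mul, ρa, ρb, coe_upperHom_mul_lowerHom, Matrix.trace_fin_two_of]
    linear_combination (-2 * n * n) * hqq
  have h3 := zpow_trace (M := ρ (a ^ q * b ^ (2 : ℤ))) (by
      rw [map_mul, ρa, ρb]
      refine Subtype.ext ?_
      rw [Matrix.SpecialLinearGroup.coe_mul, coe_upperHom_mul_lowerHom,
        Matrix.SpecialLinearGroup.coe_neg, Matrix.SpecialLinearGroup.coe_one]
      rcases hq with rfl | rfl <;> decide)
    (by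
      rw [map_mul, ρa, ρb, coe_upperHom_mul_lowerHom, Matrix.trace_fin_two_of]
      linear_combination (-2) * hqq) n
  rw [h1, h2] at h3
  rcases h3 with h3 | h3 | h3 <;> constructor <;> nlinarith

/-- An automorphism of `F₂` does not map `b` to an element of the shape `b ^ p * a ^ (±3) * b ^ r`
with `p + r = 2`. -/
lemma apply_b_ne {s : MulAut F2} {p q r : ℤ} (hq : q = 3 ∨ q = -3) (hpr : p + r = 2) :
    s b ≠ b ^ p * a ^ q * b ^ r := by
  intro h
  -- In `S₃`, with `a` a 3-cycle and `b` a transposition, the assumed form of `s b` becomes trivial.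
  -- As `s` is surjective, the image of `f` would then be cyclic, but the images of `a` and `b` do
  -- not commute.
  let f : F2 →* Equiv.Perm (Fin 3) :=
    FreeGroup.lift ![finRotate 3, Equiv.swap 0 1]
  have fa : f a = finRotate 3 := by simp [f]
  have fb : f b = Equiv.swap 0 1 := by simp [f]
  have h1 : f (s b) = 1 := by
    have h3 : (finRotate 3) ^ q = 1 := by rcases hq with rfl | rfl <;> decide
    rw [h, map_mul, map_mul, map_zpow, map_zpow, map_zpow, fa, fb, h3, mul_one, ← zpow_add, hpr]
    decide
  have h2 : ∀ w, f (s w) ∈ Subgroup.zpowers (f (s a)) := by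
    intro w
    induction w using FreeGroup.induction_on with
    | C1 => simp
    | of x =>
      fin_cases x
      · exact Subgroup.mem_zpowers _
      · change f (s b) ∈ _
        rw [h1]; exact one_mem _
    | inv_of x hx => simpa using hx
    | mul x y hx hy => simpa using mul_mem hx hy
  have h3 : ∀ w, f w ∈ Subgroup.zpowers (f (s a)) := by
    intro w
    obtain ⟨v, rfl⟩ := s.surjective w
    exact h2 v
  obtain ⟨m, hm⟩ := h3 a
  obtain ⟨n, hn⟩ := h3 b
  have : f a * f b = f b * f a := by
    rw [← hm, ← hn]
    exact (Commute.refl _).zpow_zpow m n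
  rw [fa, fb] at this
  exact absurd this (by decide)

end WordEquations

/-! ### Classification of braid pairs of automorphisms of `F₂` -/

section Classification

variable {s t : MulAut F2}

/-! #### The vertices and edges of `Γ` -/

/-- The vertices of the components `A_r`, indexed by an integer and a sign. -/
def vAz (r ε : ℤ) : WordPair := (a ^ r * b ^ ε * a ^ (-r), a ^ ε)

lemma vAz_natCast_one (n : ℕ) : vAz n 1 = vA n 0 := by simp [vAz, vA]

lemma vAz_natCast_neg_one (n : ℕ) : vAz n (-1) = vA n 1 := by simp [vAz, vA]

lemma vAz_neg_natCast_one (n : ℕ) : vAz (-n) 1 = vA n 2 := by simp [vAz, vA]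

lemma vAz_neg_natCast_neg_one (n : ℕ) : vAz (-n) (-1) = vA n 3 := by simp [vAz, vA]

/-- Signed indices turn the eight kinds of edges of the components `A_r` into a single rule. -/
lemma isEdge_vAz {β k : ℤ} (hβ : β = 1 ∨ β = -1) (hk : k = 1 ∨ k = -1) (r : ℤ) :
    IsEdge (vAz (β * r) β) (vAz r k) := by
  obtain ⟨n, rfl | rfl⟩ := r.eq_nat_or_neg <;> rcases hβ with rfl | rfl <;>
    rcases hk with rfl | rfl <;>
    simp only [one_mul, neg_mul, neg_neg, vAz_natCast_one, vAz_natCast_neg_one,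
      vAz_neg_natCast_one, vAz_neg_natCast_neg_one]
  exacts [.A00 n, .A01 n, .A30 n, .A31 n, .A22 n, .A23 n, .A12 n, .A13 n]

lemma IsEdge.isVertex {v w : WordPair} (h : IsEdge v w) : IsVertex v ∧ IsVertex w := by
  cases h
  case T => exact ⟨.T, .T⟩
  case T' => exact ⟨.T'1, .T'2⟩
  all_goals first
    | exact ⟨.A _ _, .A _ _⟩
    | exact ⟨.B _, .B _⟩
    | exact ⟨.C _, .C _⟩
    | exact ⟨.D _, .D _⟩

lemma IsVertex.snd_eq {v : WordPair} (h : IsVertex v) :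
    v.2 = a ∨ v.2 = a⁻¹ ∨ v.2 = b ∨ v.2 = b⁻¹ ∨ v.2 = b ^ 2 * a ∨ v.2 = b ^ 2 * a⁻¹ ∨
      v.2 = a⁻¹ * b ^ 2 ∨ v.2 = a * b ^ 2 := by
  cases h
  case T => simp
  case T'1 => simp
  case T'2 => simp
  case A r k => fin_cases k <;> simp [vA]
  case B k => fin_cases k <;> simp [vB]
  case C k => fin_cases k <;> simp [vC]
  case D k => fin_cases k <;> simp [vD]

/-- This excludes the swapped vertices of the components `A_r` with `r ≠ 0`. -/
lemma not_isVertex_of_snd {v : WordPair} {p e : ℤ} (he : e ≠ 0) (hp : p ≠ 0)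
    (hv : v.2 = b ^ p * a ^ e * b ^ (-p)) : ¬ IsVertex v := by
  intro h
  have h0 : expSum 0 v.2 = e := by rw [hv]; simp
  have h1 : expSum 1 v.2 = 0 := by rw [hv]; simp
  have key : ∀ K : ℤ, v.2 ≠ a ^ K := by
    intro K hK
    rw [hv] at hK
    exact hp (conj_zpow_inj' (i := -p) (K' := K) (j := 0) he (by simpa using hK))
  rcases h.snd_eq with h | h | h | h | h | h | h | h
  · exact key 1 (by simpa using h)
  · exact key (-1) (by simpa using h)
  all_goals rw [h] at h0 h1; simp at h0 h1

lemma not_isVertex_swapPair_vC (k : Fin 2) : ¬ IsVertex (swapPair (vC k)) := by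
  intro h
  have := h.snd_eq
  fin_cases k <;> simp [swapPair, vC] at this <;> revert this <;> decide

lemma not_isVertex_swapPair_vD (k : Fin 4) : ¬ IsVertex (swapPair (vD k)) := by
  intro h
  have := h.snd_eq
  fin_cases k <;> simp [swapPair, vD] at this <;> revert this <;> decide

/-! #### Structure of the words of a braid pair -/

/-- The exponent vector of a fixed word is fixed by the matrix of `s`; if one coordinate vanishes, a
nonzero off-diagonal entry kills the other. -/
lemma expSum_eq_zero_iff_of_fixed (hβ : expSum 1 (s a) ≠ 0) (hq : expSum 0 (s b) ≠ 0) (w : F2)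
    (hw : s w = w) : expSum 0 w = 0 ↔ expSum 1 w = 0 := by
  obtain ⟨h0, h1⟩ := fixed_core hw
  constructor <;> intro h <;> rw [h] at h0 h1 <;> simp_all

lemma swapLetters_eq_iff {u v : F2} : swapLetters u = v ↔ u = swapLetters v := by
  constructor
  · rintro rfl; simp
  · rintro rfl; simp

/-- The words of the second components of a braid pair. -/
lemma Braid.structure_snd (h : Braid s t) (hk : expSum 1 (t a) ≠ 0) (hγ : expSum 0 (t b) ≠ 0)
    (hq : expSum 0 (s b) ≠ 0) :
    ∃ p r : ℤ, s b = b ^ p * a ^ expSum 0 (s b) * b ^ r ∧ p + r = expSum 1 (s b) ∧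
      ((∃ n m f : ℤ, t b = b ^ n * a ^ f * b ^ m ∧ f = expSum 0 (t b) ∧
        (expSum 1 (s b) = 0 ∨ f = 1 ∨ f = -1) ∧
        t (b ^ n * a ^ (if 0 < f then p else -r)) = b ^ n * a ^ (if 0 < f then p else -r) ∧
        t (a ^ (if 0 < f then r else -p) * b ^ m) = a ^ (if 0 < f then r else -p) * b ^ m) ∨
      (expSum 1 (s b) ≠ 0 ∧ expSum 0 (t b) ≠ 1 ∧ expSum 0 (t b) ≠ -1)) := by
  -- The swapped pair `swapConj t`, `swapConj s` is again a braid pair, and its words at `a` are `t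
  -- b` and `s b` with letters interchanged.
  have hno := expSum_eq_zero_iff_of_fixed (s := swapConj t)
    (by rwa [swapConj_a, expSum_one_swapLetters]) (by rwa [swapConj_b, expSum_zero_swapLetters])
  obtain ⟨p, r, h1, h2, h3⟩ := structure_of_fixed hno (A := swapConj t a) (C := swapConj s a)
    (by rwa [swapConj_a, expSum_one_swapLetters]) (by rwa [swapConj_a, expSum_one_swapLetters])
    h.swap.fixed
  simp only [swapConj_apply, expSum_one_swapLetters, expSum_zero_swapLetters,
    swapLetters_eq_iff, swapLetters_mul, swapLetters_zpow, swapLetters_a, swapLetters_b]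
    at h1 h2 h3
  refine ⟨p, r, h1, h2, ?_⟩
  rcases h3 with ⟨n, m, f, h4, h5, h6, h7, h8⟩ | ⟨h4, h5, h6, -⟩
  · exact Or.inl ⟨n, m, f, h4, h5, h6, h7, h8⟩
  · exact Or.inr ⟨h4, h5, h6⟩

/-- Vanishing diagonal exponent sums make the outer exponents opposite, so both words are conjugates
of powers of `b`, and exclude the exceptional alternative of `structure_of_fixed`. -/
lemma Braid.structure_fst (h : Braid s t) (hβ : expSum 1 (s a) ≠ 0) (hq : expSum 0 (s b) ≠ 0)
    (hk : expSum 1 (t a) ≠ 0) (hα : expSum 0 (s a) = 0) (hl : expSum 0 (t a) = 0) :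
    ∃ c i : ℤ, s a = a ^ c * b ^ expSum 1 (s a) * a ^ (-c) ∧
      t a = a ^ i * b ^ expSum 1 (t a) * a ^ (-i) ∧ s (a ^ c * b ^ i) = a ^ c * b ^ i := by
  obtain ⟨i, j, h1, h2, h3⟩ := structure_of_fixed (expSum_eq_zero_iff_of_fixed hβ hq) hβ hk h.fixed
  rw [hl] at h2 h3
  obtain rfl : j = -i := by omega
  rcases h3 with ⟨c, d, f, h4, h5, -, h7, -⟩ | ⟨h4, -⟩
  · have h8 : c + d = 0 := by
      have := congrArg (expSum 0) h4
      simpa [hα] using this.symm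
    obtain rfl : d = -c := by omega
    refine ⟨c, i, by rw [← h5]; exact h4, h1, ?_⟩
    simpa using h7
  · exact absurd rfl h4

/-! #### The cases of the classification -/

/-- Both local automorphisms induce the same involution of the abelianization, hence are equal. The
common automorphism fixes `x₁` and `x₃` and sends `x₂` into `⟨x₁, x₂⟩ ∩ ⟨x₂, x₃⟩ = ⟨x₂⟩`. -/
lemma Braid.eq_of_diagonal (h : Braid s t) (h1 : expSum 1 (s a) = 0) (h2 : expSum 0 (s b) = 0)
    (h3 : expSum 1 (t a) = 0) (h4 : expSum 0 (t b) = 0) (h5 : expSum 0 (s a) = 1)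
    (h6 : expSum 1 (t b) = 1) (h7 : expSum 0 (t a) = expSum 1 (s b))
    (h8 : expSum 1 (s b) = 1 ∨ expSum 1 (s b) = -1) :
    s a = a ∧ s b = b ^ expSum 1 (s b) ∧ t a = a ^ expSum 1 (s b) ∧ t b = b := by
  have hM : expMatrix (coreAut (0 : Fin 2) s).toMonoidHom =
      expMatrix (coreAut (1 : Fin 2) t).toMonoidHom := by
    rw [expMatrix_coreAut_zero, expMatrix_coreAut_one, h1, h2, h3, h4, h5, h6, h7]
  have hM2 : expMatrix ((coreAut (1 : Fin 2) t).toMonoidHom.comp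
      (coreAut (1 : Fin 2) t).toMonoidHom) = 1 := by
    rw [expMatrix_comp, expMatrix_coreAut_one, h3, h4, h6, h7]
    rcases h8 with h8 | h8 <;> rw [h8] <;> decide
  have hXY : (coreAut (0 : Fin 2) s).toMonoidHom = (coreAut (1 : Fin 2) t).toMonoidHom := by
    refine eq_of_braid_of_expSum (fun w => DFunLike.congr_fun h w)
      (fun k l => congrFun (congrFun hM l) k) fun k l => ?_
    have := congrFun (congrFun hM2 l) k
    simp only [expMatrix, Matrix.of_apply, Matrix.one_apply] at this
    rw [expSum_of]
    simpa using this
  have happ : ∀ w, coreAut (0 : Fin 2) s w = coreAut (1 : Fin 2) t w :=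
    fun w => DFunLike.congr_fun hXY w
  have hsa : s a = a := by
    refine incl_injective (0 : Fin 2) ?_
    rw [← coreAut_incl, incl_a, happ]
    exact coreAut_of_ne t (by decide) (by decide)
  have htb : t b = b := by
    refine incl_injective (1 : Fin 2) ?_
    rw [← coreAut_incl, incl_b, ← happ]
    exact coreAut_of_ne s (by decide) (by decide)
  have hmid : incl (0 : Fin 2) (s b) = incl 1 (t a) := by
    rw [← coreAut_incl, ← coreAut_incl, happ]; rfl
  have hmem : incl (0 : Fin 2) (s b) ∈ lettersIn {(1 : Fin 3)} := by
    have m1 : incl (0 : Fin 2) (s b) ∈ lettersIn (Set.range ![(0 : Fin 3), 1]) :=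
      map_mem_lettersIn (f := ![(0 : Fin 3), 1]) (by decide) (s b)
    have m2 := incl_one_mem (t a)
    rw [← hmid] at m2
    intro p hp
    obtain ⟨k, hk⟩ := m1 p hp
    have := m2 p hp
    rw [← hk] at this ⊢
    fin_cases k
    · exact absurd rfl this
    · rfl
  obtain ⟨k, hk⟩ := eq_zpow_of_mem_lettersIn hmem
  have hsb : s b = b ^ k := by
    refine incl_injective (0 : Fin 2) ?_
    rw [hk, map_zpow, incl_b]; rfl
  have hta : t a = a ^ k := by
    refine incl_injective (1 : Fin 2) ?_
    rw [← hmid, hk, map_zpow, incl_a]; rfl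
  have hkm : expSum 1 (s b) = k := by rw [hsb]; simp
  exact ⟨hsa, by rw [hkm, hsb], by rw [hkm, hta], htb⟩

lemma isEdge_of_diagonal {m : ℤ} (hm : m = 1 ∨ m = -1) : IsEdge (a, b ^ m) (a ^ m, b) := by
  rcases hm with rfl | rfl
  · simpa using IsEdge.T
  · simpa using IsEdge.T'

lemma isEdge_B {β k : ℤ} (hβ : β = 1 ∨ β = -1) (hk : k = 1 ∨ k = -1) :
    IsEdge (b ^ β, a ^ (-β)) (b ^ k, a ^ (-k)) := by
  have h1 : ((b ^ (1 : ℤ), a ^ (-1 : ℤ)) : WordPair) = vB 1 := by simp [vB]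
  have h2 : ((b ^ (-1 : ℤ), a ^ (-(-1) : ℤ)) : WordPair) = vB 0 := by simp [vB]
  rcases hβ with rfl | rfl <;> rcases hk with rfl | rfl <;> simp only [h1, h2] <;> exact .B _ _

lemma Int.isUnit_factors {x y e : ℤ} (he : e = 1 ∨ e = -1) (h : x * y = e) :
    (x = 1 ∨ x = -1) ∧ y = e * x := by
  have hx : IsUnit x := isUnit_of_mul_isUnit_left (y := y) (by
    rw [h, Int.isUnit_iff]; exact he)
  rcases Int.isUnit_iff.1 hx with rfl | rfl <;> constructor <;> omega

/-- The edges between the components `A_r` and `B` of `Γ`. -/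
lemma Braid.classify_AB (h : Braid s t) (hl : expSum 0 (t a) = 0) (hm : expSum 1 (s b) = 0)
    (hα : expSum 0 (s a) = 0) (hδ : expSum 1 (t b) = 0)
    (he : expSum 1 (s a) * expSum 0 (s b) = expSum 1 (t a) * expSum 0 (t b))
    (he' : expSum 1 (s a) * expSum 0 (s b) = 1 ∨ expSum 1 (s a) * expSum 0 (s b) = -1) :
    IsEdge (s a, s b) (t a, t b) ∨
      (IsEdge (swapPair (t a, t b)) (swapPair (s a, s b)) ∧
        ¬ IsVertex (s a, s b) ∧ ¬ IsVertex (t a, t b)) := by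
  obtain ⟨hβ, hq⟩ := Int.isUnit_factors he' rfl
  rw [he] at he'
  obtain ⟨hk, hγ⟩ := Int.isUnit_factors he' rfl
  have hβ0 : expSum 1 (s a) ≠ 0 := by omega
  have hk0 : expSum 1 (t a) ≠ 0 := by omega
  have hq0 : expSum 0 (s b) ≠ 0 := by
    rintro h0; rw [h0, mul_zero] at he; omega
  have hγ0 : expSum 0 (t b) ≠ 0 := by
    rintro h0; rw [h0, mul_zero] at he'; omega
  obtain ⟨c, i, hsa, hta, hfix⟩ := h.structure_fst hβ0 hq0 hk0 hα hl
  obtain ⟨p, r, hsb, hpr, h3⟩ := h.structure_snd hk0 hγ0 hq0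
  rw [hm] at hpr h3
  obtain rfl : r = -p := by omega
  rcases h3 with ⟨n, m, f, htb, hf, -, hfix', -⟩ | ⟨h3, -⟩
  swap
  · exact absurd rfl h3
  obtain rfl : m = -n := by
    have := congrArg (expSum 1) htb
    rw [hδ] at this
    simp at this; omega
  rw [hf] at htb
  simp only [neg_neg, ite_self] at hfix'
  clear hf f
  generalize expSum 1 (s a) = β at *
  generalize expSum 0 (s b) = q at *
  generalize expSum 1 (t a) = k at *
  generalize expSum 0 (t b) = γ at *
  have hfs : a ^ c * b ^ (β * c) * a ^ (-c) * (b ^ p * a ^ (q * i) * b ^ (-p)) =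
      a ^ c * b ^ i := by
    rw [map_mul, map_zpow, map_zpow, hsa, hsb] at hfix
    rw [← hfix, zpow_neg, zpow_neg, conj_zpow, conj_zpow, zpow_mul, zpow_mul]
  have hft : b ^ n * a ^ (γ * n) * b ^ (-n) * (a ^ i * b ^ (k * p) * a ^ (-i)) =
      b ^ n * a ^ p := by
    rw [map_mul, map_zpow, map_zpow, hta, htb] at hfix'
    rw [← hfix', zpow_neg, zpow_neg, conj_zpow, conj_zpow, zpow_mul, zpow_mul]
  have e1 : q * i = c := by simpa using congrArg (expSum 0) hfs
  have e2 : β * c = i := by simpa using congrArg (expSum 1) hfs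
  have e3 : γ * n = p := by simpa using congrArg (expSum 0) hft
  have e4 : k * p = n := by simpa using congrArg (expSum 1) hft
  -- After `e1` and `e2`, equation `hfs` says that `a ^ c` and `b ^ p` commute. The case `p = 0`
  -- gives edges of `Γ`; `p ≠ 0` gives swapped edges of the components `A_r`.
  have e5 : c = 0 ∨ p = 0 := by
    refine eq_zero_of_conj ?_
    rw [e1, e2] at hfs
    have : a ^ (-c) * b ^ p * a ^ c = b ^ (-i) * a ^ (-c) * (a ^ c * b ^ i * a ^ (-c) *
      (b ^ p * a ^ c * b ^ (-p))) * b ^ p := by group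
    rw [this, hfs]; group
  rw [hsa, hsb, hta, htb]
  by_cases hp : p = 0
  · obtain rfl : n = 0 := by rw [← e4, hp, mul_zero]
    subst hp
    simp only [zpow_zero, neg_zero, one_mul, mul_one]
    left
    -- The value 1 leads to the components `A_r` with `r` free; the value `-1` forces `i = -i`,
    -- hence `c = i = 0`, and leads to `B`.
    by_cases hβq : β * q = 1
    · rw [hβq] at he hq
      rw [← he, one_mul] at hγ
      rw [hq, hγ, one_mul]
      have : c = β * i := by rw [← e1, hq, one_mul]
      rw [this]
      exact isEdge_vAz hβ hk i
    · have hβq' : β * q = -1 := by rcases he ▸ he' with h | h <;> [exact absurd h hβq; exact h]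
      have hc : c = 0 := by
        have : β * q * i = i := by rw [mul_assoc, e1, e2]
        rw [hβq'] at this
        have : i = 0 := by omega
        rw [← e1, this, mul_zero]
      have hi : i = 0 := by rw [← e2, hc, mul_zero]
      rw [hβq'] at hq
      rw [← he, hβq'] at hγ
      rw [hc, hi, hq, hγ]
      simpa using isEdge_B hβ hk
  · obtain rfl : c = 0 := by tauto
    obtain rfl : i = 0 := by rw [← e2, mul_zero]
    simp only [zpow_zero, neg_zero, one_mul, mul_one]
    have hkγ : k * γ = 1 := by
      have h1 : k * γ * n = n := by rw [mul_assoc, e3, e4]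
      rcases he' with h2 | h2
      · exact h2
      · rw [h2] at h1
        have : n = 0 := by omega
        rw [this, mul_zero] at e3
        exact absurd e3.symm hp
    rw [he, hkγ, one_mul] at hq
    rw [hkγ, one_mul] at hγ
    subst hq hγ
    right
    refine ⟨?_, not_isVertex_of_snd (p := p) hq0 hp rfl, not_isVertex_of_snd (p := n) hγ0 ?_ rfl⟩
    · rw [← e4]
      simpa [swapPair, vAz] using isEdge_vAz hk hβ p
    · rintro rfl
      exact hp (by rw [← e3, mul_zero])

lemma isEdge_C {β k : ℤ} (hβ : β = 1 ∨ β = -1) (hk : k = 1 ∨ k = -1) :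
    ∃ x y, swapPair (b ^ k, b * a ^ (-k) * b) = vC x ∧
      swapPair (b ^ β, b * a ^ (-β) * b) = vC y := by
  have h1 : swapPair (b ^ (1 : ℤ), b * a ^ (-1 : ℤ) * b) = vC 0 := by simp [vC, swapPair]
  have h2 : swapPair (b ^ (-1 : ℤ), b * a ^ (-(-1) : ℤ) * b) = vC 1 := by simp [vC, swapPair]
  rcases hβ with rfl | rfl <;> rcases hk with rfl | rfl <;> simp only [h1, h2] <;>
    exact ⟨_, _, rfl, rfl⟩

/-- The edges between the components `C` (swapped) and `D` of `Γ`. -/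
lemma Braid.classify_CD (h : Braid s t) (hl : expSum 0 (t a) = 0) (hm : expSum 1 (s b) = 2)
    (hα : expSum 0 (s a) = 0) (hδ : expSum 1 (t b) = 2)
    (he : expSum 1 (s a) * expSum 0 (s b) = -1) (he' : expSum 1 (t a) * expSum 0 (t b) = -1) :
    (∃ x y, swapPair (t a, t b) = vC x ∧ swapPair (s a, s b) = vC y) ∨
      ∃ x y, (s a, s b) = vD x ∧ (t a, t b) = vD y ∧ IsEdge (vD x) (vD y) := by
  obtain ⟨hβ, hq⟩ := Int.isUnit_factors (Or.inr rfl) he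
  obtain ⟨hk, hγ⟩ := Int.isUnit_factors (Or.inr rfl) he'
  rw [neg_one_mul] at hq hγ
  obtain ⟨c, i, hsa, hta, hfix⟩ := h.structure_fst (by omega) (by omega) (by omega) hα hl
  obtain ⟨p, r, hsb, hpr, h3⟩ := h.structure_snd (by omega) (by omega) (by omega)
  rw [hm] at hpr h3
  rcases h3 with ⟨n, m, f, htb, hf, -, hfix', hfix''⟩ | ⟨-, h3⟩
  swap
  · omega
  have hnm : n + m = 2 := by
    have := congrArg (expSum 1) htb
    rw [hδ] at this
    simpa using this.symm
  clear hl hm hα hδ he he'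
  obtain rfl : r = 2 - p := by omega
  obtain rfl : m = 2 - n := by omega
  rw [← hf] at hγ
  rw [hq] at hsb
  clear hf hq
  generalize expSum 1 (s a) = β at *
  generalize expSum 1 (t a) = k at *
  subst hγ
  have hpow : ∀ e x y : ℤ, (b ^ x * a ^ e * b ^ (2 - x)) ^ y =
      b ^ x * (a ^ e * b ^ (2 : ℤ)) ^ y * (b ^ x)⁻¹ := by
    intro e x y
    rw [← conj_zpow]; congr 1; group
  have hfs : a ^ c * b ^ (β * c) * a ^ (-c) *
      (b ^ p * (a ^ (-β) * b ^ (2 : ℤ)) ^ i * (b ^ p)⁻¹) = a ^ c * b ^ i := by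
    rw [map_mul, map_zpow, map_zpow, hsa, hsb, hpow] at hfix
    rw [← hfix, zpow_neg, conj_zpow, zpow_mul]
  have e1 : -β * i = c := by simpa [mul_comm] using congrArg (expSum 0) hfs
  have e2 : β * c = -i := by
    rw [← e1]; rcases hβ with rfl | rfl <;> ring
  -- The fixed word becomes a conjugacy between a power of a product and the product of the powers,
  -- which the trace argument allows only for `|i| ≤ 1`.
  have hs1 : b ^ p * (a ^ (-β) * b ^ (2 : ℤ)) ^ i * (b ^ p)⁻¹ =
      1 * (a ^ (-β * i) * b ^ (2 * i)) * 1⁻¹ := by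
    rw [e2] at hfs
    rw [e1]
    have : b ^ p * (a ^ (-β) * b ^ (2 : ℤ)) ^ i * (b ^ p)⁻¹ = (a ^ c * b ^ (-i) * a ^ (-c))⁻¹ *
      (a ^ c * b ^ (-i) * a ^ (-c) * (b ^ p * (a ^ (-β) * b ^ (2 : ℤ)) ^ i * (b ^ p)⁻¹)) := by
      group
    rw [this, hfs]; group
  have hi := abs_le_one_of_conj (q := -β) (by omega) hs1
  have e3 : (if 0 < -k then p else -(2 - p)) = -k * n := by
    rw [map_mul, map_zpow, map_zpow, hta, htb] at hfix'
    have := congrArg (expSum 0) hfix'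
    simp at this
    rcases hk with rfl | rfl <;> simp at this ⊢ <;> omega
  have e4 : (if 0 < -k then 2 - p else -p) = -k * (2 - n) := by
    rcases hk with rfl | rfl <;> norm_num at e3 ⊢ <;> omega
  rw [e3] at hfix'
  rw [e4] at hfix''
  -- The value `i = 0` leads to the swapped component `C`; `i = 1` forces `p = 0` and `i = -1`
  -- forces `p = 2`, which give the edges of `D`.
  obtain rfl | rfl | rfl : i = 0 ∨ i = 1 ∨ i = -1 := by omega
  · left
    obtain rfl : c = 0 := by omega
    simp only [zpow_zero, neg_zero, one_mul, mul_one] at hta hsa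
    have hkk : k * k = 1 := by rcases hk with rfl | rfl <;> rfl
    -- The two blocks fixed by `t` bound `n` and `2 - n` by 1 in absolute value, so `n = 1`.
    have hn : -1 ≤ n ∧ n ≤ 1 := by
      refine abs_le_one_of_conj (q := -k) (g := b ^ n) (h := b ^ n) (by omega) ?_
      rw [map_mul, map_zpow, map_zpow, hta, htb, hpow, ← zpow_mul,
        show k * (-k * n) = -n by linear_combination (-n) * hkk] at hfix'
      rw [← eq_mul_inv_iff_mul_eq] at hfix'
      rw [hfix']; group
    have hn' : -1 ≤ 2 - n ∧ 2 - n ≤ 1 := by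
      refine abs_le_one_of_conj (q := -k) (g := b ^ (n - (2 - n))) (h := 1) (by omega) ?_
      rw [map_mul, map_zpow, map_zpow, hta, htb, hpow, ← zpow_mul,
        show k * (-k * (2 - n)) = -(2 - n) by linear_combination (-(2 - n)) * hkk] at hfix''
      have : b ^ (n - (2 - n)) * (a ^ (-k) * b ^ (2 : ℤ)) ^ (2 - n) * (b ^ (n - (2 - n)))⁻¹ =
        b ^ (-(2 - n)) * (b ^ n * (a ^ (-k) * b ^ (2 : ℤ)) ^ (2 - n) * (b ^ n)⁻¹) *
          b ^ (2 - n) := by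
        generalize (a ^ (-k) * b ^ (2 : ℤ)) ^ (2 - n) = X
        group
      rw [this, hfix'']; group
    obtain rfl : n = 1 := by omega
    obtain rfl : p = 1 := by rcases hk with rfl | rfl <;> simp at e3 <;> omega
    rw [hsa, hsb, hta, htb]
    simpa using isEdge_C hβ hk
  · right
    obtain rfl : p = 0 := by
      refine conj_zpow_inj' (K := -β) (i := 2 - p) (j := 2) (K' := -β) (by omega) ?_
      have : b ^ p * a ^ (-β) * b ^ (2 - p) =
        b ^ p * (a ^ (-β) * b ^ (2 : ℤ)) ^ (1 : ℤ) * (b ^ p)⁻¹ := by group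
      rw [this, hs1]; group
    rw [hsa, hsb, hta, htb, ← e1]
    rcases hβ with rfl | rfl <;> rcases hk with rfl | rfl <;>
      (simp at e3; obtain rfl := e3)
    · refine ⟨2, 1, ?_, ?_, .D21⟩ <;> simp [vD]
    · refine ⟨2, 3, ?_, ?_, .D23⟩ <;> simp [vD]
    · refine ⟨3, 1, ?_, ?_, .D31⟩ <;> simp [vD]
    · refine ⟨3, 3, ?_, ?_, .D33⟩ <;> simp [vD]
  · right
    have hp2 : p - 2 = 0 := by
      refine conj_zpow_inj' (K := β) (i := -p) (j := -2) (K' := β) (by omega) ?_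
      have : b ^ (p - 2) * a ^ β * b ^ (-p) =
        b ^ p * (a ^ (-β) * b ^ (2 : ℤ)) ^ (-1 : ℤ) * (b ^ p)⁻¹ := by group
      rw [this, hs1]; group
    obtain rfl : p = 2 := by omega
    rw [hsa, hsb, hta, htb, ← e1]
    rcases hβ with rfl | rfl <;> rcases hk with rfl | rfl <;>
      (simp at e3; obtain rfl := e3)
    · refine ⟨1, 2, ?_, ?_, .D12⟩ <;> simp [vD]
    · refine ⟨1, 0, ?_, ?_, .D10⟩ <;> simp [vD]
    · refine ⟨0, 2, ?_, ?_, .D02⟩ <;> simp [vD]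
    · refine ⟨0, 0, ?_, ?_, .D00⟩ <;> simp [vD]

/-- If `s a` has three syllables, its `b`-exponent sum is `±1`, so that of `a` in `s b` is `±3`,
which the quotient `S₃` excludes. Otherwise the former is `±3`, while a fixed word with `b`-exponent
sum `±2` would make it divide 2. -/
lemma Braid.expSum_ne (h : Braid s t) (hl : expSum 0 (t a) = 2) (hm : expSum 1 (s b) = 2)
    (he : expSum 1 (s a) * expSum 0 (s b) = -3)
    (he' : expSum 1 (t a) * expSum 0 (t b) = -3) : False := by
  have hβ0 : expSum 1 (s a) ≠ 0 := by rintro h0; simp [h0] at he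
  have hq0 : expSum 0 (s b) ≠ 0 := by rintro h0; simp [h0] at he
  have hk0 : expSum 1 (t a) ≠ 0 := by rintro h0; simp [h0] at he'
  have hγ0 : expSum 0 (t b) ≠ 0 := by rintro h0; simp [h0] at he'
  obtain ⟨i, j, -, -, h3⟩ :=
    structure_of_fixed (expSum_eq_zero_iff_of_fixed hβ0 hq0) hβ0 hk0 h.fixed
  rw [hl] at h3
  rcases h3 with ⟨c, d, f, -, hf, h5, -⟩ | ⟨-, h5, h6, w, hw, -, hw2⟩
  · obtain ⟨p, r, hsb, hpr, -⟩ := h.structure_snd hk0 hγ0 hq0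
    refine apply_b_ne (p := p) (r := r) (q := expSum 0 (s b)) ?_ (by omega) hsb
    rw [hf] at h5
    rcases h5 with h5 | h5 | h5
    · omega
    · rw [h5] at he; omega
    · rw [h5] at he; omega
  · obtain ⟨-, h8⟩ := fixed_core hw
    rw [hm] at h8
    have hβ : expSum 1 (s a) ∣ 3 := ⟨-expSum 0 (s b), by linarith⟩
    have : expSum 1 (s a) ≤ 3 := Int.le_of_dvd (by norm_num) hβ
    have : -3 ≤ expSum 1 (s a) := by
      have := Int.le_of_dvd (by norm_num) ((neg_dvd).2 hβ); omega
    generalize expSum 1 (s a) = β at *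
    interval_cases β <;> omega

/-- The words of a braid pair form an edge of `Γ`, or an edge of the image of `Γ` under the swap
symmetry, in which case they are not vertices of `Γ`. -/
theorem Braid.classify (h : Braid s t) :
    IsEdge (s a, s b) (t a, t b) ∨
      (IsEdge (swapPair (t a, t b)) (swapPair (s a, s b)) ∧
        ¬ IsVertex (s a, s b) ∧ ¬ IsVertex (t a, t b)) := by
  rcases h.expSum_cases with ⟨h1, h2, h3, h4, h5, h6, h7, h8⟩ | ⟨h1, h2, h3, h4, h5, h6⟩ |
    ⟨h1, h2, h3, h4, h5, h6⟩ | ⟨h1, h2, h3, h4, h5, h6⟩ | ⟨h1, h2, -, -, h5, h6⟩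
  · left
    obtain ⟨e1, e2, e3, e4⟩ := h.eq_of_diagonal h1 h2 h3 h4 h5 h6 h7 h8
    rw [e1, e2, e3, e4]
    exact isEdge_of_diagonal h8
  · exact h.classify_AB h1 h2 h3 h4 h5 h6
  · rcases h.classify_CD h1 h2 h3 h4 h5 h6 with ⟨x, y, hx, hy⟩ | ⟨x, y, hx, hy, hxy⟩
    · right
      refine ⟨by rw [hx, hy]; exact .C x y, ?_, ?_⟩
      · rw [← swapPair_swapPair (s a, s b), hy]; exact not_isVertex_swapPair_vC y
      · rw [← swapPair_swapPair (t a, t b), hx]; exact not_isVertex_swapPair_vC x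
    · left; rw [hx, hy]; exact hxy
  -- The values `(2, 0)` of these two exponent sums are the swap image of `(0, 2)`, so `C` now
  -- appears unswapped and `D` swapped.
  · have hs : ((swapConj s) a, (swapConj s) b) = swapPair (s a, s b) := by
      rw [swapConj_a, swapConj_b]; rfl
    have ht : ((swapConj t) a, (swapConj t) b) = swapPair (t a, t b) := by
      rw [swapConj_a, swapConj_b]; rfl
    have key := h.swap.classify_CD
      (by rw [swapConj_a, expSum_zero_swapLetters]; exact h2)
      (by rw [swapConj_b, expSum_one_swapLetters]; exact h1)
      (by rw [swapConj_a, expSum_zero_swapLetters]; exact h4)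
      (by rw [swapConj_b, expSum_one_swapLetters]; exact h3)
      (by rw [swapConj_a, swapConj_b, expSum_zero_swapLetters, expSum_one_swapLetters, mul_comm]
          exact h6)
      (by rw [swapConj_a, swapConj_b, expSum_zero_swapLetters, expSum_one_swapLetters, mul_comm]
          exact h5)
    rw [hs, ht, swapPair_swapPair, swapPair_swapPair] at key
    rcases key with ⟨x, y, hx, hy⟩ | ⟨x, y, hx, hy, hxy⟩
    · left; rw [hx, hy]; exact .C x y
    · right
      refine ⟨by rw [hx, hy]; exact hxy, ?_, ?_⟩
      · rw [← swapPair_swapPair (s a, s b), hy]; exact not_isVertex_swapPair_vD y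
      · rw [← swapPair_swapPair (t a, t b), hx]; exact not_isVertex_swapPair_vD x
  · exact (h.expSum_ne h1 h2 h5 h6).elim

end Classification

/-! ### The edges of `Γ` define representations -/

section Realization

/-- The endomorphism of `F₂` given by a pair of words. -/
def wordHom (v : WordPair) : F2 →* F2 := FreeGroup.lift ![v.1, v.2]

@[simp] lemma wordHom_a (v : WordPair) : wordHom v a = v.1 := by simp [wordHom]

@[simp] lemma wordHom_b (v : WordPair) : wordHom v b = v.2 := by simp [wordHom]

/-- The pairs of words `v` and `v'` are those of two mutually inverse automorphisms. -/
def InversePair (v v' : WordPair) : Prop :=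
  ∃ s : MulAut F2, (s a, s b) = v ∧ (s⁻¹ a, s⁻¹ b) = v'

lemma inversePair_of_wordHom {v v' : WordPair} (h1 : wordHom v' v.1 = a) (h2 : wordHom v' v.2 = b)
    (h3 : wordHom v v'.1 = a) (h4 : wordHom v v'.2 = b) : InversePair v v' := by
  refine ⟨MonoidHom.toMulEquiv (wordHom v) (wordHom v') (hom_F2_ext ?_ ?_) (hom_F2_ext ?_ ?_),
    ?_, ?_⟩
  · simpa using h1
  · simpa using h2
  · simpa using h3
  · simpa using h4
  · exact Prod.ext (wordHom_a v) (wordHom_b v)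
  · exact Prod.ext (wordHom_a v') (wordHom_b v')

/-- The endomorphism of `F₃` given by a pair of words in the first two generators. -/
def leftHom (v : WordPair) : FreeGroup (Fin 3) →* FreeGroup (Fin 3) :=
  FreeGroup.lift ![incl (0 : Fin 2) v.1, incl (0 : Fin 2) v.2, FreeGroup.of 2]

/-- The endomorphism of `F₃` given by a pair of words in the last two generators. -/
def rightHom (v : WordPair) : FreeGroup (Fin 3) →* FreeGroup (Fin 3) :=
  FreeGroup.lift ![FreeGroup.of 0, incl (1 : Fin 2) v.1, incl (1 : Fin 2) v.2]

lemma leftHom_zero (v : WordPair) : leftHom v (FreeGroup.of 0) = incl 0 v.1 := by simp [leftHom]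

lemma leftHom_one (v : WordPair) : leftHom v (FreeGroup.of 1) = incl 0 v.2 := by simp [leftHom]

lemma rightHom_one (v : WordPair) : rightHom v (FreeGroup.of 1) = incl 1 v.1 := by
  simp [rightHom]

lemma rightHom_two (v : WordPair) : rightHom v (FreeGroup.of 2) = incl 1 v.2 := by
  simp [rightHom]

/-- It suffices to compare both sides on the three generators, where explicit homomorphisms reduce
the relation to a computation with words. -/
lemma wordBraid_of_hom {v v' w w' : WordPair} (hv : InversePair v v') (hw : InversePair w w')
    (h : ∀ j : Fin 3, leftHom v (rightHom w (leftHom v (FreeGroup.of j))) =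
      rightHom w (leftHom v (rightHom w (FreeGroup.of j)))) : WordBraid v w := by
  obtain ⟨s, rfl, -⟩ := hv
  obtain ⟨t, rfl, -⟩ := hw
  refine ⟨s, t, rfl, rfl, ?_⟩
  have hs : ∀ x, leftHom (s a, s b) x = coreAut (0 : Fin 2) s x := by
    have : leftHom (s a, s b) = (coreAut (0 : Fin 2) s).toMonoidHom := by
      ext j
      fin_cases j
      · exact (leftHom_zero _).trans (coreAut_castSucc (0 : Fin 2) s).symm
      · exact (leftHom_one _).trans (coreAut_succ (0 : Fin 2) s).symm
      · exact (coreAut_of_ne (i := (0 : Fin 2)) s (j := 2) (by decide) (by decide)).symm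
    exact DFunLike.congr_fun this
  have ht : ∀ x, rightHom (t a, t b) x = coreAut (1 : Fin 2) t x := by
    have : rightHom (t a, t b) = (coreAut (1 : Fin 2) t).toMonoidHom := by
      ext j
      fin_cases j
      · exact (coreAut_of_ne (i := (1 : Fin 2)) t (j := 0) (by decide) (by decide)).symm
      · exact (rightHom_one _).trans (coreAut_castSucc (1 : Fin 2) t).symm
      · exact (rightHom_two _).trans (coreAut_succ (1 : Fin 2) t).symm
    exact DFunLike.congr_fun this
  simp only [hs, ht] at h
  have : (coreAut (0 : Fin 2) s * coreAut 1 t * coreAut 0 s).toMonoidHom =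
      (coreAut (1 : Fin 2) t * coreAut 0 s * coreAut 1 t).toMonoidHom := by
    ext j; exact h j
  exact MulEquiv.toMonoidHom_injective this

/-- The inverse of a vertex of `A_r` is a swapped vertex of `A_r`; this makes inverse followed by
swap act on these components. -/
lemma inversePair_vAz {ε : ℤ} (hε : ε = 1 ∨ ε = -1) (r : ℤ) :
    InversePair (vAz r ε) (swapPair (vAz (-(ε * r)) ε)) := by
  rcases hε with rfl | rfl <;> apply inversePair_of_wordHom <;>
    simp [vAz, swapPair, mul_assoc]

lemma wordBraid_vAz {β k : ℤ} (hβ : β = 1 ∨ β = -1) (hk : k = 1 ∨ k = -1) (r : ℤ) :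
    WordBraid (vAz (β * r) β) (vAz r k) := by
  refine wordBraid_of_hom (inversePair_vAz hβ _) (inversePair_vAz hk _) fun j => ?_
  -- Expanding powers of conjugates leaves only free cancellation, uniformly in `r`.
  have hc : ∀ x y : FreeGroup (Fin 3), (x⁻¹ * y * x) ^ r = x⁻¹ * y ^ r * x := by
    intro x y
    simpa using conj_zpow (a := x⁻¹) (b := y) (i := r)
  rcases hβ with rfl | rfl <;> rcases hk with rfl | rfl <;> fin_cases j <;>
    simp [leftHom, rightHom, vAz, incl_a, incl_b]
  all_goals try simp only [hc, inv_zpow, mul_inv_rev, inv_inv]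
  all_goals simp only [mul_assoc, mul_inv_cancel_left]

lemma inversePair_vB : InversePair (vB 0) (vB 1) ∧ InversePair (vB 1) (vB 0) := by
  constructor <;> apply inversePair_of_wordHom <;> decide

lemma inversePair_vC (k : Fin 2) : InversePair (vC k) (swapPair (vC k)) := by
  revert k
  simp only [Fin.forall_fin_two]
  constructor <;> apply inversePair_of_wordHom <;> decide

lemma inversePair_vD (k : Fin 4) : ∃ v, InversePair (vD k) v := by
  fin_cases k
  · exact ⟨(b * a ^ 2, b * a⁻¹ * b⁻¹), by apply inversePair_of_wordHom <;> decide⟩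
  · exact ⟨(a ^ 2 * b⁻¹, b * a * b⁻¹), by apply inversePair_of_wordHom <;> decide⟩
  · exact ⟨(b⁻¹ * a ^ 2, b⁻¹ * a * b), by apply inversePair_of_wordHom <;> decide⟩
  · exact ⟨(a ^ 2 * b, b⁻¹ * a⁻¹ * b), by apply inversePair_of_wordHom <;> decide⟩

lemma inversePair_T (m : Fin 3) : InversePair (![(a, b), (a, b⁻¹), (a⁻¹, b)] m)
    (![(a, b), (a, b⁻¹), (a⁻¹, b)] m) := by
  fin_cases m <;> apply inversePair_of_wordHom <;> decide

/-- The components `A_r` are instances of the signed family at `r` or `-r`; the finitely many other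
edges are checked on generators. -/
theorem IsEdge.wordBraid {v w : WordPair} (h : IsEdge v w) : WordBraid v w := by
  cases h
  case T => exact wordBraid_of_hom (inversePair_T 0) (inversePair_T 0) (by decide)
  case T' => exact wordBraid_of_hom (inversePair_T 1) (inversePair_T 2) (by decide)
  case A00 r =>
    rw [← vAz_natCast_one]; simpa using wordBraid_vAz (.inl rfl) (.inl rfl) r
  case A01 r =>
    rw [← vAz_natCast_one, ← vAz_natCast_neg_one]
    simpa using wordBraid_vAz (.inl rfl) (.inr rfl) r
  case A12 r =>
    rw [← vAz_neg_natCast_one, ← vAz_natCast_neg_one]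
    simpa using wordBraid_vAz (.inr rfl) (.inl rfl) (-r)
  case A13 r =>
    rw [← vAz_neg_natCast_neg_one, ← vAz_natCast_neg_one]
    simpa using wordBraid_vAz (.inr rfl) (.inr rfl) (-r)
  case A22 r =>
    rw [← vAz_neg_natCast_one]; simpa using wordBraid_vAz (.inl rfl) (.inl rfl) (-r)
  case A23 r =>
    rw [← vAz_neg_natCast_one, ← vAz_neg_natCast_neg_one]
    simpa using wordBraid_vAz (.inl rfl) (.inr rfl) (-r)
  case A30 r =>
    rw [← vAz_natCast_one, ← vAz_neg_natCast_neg_one]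
    simpa using wordBraid_vAz (.inr rfl) (.inl rfl) r
  case A31 r =>
    rw [← vAz_natCast_neg_one, ← vAz_neg_natCast_neg_one]
    simpa using wordBraid_vAz (.inr rfl) (.inr rfl) r
  case B k l =>
    have hB : ∀ k, ∃ v, InversePair (vB k) v := by
      simp only [Fin.forall_fin_two]
      exact ⟨⟨_, inversePair_vB.1⟩, ⟨_, inversePair_vB.2⟩⟩
    obtain ⟨_, hk⟩ := hB k
    obtain ⟨_, hl⟩ := hB l
    exact wordBraid_of_hom hk hl (by clear hk hl; revert k l; decide)
  case C k l =>
    exact wordBraid_of_hom (inversePair_vC k) (inversePair_vC l) (by revert k l; decide)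
  all_goals
    exact wordBraid_of_hom (inversePair_vD _).choose_spec (inversePair_vD _).choose_spec
      (by decide)

end Realization

/-! ### Natural symmetries -/

section NaturalSymmetries

variable {m : ℕ}

/-- The backward symmetry on a single pair of words. -/
def backPair (v : WordPair) : WordPair := (readBackward v.1, readBackward v.2)

lemma backPair_backPair (v : WordPair) : backPair (backPair v) = v := by
  simp [backPair, readBackward_eq]

lemma Defines.inverse {τ : Fin m → MulAut F2} (h : Defines τ) : Defines fun i => (τ i)⁻¹ :=
  defines_iff_braid.2 fun i j hij => (defines_iff_braid.1 h i j hij).inverse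

lemma WordsDefine.swap {w : Fin m → WordPair} (h : WordsDefine w) :
    WordsDefine fun i => swapPair (w i.rev) := by
  obtain ⟨τ, rfl, hτ⟩ := wordsDefine_iff.1 h
  refine wordsDefine_iff.2 ⟨fun i => swapConj (τ i.rev), ?_, defines_iff_braid.2 fun i j hij => ?_⟩
  · funext i
    exact Prod.ext (swapConj_a _) (swapConj_b _)
  · exact (defines_iff_braid.1 hτ j.rev i.rev (by simp only [Fin.val_rev]; omega)).swap

lemma WordsDefine.backward {w : Fin m → WordPair} (h : WordsDefine w) :
    WordsDefine fun i => backPair (w i) := by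
  obtain ⟨τ, rfl, hτ⟩ := wordsDefine_iff.1 h
  refine wordsDefine_iff.2 ⟨fun i => backConj (τ i), ?_, defines_iff_braid.2 fun i j hij => ?_⟩
  · funext i
    exact Prod.ext (backConj_a _) (backConj_b _)
  · exact (defines_iff_braid.1 hτ i j hij).backward

lemma wordsDefine_coreWords {τ : Fin m → MulAut F2} : WordsDefine (coreWords τ) ↔ Defines τ := by
  rw [wordsDefine_iff]
  constructor
  · rintro ⟨τ', h, h'⟩
    rwa [← coreWords_injective h]
  · exact fun h => ⟨τ, rfl, h⟩

lemma SymmetryStep.wordsDefine_iff {w w' : Fin m → WordPair} (h : SymmetryStep w w') :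
    WordsDefine w ↔ WordsDefine w' := by
  cases h with
  | inverse τ =>
    rw [wordsDefine_coreWords, wordsDefine_coreWords]
    exact ⟨Defines.inverse, fun h => by simpa using h.inverse⟩
  | swap =>
    refine ⟨WordsDefine.swap, fun h => ?_⟩
    have := h.swap
    simpa [swapPair] using this
  | backward =>
    refine ⟨WordsDefine.backward, fun h => ?_⟩
    have := WordsDefine.backward h
    change WordsDefine fun i => backPair (backPair (w i)) at this
    simpa only [backPair_backPair] using this

theorem SymmEquiv.wordsDefine_iff {w w' : Fin m → WordPair} (h : SymmEquiv w w') :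
    WordsDefine w ↔ WordsDefine w' := by
  induction h with
  | rel _ _ h => exact h.wordsDefine_iff
  | refl => rfl
  | symm _ _ _ ih => exact ih.symm
  | trans _ _ _ _ _ ih ih' => exact ih.trans ih'

lemma symmEquiv_swap (v w : WordPair) : SymmEquiv ![v, w] ![swapPair w, swapPair v] := by
  have : ![swapPair w, swapPair v] = fun i : Fin 2 =>
      (swapLetters (![v, w] i.rev).2, swapLetters (![v, w] i.rev).1) := by
    funext i; fin_cases i <;> rfl
  rw [this]
  exact .rel _ _ (.swap _)

lemma symmEquiv_backward (v w : WordPair) : SymmEquiv ![v, w] ![backPair v, backPair w] := by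
  have : ![backPair v, backPair w] = fun i : Fin 2 =>
      (readBackward (![v, w] i).1, readBackward (![v, w] i).2) := by
    funext i; fin_cases i <;> rfl
  rw [this]
  exact .rel _ _ (.backward _)

lemma symmEquiv_inverse {v w v' w' : WordPair} (hv : InversePair v v') (hw : InversePair w w') :
    SymmEquiv ![v, w] ![v', w'] := by
  obtain ⟨s, rfl, rfl⟩ := hv
  obtain ⟨t, rfl, rfl⟩ := hw
  have h1 : ![(s a, s b), (t a, t b)] = coreWords ![s, t] := by
    funext i; fin_cases i <;> rfl
  have h2 : ![(s⁻¹ a, s⁻¹ b), (t⁻¹ a, t⁻¹ b)] = coreWords fun i => (![s, t] i)⁻¹ := by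
    funext i; fin_cases i <;> rfl
  rw [h1, h2]
  exact .rel _ _ (.inverse _)

end NaturalSymmetries

/-! ### The list of quadruples -/

section List

lemma Listed.isEdge {A B C D : F2} (h : Listed A B C D) : IsEdge (A, B) (C, D) := by
  cases h
  case T => exact .T
  case T' => exact .T'
  case A1 r => exact .A00 r
  case A2 r => exact .A01 r
  case A3 r => exact .A13 r
  case B1 => exact .B 0 0
  case B2 => exact .B 0 1
  case C1 => exact .C 0 0
  case C2 => exact .C 0 1
  case C3 => exact .C 1 1
  case D1 => exact .D00
  case D2 => exact .D10
  case D3 => exact .D02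
  case D4 => exact .D12

/-- The pair `![v, w]` is equivalent to a listed quadruple. -/
def EquivListed (v w : WordPair) : Prop :=
  ∃ A B C D : F2, SymmEquiv ![v, w] (quad A B C D) ∧ Listed A B C D

lemma EquivListed.of_symmEquiv {v w v' w' : WordPair} (h : EquivListed v' w')
    (h' : SymmEquiv ![v, w] ![v', w']) : EquivListed v w := by
  obtain ⟨A, B, C, D, h1, h2⟩ := h
  exact ⟨A, B, C, D, .trans _ _ _ h' h1, h2⟩

lemma EquivListed.of_listed {v w : WordPair} (h : Listed v.1 v.2 w.1 w.2) : EquivListed v w :=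
  ⟨_, _, _, _, .refl _, h⟩

lemma EquivListed.of_backward {v w v' w' : WordPair} (h : EquivListed v' w')
    (hv : backPair v = v') (hw : backPair w = w') : EquivListed v w := by
  subst hv hw
  exact h.of_symmEquiv (symmEquiv_backward v w)

/-- Inverse and swap each leave the swapped order of a pair manageable only together: the inverses
are swapped words in reversed order, and the swap restores words and order. -/
lemma EquivListed.of_inverse_swap {v w v' w' : WordPair} (h : EquivListed v' w')
    (hv : InversePair v (swapPair w')) (hw : InversePair w (swapPair v')) : EquivListed v w := by
  have := symmEquiv_swap (swapPair w') (swapPair v')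
  rw [swapPair_swapPair, swapPair_swapPair] at this
  exact h.of_symmEquiv (.trans _ _ _ (symmEquiv_inverse hv hw) this)

lemma backPair_vAz (r ε : ℤ) : backPair (vAz r ε) = vAz (-r) ε := by
  simp [backPair, vAz, readBackward_eq, mul_assoc]

lemma backPair_vA (r : ℕ) : backPair (vA r 0) = vA r 2 ∧ backPair (vA r 1) = vA r 3 ∧
    backPair (vA r 2) = vA r 0 ∧ backPair (vA r 3) = vA r 1 := by
  simp only [← vAz_natCast_one, ← vAz_natCast_neg_one, ← vAz_neg_natCast_one,
    ← vAz_neg_natCast_neg_one, backPair_vAz, neg_neg, and_self]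

lemma backPair_vD : backPair (vD 1) = vD 2 ∧ backPair (vD 2) = vD 1 ∧ backPair (vD 3) = vD 0 := by
  decide

lemma equivListed_A12 (r : ℕ) : EquivListed (vA r 1) (vA r 2) := by
  have h : EquivListed (vA r 0) (vA r 1) := .of_listed (.A2 r)
  refine h.of_inverse_swap ?_ ?_
  · rw [← vAz_natCast_neg_one]
    simpa using inversePair_vAz (.inr rfl) (r : ℤ)
  · rw [← vAz_natCast_one, ← vAz_neg_natCast_one]
    simpa using inversePair_vAz (.inl rfl) (-r : ℤ)

/-- Backward exchanges the first and third, and the second and fourth, vertices of `A_r`; on `D` it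
exchanges the first with the fourth and the second with the third. What this does not reach is
obtained by inverse, alone for `B` and followed by swap for `A_r` and `C`. -/
theorem IsEdge.equivListed {v w : WordPair} (h : IsEdge v w) : EquivListed v w := by
  cases h
  case T => exact .of_listed .T
  case T' => exact .of_listed .T'
  case A00 r => exact .of_listed (.A1 r)
  case A01 r => exact .of_listed (.A2 r)
  case A12 r => exact equivListed_A12 r
  case A13 r => exact .of_listed (.A3 r)
  case A22 r =>
    exact (EquivListed.of_listed (.A1 r)).of_backward (backPair_vA r).2.2.1 (backPair_vA r).2.2.1
  case A23 r =>
    exact (EquivListed.of_listed (.A2 r)).of_backward (backPair_vA r).2.2.1 (backPair_vA r).2.2.2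
  case A30 r =>
    exact (equivListed_A12 r).of_backward (backPair_vA r).2.2.2 (backPair_vA r).1
  case A31 r =>
    exact (EquivListed.of_listed (.A3 r)).of_backward (backPair_vA r).2.2.2 (backPair_vA r).2.1
  case B k l =>
    have h1 : EquivListed (vB 0) (vB 0) := .of_listed .B1
    have h2 : EquivListed (vB 0) (vB 1) := .of_listed .B2
    fin_cases k <;> fin_cases l
    · exact h1
    · exact h2
    · exact h2.of_symmEquiv (symmEquiv_inverse inversePair_vB.2 inversePair_vB.1)
    · exact h1.of_symmEquiv (symmEquiv_inverse inversePair_vB.2 inversePair_vB.2)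
  case C k l =>
    have h1 : EquivListed (vC 0) (vC 1) := .of_listed .C2
    fin_cases k <;> fin_cases l
    · exact .of_listed .C1
    · exact h1
    · exact h1.of_inverse_swap (inversePair_vC 1) (inversePair_vC 0)
    · exact .of_listed .C3
  case D00 => exact .of_listed .D1
  case D02 => exact .of_listed .D3
  case D10 => exact .of_listed .D2
  case D12 => exact .of_listed .D4
  case D21 =>
    exact (EquivListed.of_listed .D4).of_backward backPair_vD.2.1 backPair_vD.1
  case D23 =>
    exact (EquivListed.of_listed .D2).of_backward backPair_vD.2.1 backPair_vD.2.2
  case D31 =>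
    exact (EquivListed.of_listed .D3).of_backward backPair_vD.2.2 backPair_vD.1
  case D33 =>
    exact (EquivListed.of_listed .D1).of_backward backPair_vD.2.2 backPair_vD.2.2

end List

/-! ### Paths of `Γ` -/

section Paths

variable {m : ℕ}

lemma WordBraid.classify {v w : WordPair} (h : WordBraid v w) :
    IsEdge v w ∨ (IsEdge (swapPair w) (swapPair v) ∧ ¬ IsVertex v ∧ ¬ IsVertex w) := by
  obtain ⟨s, t, rfl, rfl, h⟩ := h
  exact h.classify

theorem isEdge_iff_wordBraid {v w : WordPair} (hv : IsVertex v) : IsEdge v w ↔ WordBraid v w := by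
  refine ⟨IsEdge.wordBraid, fun h => ?_⟩
  rcases h.classify with h | ⟨-, h, -⟩
  · exact h
  · exact absurd hv h

lemma wordsDefine_pathWords (hm : 2 ≤ m) {γ : Fin m → {v : WordPair // IsVertex v}}
    (h : IsEdgePath γ) : WordsDefine (pathWords γ) :=
  (wordsDefine_iff_wordBraid hm).2 fun i j hij => (h i j hij).wordBraid

lemma exists_path_of_isEdge (hm : 2 ≤ m) {w : Fin m → WordPair}
    (h : ∀ i j : Fin m, i.val + 1 = j.val → IsEdge (w i) (w j)) :
    ∃ γ : Fin m → {v : WordPair // IsVertex v}, IsEdgePath γ ∧ pathWords γ = w := by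
  have hv : ∀ i, IsVertex (w i) := by
    intro i
    by_cases hi : i.val + 1 < m
    · exact (h i ⟨i + 1, hi⟩ rfl).isVertex.1
    · exact (h ⟨i - 1, by omega⟩ i (by simp only; omega)).isVertex.2
  exact ⟨fun i => ⟨w i, hv i⟩, h, rfl⟩

/-- By the dichotomy of `WordBraid.classify`, whether the first pair of words is a vertex of `Γ`
propagates along the sequence. So all consecutive pairs are edges of `Γ`, or all are swapped edges
and one swap suffices. -/
theorem exists_path_of_wordsDefine (hm : 2 ≤ m) {w : Fin m → WordPair} (h : WordsDefine w) :
    ∃ γ : Fin m → {v : WordPair // IsVertex v}, IsEdgePath γ ∧ SymmEquiv w (pathWords γ) := by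
  rw [wordsDefine_iff_wordBraid hm] at h
  by_cases h0 : IsVertex (w ⟨0, by omega⟩)
  · have hv : ∀ n (hn : n < m), IsVertex (w ⟨n, hn⟩) := by
      intro n
      induction n with
      | zero => exact fun _ => h0
      | succ n ih =>
        intro hn
        exact ((isEdge_iff_wordBraid (ih (by omega))).2 (h ⟨n, by omega⟩ ⟨n + 1, hn⟩ rfl)).isVertex.2
    obtain ⟨γ, hγ, hw⟩ := exists_path_of_isEdge (w := w) hm fun i j hij =>
      (isEdge_iff_wordBraid (hv i i.2)).2 (h i j hij)
    exact ⟨γ, hγ, hw ▸ .refl _⟩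
  · have hv : ∀ n (hn : n < m), ¬ IsVertex (w ⟨n, hn⟩) := by
      intro n
      induction n with
      | zero => exact fun _ => h0
      | succ n ih =>
        intro hn
        rcases (h ⟨n, by omega⟩ ⟨n + 1, hn⟩ rfl).classify with h | ⟨-, -, h⟩
        · exact absurd h.isVertex.1 (ih (by omega))
        · exact h
    -- Swapping reverses edges, which the reversal of indices in the swap symmetry compensates.
    have hE : ∀ i j : Fin m, i.val + 1 = j.val → IsEdge (swapPair (w i.rev)) (swapPair (w j.rev)) := by
      intro i j hij
      rcases (h j.rev i.rev (by simp only [Fin.val_rev]; omega)).classify with h | ⟨h, -⟩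
      · exact absurd h.isVertex.1 (hv _ _)
      · exact h
    obtain ⟨γ, hγ, hw⟩ := exists_path_of_isEdge hm hE
    refine ⟨γ, hγ, ?_⟩
    rw [hw]
    exact .rel _ _ (.swap w)

end Paths

end LocalBraid

theorem theorem1 :
    -- classification of quadruples
    (∀ A B C D : F2, WordsDefine (quad A B C D) ↔
      ∃ A' B' C' D' : F2, SymmEquiv (quad A B C D) (quad A' B' C' D') ∧ Listed A' B' C' D') ∧
    -- a local representation of `B_{m+1}` has a unique sequence of cores
    (∀ (m : ℕ) (Θ : BraidRep m), Θ.IsLocal → ∃! τ : Fin m → MulAut F2, Θ.HasCores τ) ∧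
    -- reduction of `B_{m+1}` to `B_3`
    (∀ (m : ℕ) (τ : Fin m → MulAut F2), Defines τ ↔
      ∀ i j : Fin m, i.val + 1 = j.val → Defines ![τ i, τ j]) ∧
    -- the edges of `Γ` are exactly the local representations of `B_3` between its vertices
    (∀ v w : {v : WordPair // IsVertex v}, Gamma.Adj v w ↔ WordsDefine ![v.1, w.1]) ∧
    -- each edge-path gives exactly one local representation
    (∀ (m : ℕ), 2 ≤ m → ∀ γ : Fin m → {v : WordPair // IsVertex v}, IsEdgePath γ →
      ∃! Θ : BraidRep m, Θ.IsLocal ∧ Θ.HasCoreWords (pathWords γ)) ∧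
    -- up to natural symmetries, all local representations arise from edge-paths
    (∀ (m : ℕ), 2 ≤ m → ∀ w : Fin m → WordPair, WordsDefine w ↔
      ∃ γ : Fin m → {v : WordPair // IsVertex v}, IsEdgePath γ ∧
        SymmEquiv w (pathWords γ)) := by
  refine ⟨fun A B C D => ⟨fun h => ?_, ?_⟩, fun m Θ h => h.existsUnique_hasCores, fun m τ => ?_,
    fun v w => ?_, fun m hm γ hγ => (LocalBraid.wordsDefine_pathWords hm hγ).existsUnique,
    fun m hm w => ⟨LocalBraid.exists_path_of_wordsDefine hm, ?_⟩⟩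
  · rcases (LocalBraid.wordsDefine_pair_iff.1 h).classify with h | ⟨h, -⟩
    · exact h.equivListed
    · exact h.equivListed.of_symmEquiv (LocalBraid.symmEquiv_swap _ _)
  · rintro ⟨A', B', C', D', h, hL⟩
    exact h.wordsDefine_iff.2 (LocalBraid.wordsDefine_pair_iff.2 hL.isEdge.wordBraid)
  · rw [LocalBraid.defines_iff_braid]
    simp only [LocalBraid.defines_pair_iff]
  · rw [LocalBraid.wordsDefine_pair_iff]
    exact LocalBraid.isEdge_iff_wordBraid v.2
  · rintro ⟨γ, hγ, h⟩
    exact h.wordsDefine_iff.2 (LocalBraid.wordsDefine_pathWords hm hγ)
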